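/- Let $p$ be a prime number and let $\epsilon\in(0,1-1/p]$ be a fixed real number. A random variable $\xi\in\mathbb{F}_p$ is called $\epsilon$-balanced if $\mathbf{P}(\xi=a)\le 1-\epsilon$ for all $a\in\mathbb{F}_p$. For each $n$, let $A_n$ be a random $n\times n$ matrix over $\mathbb{F}_p$ whose entries are independent and $\epsilon$-balanced (they need not be identically distributed, and their distributions may depend on $n$). Let $f_1,\ldots,f_r\in\mathbb{F}_p[t]$ be distinct monic, irreducible, nonconstant polynomials, and for $1\le i\le r$ let $e_i=e_i(A_n)\in\mathbb{Z}_{\ge 0}$ be the multiplicity of $f_i$ in the characteristic polynomial $\det(tI_n-A_n)$. Then the distribution of $(e_1,\ldots,e_r)$ converges pointwise to the product measure $\prod_{i=1}^r\nu_{f_i}$ on $\mathbb{Z}_{\ge 0}^r$ as $n\to\infty$: for all $(j_1,\ldots,j_r)\in\mathbb{Z}_{\ge 0}^r$, $$\lim_{n\to\infty}\mathbf{P}(e_1=j_1,\ldots,e_r=j_r)=\prod_{i=1}^r\nu_{f_i}(j_i),$$ where for all $1\le i\le r$, $$\nu_{f_i}(j)=p^{-j\deg f_i}\prod_{k\ge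 j+1}(1-p^{-k\deg f_i}),\qquad j\in\mathbb{Z}_{\ge 0}.$$ -/

import Mathlib

open MeasureTheory ProbabilityTheory Filter Topology Polynomial

/-- A random variable `ξ` with values in `𝔽_p` is `ε`-balanced if `P(ξ = a) ≤ 1 - ε` for all
`a ∈ 𝔽_p`. -/
def IsEpsBalanced {Ω : Type*} [MeasurableSpace Ω] (P : Measure Ω) {p : ℕ} (ε : ℝ)
    (ξ : Ω → ZMod p) : Prop :=
  ∀ a : ZMod p, P.real {ω | ξ ω = a} ≤ 1 - ε

/-- The power of `f` in the characteristic polynomial `det (t I_n - A)` of `A`. -/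
noncomputable def charpolyPower {p n : ℕ} (f : (ZMod p)[X]) (A : Matrix (Fin n) (Fin n) (ZMod p)) :
    ℕ :=
  multiplicity f A.charpoly

/-- The mass `ν_f(j) = p^{-j deg f} ∏_{k ≥ j+1} (1 - p^{-k deg f})`; the index of the infinite
product is shifted to start at `0`. -/
noncomputable def nuMass {p : ℕ} (f : (ZMod p)[X]) (j : ℕ) : ℝ :=
  ((p : ℝ)⁻¹) ^ (j * f.natDegree) * ∏' k : ℕ, (1 - ((p : ℝ)⁻¹) ^ ((j + 1 + k) * f.natDegree))

/-- The measure `ν_f` on `ℤ_{≥ 0}` with point masses `ν_f(j)`. -/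
noncomputable def nuMeasure {p : ℕ} (f : (ZMod p)[X]) : Measure ℕ :=
  Measure.sum fun j : ℕ => ENNReal.ofReal (nuMass f j) • Measure.dirac j

/-! Regard `𝔽_p^n` as an `𝔽_p[X]`-module `V` on which `X` acts as `A`. The proof is a moment method
for surjections out of `V`. For a fixed finite space `W` with an endomorphism `T`, the expected
number of surjections `φ : V → W` with `φ A = T φ` tends to 1, whatever `T` is
(`tendsto_sum_matrixWeight_mul_card`). Such a `φ` is a spanning family of `n` vectors of `W`, and
each column of `A` has to combine that family to a prescribed vector. By Fourier analysis this has
probability close to `1 / |W|`, unless some nonzero functional vanishes on almost all of the family;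
the families with such a functional contribute negligibly.

Put `g = ∏ f_i ^ j_i` and let `W` have dimension `deg g`. The multiplicities are the `j_i` exactly
when `V` has a quotient with characteristic polynomial `g` whose kernel has no nonzero map to any
`F[X]/(f_i)`; the kernel is then `gV`. So pairs `(B, φ)`, with `B` of characteristic polynomial `g`
and `φ : V → (W, B)` a surjection with such a kernel, number `|GL(W)|` on the event and 0 off it
(`card_sigma_surjections_eq_ite`).

For fixed `B` the kernel condition is extracted from moments. The `q`-factorial moments of the ranks
of `Hom(ker φ, F[X]/(f_i))` count surjections from `ker φ` onto `∏ (F[X]/(f_i)) ^ k_i`. Up to a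
constant these are surjections from `V` onto extensions of `W`
(`sum_card_surjections_ker_mul_card`), so all these moments tend to 1. Inclusion–exclusion over
subspaces then gives the limit `∏_i ∏_k (1 - q_i ^ (-k))` with `q_i = p ^ deg f_i`
(`tendsto_sum_ranks_zero`).

What remains is the number of `B` divided by `|GL(W)|`. Sorting pairs `(B, v)` by the annihilator of
`v` yields a recursion that factors over the `f_i` (`charpolyDensity_eq_prod`) and supplies the
missing factor of `ν_{f_i}(j_i)`. -/

/-! ### Characters and hitting probabilities of random linear combinations. -/

section Fourier

variable {p : ℕ} [Fact p.Prime]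

/-- Probability weights on `ZMod p` with no atom heavier than `1 - ε`. -/
structure IsBalancedWeight (ε : ℝ) (m : ZMod p → ℝ) : Prop where
  nonneg : ∀ x, 0 ≤ m x
  sum_eq_one : ∑ x, m x = 1
  le : ∀ x, m x ≤ 1 - ε

/-- The Fourier coefficients of balanced weights at nonzero frequencies are uniformly bounded
away from one. -/
theorem exists_norm_charSum_le {ε : ℝ} (hε : 0 < ε) :
    ∃ ρ : ℝ, 0 ≤ ρ ∧ ρ < 1 ∧ ∀ m : ZMod p → ℝ, IsBalancedWeight ε m → ∀ c : ZMod p, c ≠ 0 →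
      ‖∑ x, (m x : ℂ) * ZMod.stdAddChar (x * c)‖ ≤ ρ := by
  classical
  have hnorm : ∀ u : ZMod p, ‖(ZMod.stdAddChar u : ℂ)‖ = 1 := fun u => by
    rw [ZMod.stdAddChar_apply]; exact Circle.norm_coe _
  have hre : ∀ u : ZMod p, u ≠ 0 → (ZMod.stdAddChar u : ℂ).re < 1 := by
    intro u hu
    refine lt_of_le_of_ne ((Complex.re_le_norm _).trans (hnorm u).le) fun h => hu ?_
    apply ZMod.injective_stdAddChar
    rw [AddChar.map_zero_eq_one]
    have h1 := Complex.sq_norm (ZMod.stdAddChar u : ℂ)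
    rw [hnorm, Complex.normSq_apply, h] at h1
    have h2 : (ZMod.stdAddChar u : ℂ).im = 0 := by nlinarith
    exact Complex.ext (by simpa using h) (by simpa using h2)
  -- A spectral gap: only finitely many nonzero frequencies compete for the maximal real part.
  obtain ⟨κ, hκ0, hκ⟩ : ∃ κ : ℝ, 0 < κ ∧ ∀ u : ZMod p, u ≠ 0 →
      (ZMod.stdAddChar u : ℂ).re ≤ 1 - κ := by
    obtain ⟨u, hu, hmax⟩ := (Finset.univ.erase (0 : ZMod p)).exists_max_image
      (fun u => (ZMod.stdAddChar u : ℂ).re) ⟨1, by simp⟩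
    refine ⟨1 - (ZMod.stdAddChar u : ℂ).re, sub_pos.2 (hre u (by simpa using hu)), fun w hw => ?_⟩
    have := hmax w (by simpa using hw)
    linarith
  -- The squared modulus is the mean of `Re e((x - y)c)` over two independent copies `x`, `y`. Each
  -- off-diagonal pair loses at least `κ`, and the diagonal has mass `∑ m x ^ 2 ≤ 1 - ε`.
  refine ⟨√(1 - κ * ε), Real.sqrt_nonneg _, ?_, fun m hm c hc => ?_⟩
  · rw [Real.sqrt_lt' one_pos]; nlinarith
  apply Real.le_sqrt_of_sq_le
  have hsq : ‖∑ x, (m x : ℂ) * ZMod.stdAddChar (x * c)‖ ^ 2 =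
      ∑ x, ∑ y, m x * m y * (ZMod.stdAddChar ((x - y) * c) : ℂ).re := by
    have h1 : ((‖∑ x, (m x : ℂ) * ZMod.stdAddChar (x * c)‖ ^ 2 : ℝ) : ℂ) =
        ∑ x, ∑ y, (m x : ℂ) * m y * (ZMod.stdAddChar ((x - y) * c) : ℂ) := by
      push_cast
      rw [← Complex.mul_conj', map_sum, Finset.sum_mul_sum]
      refine Finset.sum_congr rfl fun x _ => Finset.sum_congr rfl fun y _ => ?_
      rw [map_mul (starRingEnd ℂ), Complex.conj_ofReal, sub_mul, sub_eq_add_neg, AddChar.map_add_eq_mul,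
        ZMod.stdAddChar_apply (-(y * c)), AddChar.map_neg_eq_inv, Circle.coe_inv_eq_conj,
        ← ZMod.stdAddChar_apply]
      ring
    have h2 := congrArg Complex.re h1
    rw [Complex.ofReal_re] at h2
    rw [h2, Complex.re_sum]
    refine Finset.sum_congr rfl fun x _ => ?_
    rw [Complex.re_sum]
    refine Finset.sum_congr rfl fun y _ => ?_
    rw [← Complex.ofReal_mul, Complex.re_ofReal_mul]
  rw [hsq]
  have hbd : ∀ x y : ZMod p, m x * m y * (ZMod.stdAddChar ((x - y) * c) : ℂ).re ≤
      m x * m y * (1 - κ) + if x = y then m x * (κ * m y) else 0 := by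
    intro x y
    have h0 := mul_nonneg (hm.nonneg x) (hm.nonneg y)
    split_ifs with h
    · subst h; simp; nlinarith
    · rw [add_zero]
      exact mul_le_mul_of_nonneg_left (hκ _ (mul_ne_zero (sub_ne_zero.2 h) hc)) h0
  calc _ ≤ ∑ x, ∑ y, (m x * m y * (1 - κ) + if x = y then m x * (κ * m y) else 0) :=
        Finset.sum_le_sum fun x _ => Finset.sum_le_sum fun y _ => hbd x y
    _ = (1 - κ) + ∑ x, m x * (κ * m x) := by
        simp only [Finset.sum_add_distrib, Finset.sum_ite_eq, Finset.mem_univ, if_true,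
          ← Finset.mul_sum, ← Finset.sum_mul, hm.sum_eq_one]
        ring
    _ ≤ (1 - κ) + ∑ x, m x * (κ * (1 - ε)) := by
        gcongr with x
        · exact hm.nonneg x
        · exact hm.le x
    _ = 1 - κ * ε := by rw [← Finset.sum_mul, hm.sum_eq_one]; ring

variable {W : Type*} [AddCommGroup W] [Module (ZMod p) W] {ι : Type*} [Fintype ι]

/-- The number of coordinates of `v` seen by the functional `ψ`. -/
noncomputable def dualWeight (ψ : Module.Dual (ZMod p) W) (v : ι → W) : ℕ :=
  {i | ψ (v i) ≠ 0}.ncard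

/-- Coordinates killed by `ψ` give the factor 1, and each of the others at most `ρ`. -/
theorem norm_prod_charSum_le {ε ρ : ℝ} (hρ : ∀ m : ZMod p → ℝ, IsBalancedWeight ε m →
      ∀ c : ZMod p, c ≠ 0 → ‖∑ x, (m x : ℂ) * ZMod.stdAddChar (x * c)‖ ≤ ρ)
    {m : ι → ZMod p → ℝ} (hm : ∀ i, IsBalancedWeight ε (m i)) (v : ι → W) (y : W)
    (ψ : Module.Dual (ZMod p) W) :
    ‖(ZMod.stdAddChar (-ψ y) : ℂ) * ∏ i, ∑ x, (m i x : ℂ) * ZMod.stdAddChar (x * ψ (v i))‖ ≤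
      ρ ^ dualWeight ψ v := by
  classical
  have hnorm : ∀ u : ZMod p, ‖(ZMod.stdAddChar u : ℂ)‖ = 1 := fun u => by
    rw [ZMod.stdAddChar_apply]; exact Circle.norm_coe _
  rw [norm_mul, hnorm, one_mul, norm_prod, dualWeight, Set.ncard_eq_toFinset_card',
    ← Finset.prod_const]
  rw [← Finset.prod_subset (Finset.subset_univ (Set.toFinset {i | ψ (v i) ≠ 0}))]
  · refine Finset.prod_le_prod (fun _ _ => norm_nonneg _) fun i hi => ?_
    exact hρ _ (hm i) _ (by simpa using hi)
  · intro i _ hi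
    have h0 : ψ (v i) = 0 := by simpa using hi
    have : ∑ x, (m i x : ℂ) = 1 := by exact_mod_cast (hm i).sum_eq_one
    simp [h0, this]

variable [DecidableEq ι]

open Classical in
/-- The probability that a random linear combination of the vectors `v i`, with independent
coefficients of law `m i`, equals `y`. -/
noncomputable def hitProb (m : ι → ZMod p → ℝ) (v : ι → W) (y : W) : ℝ :=
  ∑ a : ι → ZMod p, (∏ i, m i (a i)) * if ∑ i, a i • v i = y then 1 else 0

theorem hitProb_nonneg {ε : ℝ} {m : ι → ZMod p → ℝ} (hm : ∀ i, IsBalancedWeight ε (m i))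
    (v : ι → W) (y : W) : 0 ≤ hitProb m v y :=
  Finset.sum_nonneg fun a _ => mul_nonneg (Finset.prod_nonneg fun i _ => (hm i).nonneg _)
    (by split_ifs <;> norm_num)

variable [Fintype W] [Fintype (Module.Dual (ZMod p) W)]

theorem card_dual_eq : Fintype.card (Module.Dual (ZMod p) W) = Fintype.card W := by
  rw [Module.card_eq_pow_finrank (K := ZMod p), Module.card_eq_pow_finrank (K := ZMod p) (V := W),
    Subspace.dual_finrank_eq]

theorem sum_dual_stdAddChar [DecidableEq W] (z : W) :
    ∑ ψ : Module.Dual (ZMod p) W, (ZMod.stdAddChar (ψ z) : ℂ) =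
      if z = 0 then (Fintype.card W : ℂ) else 0 := by
  classical
  split_ifs with h
  · simp [h, card_dual_eq]
  · obtain ⟨ψ, hψ⟩ : ∃ ψ : Module.Dual (ZMod p) W, ψ z ≠ 0 := by
      by_contra! hcon
      exact h ((Module.forall_dual_apply_eq_zero_iff (ZMod p) z).1 hcon)
    let θ : AddChar (Module.Dual (ZMod p) W) ℂ :=
      (ZMod.stdAddChar (N := p)).compAddMonoidHom (LinearMap.applyₗ z).toAddMonoidHom
    have hθ : θ ≠ 0 := by
      rw [AddChar.ne_zero_iff]
      refine ⟨ψ, fun h1 => hψ (ZMod.injective_stdAddChar ?_)⟩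
      rw [AddChar.map_zero_eq_one]
      exact h1
    exact AddChar.sum_eq_zero_iff_ne_zero.2 hθ

/-- Fourier inversion on `W`: the indicator of a vector being 0 is the average of `e(ψ z)` over
functionals, and independence factors each average. -/
theorem card_mul_hitProb (m : ι → ZMod p → ℝ) (v : ι → W) (y : W) :
    (Fintype.card W : ℂ) * hitProb m v y = ∑ ψ : Module.Dual (ZMod p) W,
      ZMod.stdAddChar (-ψ y) * ∏ i, ∑ x, (m i x : ℂ) * ZMod.stdAddChar (x * ψ (v i)) := by
  classical
  have h1 : ∀ ψ : Module.Dual (ZMod p) W,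
      (ZMod.stdAddChar (-ψ y) : ℂ) * ∏ i, ∑ x, (m i x : ℂ) * ZMod.stdAddChar (x * ψ (v i)) =
      ∑ a : ι → ZMod p, (∏ i, (m i (a i) : ℂ)) *
        ZMod.stdAddChar (ψ (∑ i, a i • v i - y)) := by
    intro ψ
    rw [Finset.prod_univ_sum, Fintype.piFinset_univ, Finset.mul_sum]
    refine Finset.sum_congr rfl fun a _ => ?_
    rw [Finset.prod_mul_distrib, map_sub, map_sum, sub_eq_add_neg, AddChar.map_add_eq_mul]
    have : (ZMod.stdAddChar (∑ i, ψ (a i • v i)) : ℂ) =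
        ∏ i, ZMod.stdAddChar (a i * ψ (v i)) := by
      simp only [map_smul, smul_eq_mul]
      exact map_prod (ZMod.stdAddChar (N := p)).toMonoidHom
        (fun i => Multiplicative.ofAdd (a i * ψ (v i))) _
    rw [this]; ring
  simp_rw [h1]
  rw [Finset.sum_comm]
  simp_rw [← Finset.mul_sum, sum_dual_stdAddChar, sub_eq_zero]
  rw [hitProb]
  push_cast
  rw [Finset.mul_sum]
  refine Finset.sum_congr rfl fun a _ => ?_
  split_ifs <;> simp [mul_comm]

theorem card_mul_hitProb_le {ε ρ : ℝ} (hρ : ∀ m : ZMod p → ℝ, IsBalancedWeight ε m →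
      ∀ c : ZMod p, c ≠ 0 → ‖∑ x, (m x : ℂ) * ZMod.stdAddChar (x * c)‖ ≤ ρ)
    {m : ι → ZMod p → ℝ} (hm : ∀ i, IsBalancedWeight ε (m i)) (v : ι → W) (y : W) :
    (Fintype.card W : ℝ) * hitProb m v y ≤ ∑ ψ : Module.Dual (ZMod p) W, ρ ^ dualWeight ψ v := by
  have h := card_mul_hitProb m v y
  have h2 : ‖(Fintype.card W : ℂ) * hitProb m v y‖ = Fintype.card W * hitProb m v y := by
    rw [norm_mul, Complex.norm_natCast, Complex.norm_real,
      Real.norm_of_nonneg (hitProb_nonneg hm v y)]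
  rw [← h2, h]
  exact (norm_sum_le _ _).trans (Finset.sum_le_sum fun ψ _ => norm_prod_charSum_le hρ hm v y ψ)

/-- The zero functional contributes exactly 1, the uniform value; the others measure the deviation
from it. -/
theorem abs_card_mul_hitProb_sub_one_le [DecidableEq (Module.Dual (ZMod p) W)] {ε ρ : ℝ}
    (hρ : ∀ m : ZMod p → ℝ, IsBalancedWeight ε m →
      ∀ c : ZMod p, c ≠ 0 → ‖∑ x, (m x : ℂ) * ZMod.stdAddChar (x * c)‖ ≤ ρ)
    {m : ι → ZMod p → ℝ} (hm : ∀ i, IsBalancedWeight ε (m i)) (v : ι → W) (y : W) :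
    |(Fintype.card W : ℝ) * hitProb m v y - 1| ≤
      ∑ ψ ∈ Finset.univ.erase (0 : Module.Dual (ZMod p) W), ρ ^ dualWeight ψ v := by
  have h := card_mul_hitProb m v y
  rw [← Finset.add_sum_erase _ _ (Finset.mem_univ (0 : Module.Dual (ZMod p) W))] at h
  have h0 : (ZMod.stdAddChar (-(0 : Module.Dual (ZMod p) W) y) : ℂ) *
      ∏ i, ∑ x, (m i x : ℂ) * ZMod.stdAddChar (x * (0 : Module.Dual (ZMod p) W) (v i)) = 1 := by
    have : ∀ i, ∑ x, (m i x : ℂ) = 1 := fun i => by exact_mod_cast (hm i).sum_eq_one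
    simp [this]
  rw [h0] at h
  have h2 : ‖(Fintype.card W : ℂ) * hitProb m v y - 1‖ = |Fintype.card W * hitProb m v y - 1| := by
    rw [← Real.norm_eq_abs, ← Complex.norm_real]; push_cast; rfl
  rw [← h2, h, add_sub_cancel_left]
  exact (norm_sum_le _ _).trans (Finset.sum_le_sum fun ψ _ => norm_prod_charSum_le hρ hm v y ψ)

end Fourier

/-! ### Counting families on which many functionals nearly vanish. -/

section Counting

variable {p : ℕ} [Fact p.Prime] {W : Type*} [AddCommGroup W] [Module (ZMod p) W] [Fintype W]
  [Fintype (Module.Dual (ZMod p) W)] {ι : Type*} [Fintype ι]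

/-- Duality: `B` lies in its span, and a subspace of the dual and its annihilator have sizes with
product `|W|`. -/
theorem card_mul_card_commonZeros_le (B : Finset (Module.Dual (ZMod p) W)) :
    B.card * Nat.card {y : W // ∀ ψ ∈ B, ψ y = 0} ≤ Fintype.card W := by
  classical
  set U : Subspace (ZMod p) (Module.Dual (ZMod p) W) := Submodule.span (ZMod p) (B : Set _)
  have h1 : B.card ≤ Nat.card U := by
    have h0 : Nat.card B = B.card := by simp
    rw [← h0]
    exact Nat.card_le_card_of_injective (fun x : B => (⟨x, Submodule.subset_span x.2⟩ : U))
      fun x y h => Subtype.ext (congrArg (fun z : U => (z : Module.Dual (ZMod p) W)) h)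
  have h2 : Nat.card {y : W // ∀ ψ ∈ B, ψ y = 0} = Nat.card U.dualCoannihilator := by
    refine Nat.card_congr (Equiv.subtypeEquivRight fun y => ?_)
    rw [Submodule.mem_dualCoannihilator]
    refine ⟨fun h ψ hψ => ?_, fun h ψ hψ => h ψ (Submodule.subset_span hψ)⟩
    induction hψ using Submodule.span_induction with
    | mem x hx => exact h x hx
    | zero => rfl
    | add x y _ _ hx hy => simp [hx, hy]
    | smul a x _ hx => simp [hx]
  have h3 : Nat.card U * Nat.card U.dualCoannihilator = Fintype.card W := by
    rw [Module.natCard_eq_pow_finrank (K := ZMod p), Module.natCard_eq_pow_finrank (K := ZMod p)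
      (V := U.dualCoannihilator), ← pow_add, Subspace.finrank_add_finrank_dualCoannihilator_eq,
      ← Module.natCard_eq_pow_finrank, Nat.card_eq_fintype_card]
  rw [h2, ← h3]
  exact Nat.mul_le_mul_right _ h1

open Classical in
/-- The functionals that see at most a fraction `1 / k` of the coordinates of `v`. -/
noncomputable def lightDuals (k : ℕ) (v : ι → W) : Finset (Module.Dual (ZMod p) W) :=
  Finset.univ.filter fun ψ => dualWeight ψ v * k ≤ Fintype.card ι

omit [Fintype W] in
theorem mem_lightDuals {k : ℕ} {v : ι → W} {ψ : Module.Dual (ZMod p) W} :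
    ψ ∈ lightDuals k v ↔ dualWeight ψ v * k ≤ Fintype.card ι := by
  simp [lightDuals]

omit [Fintype W] in
theorem zero_mem_lightDuals (k : ℕ) (v : ι → W) :
    (0 : Module.Dual (ZMod p) W) ∈ lightDuals k v := by
  simp [mem_lightDuals, dualWeight]

/-- A Chernoff bound: few vectors have almost all of their coordinates in `H`. -/
theorem card_mostly_mem_le [DecidableEq ι] [DecidableEq W] (H : Finset W) (hH : H.Nonempty) {k : ℕ}
    (hk : k ≠ 0)
    {Λ μ : ℝ} (hΛ : 1 ≤ Λ) (hμ : 1 < μ) (h1 : Λ ^ Fintype.card W ≤ μ ^ k)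
    (h2 : 1 + Fintype.card W / Λ ≤ μ) :
    ((Finset.univ.filter fun v : ι → W => (Finset.univ.filter fun i => v i ∉ H).card * k ≤
      Fintype.card W * Fintype.card ι).card : ℝ) ≤ (μ ^ 2 * H.card) ^ Fintype.card ι := by
  have hμ0 : 0 < μ := one_pos.trans hμ
  have hΛ0 : 0 < Λ := one_pos.trans_le hΛ
  -- Exponential weight: `μ` for a coordinate in `H`, `μ / Λ` for one outside. The condition `Λ ^
  -- |W| ≤ μ ^ k` makes the product at least 1 on every family counted, and `1 + |W| / Λ ≤ μ` bounds
  -- the total weight.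
  have hpt : ∀ v : ι → W, (Finset.univ.filter fun i => v i ∉ H).card * k ≤
      Fintype.card W * Fintype.card ι → 1 ≤ ∏ i, μ * (if v i ∈ H then 1 else 1 / Λ) := by
    intro v hv
    set h := (Finset.univ.filter fun i => v i ∉ H).card
    have hh : Λ ^ h ≤ μ ^ Fintype.card ι := by
      refine le_of_pow_le_pow_left₀ hk (by positivity) ?_
      calc (Λ ^ h) ^ k = Λ ^ (h * k) := by rw [pow_mul]
        _ ≤ Λ ^ (Fintype.card W * Fintype.card ι) := pow_le_pow_right₀ hΛ hv
        _ = (Λ ^ Fintype.card W) ^ Fintype.card ι := by rw [pow_mul]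
        _ ≤ (μ ^ k) ^ Fintype.card ι := pow_le_pow_left₀ (by positivity) h1 _
        _ = _ := by rw [← pow_mul, ← pow_mul, mul_comm]
    rw [Finset.prod_mul_distrib, Finset.prod_const, Finset.card_univ, Finset.prod_ite,
      Finset.prod_const_one, one_mul, Finset.prod_const, one_div, inv_pow, ← div_eq_mul_inv,
      one_le_div (by positivity)]
    exact hh
  calc ((Finset.univ.filter fun v : ι → W => (Finset.univ.filter fun i => v i ∉ H).card * k ≤
      Fintype.card W * Fintype.card ι).card : ℝ)
      = ∑ v ∈ Finset.univ.filter fun v : ι → W => (Finset.univ.filter fun i => v i ∉ H).card * k ≤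
        Fintype.card W * Fintype.card ι, (1 : ℝ) := by simp
    _ ≤ ∑ v ∈ Finset.univ.filter fun v : ι → W => (Finset.univ.filter fun i => v i ∉ H).card * k ≤
        Fintype.card W * Fintype.card ι, ∏ i, μ * (if v i ∈ H then 1 else 1 / Λ) :=
        Finset.sum_le_sum fun v hv => hpt v (Finset.mem_filter.1 hv).2
    _ ≤ ∑ v : ι → W, ∏ i, μ * (if v i ∈ H then 1 else 1 / Λ) := by
        refine Finset.sum_le_sum_of_subset_of_nonneg (Finset.filter_subset _ _) fun v _ _ => ?_
        refine Finset.prod_nonneg fun i _ => mul_nonneg hμ0.le ?_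
        split_ifs <;> positivity
    _ = (∑ y : W, μ * (if y ∈ H then 1 else 1 / Λ)) ^ Fintype.card ι := by
        rw [← Finset.card_univ, ← Finset.prod_const, Finset.prod_univ_sum, Fintype.piFinset_univ]
    _ ≤ _ := by
        have hs0 : ∀ y : W, 0 ≤ (if y ∈ H then (1 : ℝ) else 1 / Λ) := fun y => by
          split_ifs <;> positivity
        refine pow_le_pow_left₀ (Finset.sum_nonneg fun y _ => mul_nonneg hμ0.le (hs0 y)) ?_ _
        rw [← Finset.mul_sum, sq, mul_assoc]
        refine mul_le_mul_of_nonneg_left ?_ hμ0.le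
        have hHc : (1 : ℝ) ≤ H.card := by exact_mod_cast hH.card_pos
        calc ∑ y : W, (if y ∈ H then (1 : ℝ) else 1 / Λ)
            ≤ ∑ y : W, ((if y ∈ H then (1 : ℝ) else 0) + 1 / Λ) := by
              refine Finset.sum_le_sum fun y _ => ?_
              have : 0 ≤ 1 / Λ := by positivity
              split_ifs <;> linarith
          _ = H.card + Fintype.card W / Λ := by
              rw [Finset.sum_add_distrib]; simp [div_eq_mul_inv]
          _ ≤ H.card * (1 + Fintype.card W / Λ) := by
              have : 0 ≤ (Fintype.card W : ℝ) / Λ := by positivity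
              nlinarith
          _ ≤ _ := by rw [mul_comm]; gcongr

/-- Fix the set `B` of light functionals; there are `2 ^ |W|` candidates. At most `|W| n / k`
coordinates then leave the space `H` of common zeros, so about `|H| ^ n` families have this `B`.
Since `|B| |H| ≤ |W|`, the factor `|B| ^ n` is paid for exactly. -/
theorem sum_card_lightDuals_pow_le [DecidableEq ι] {k : ℕ} (hk : k ≠ 0) {Λ μ : ℝ} (hΛ : 1 ≤ Λ)
    (hμ : 1 < μ) (h1 : Λ ^ Fintype.card W ≤ μ ^ k) (h2 : 1 + Fintype.card W / Λ ≤ μ) {c : ℝ}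
    (hc : 0 ≤ c) :
    ∑ v : ι → W, (c * (lightDuals (p := p) k v).card) ^ Fintype.card ι ≤
      2 ^ Fintype.card W * (μ ^ 2 * Fintype.card W * c) ^ Fintype.card ι := by
  classical
  rw [← Finset.sum_fiberwise (s := Finset.univ) (g := fun v : ι → W => lightDuals (p := p) k v)]
  have hcard : (2 : ℝ) ^ Fintype.card W =
      (Finset.univ : Finset (Finset (Module.Dual (ZMod p) W))).card := by
    rw [Finset.card_univ, Fintype.card_finset, card_dual_eq]; push_cast; rfl
  rw [hcard, ← nsmul_eq_mul]
  refine Finset.sum_le_card_nsmul _ _ _ fun B _ => ?_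
  set H : Finset W := Finset.univ.filter fun y => ∀ ψ ∈ B, ψ y = 0 with hHdef
  have hHne : H.Nonempty := ⟨0, by simp [hHdef]⟩
  have hBH : B.card * H.card ≤ Fintype.card W := by
    have := card_mul_card_commonZeros_le B
    rwa [Nat.card_eq_fintype_card, Fintype.card_subtype] at this
  have hsub : (Finset.univ.filter fun v : ι → W => lightDuals (p := p) k v = B) ⊆
      Finset.univ.filter fun v : ι → W => (Finset.univ.filter fun i => v i ∉ H).card * k ≤
        Fintype.card W * Fintype.card ι := by
    intro v hv
    have hv : lightDuals k v = B := by simpa using hv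
    rw [Finset.mem_filter]
    refine ⟨Finset.mem_univ _, ?_⟩
    have hle : (Finset.univ.filter fun i => v i ∉ H).card ≤ ∑ ψ ∈ B, dualWeight ψ v := by
      have : (Finset.univ.filter fun i => v i ∉ H) ⊆
          B.biUnion fun ψ => Set.toFinset {i | ψ (v i) ≠ 0} := by
        intro i hi
        simp only [hHdef, Finset.mem_filter, Finset.mem_univ, true_and, not_forall] at hi
        obtain ⟨ψ, hψ, h⟩ := hi
        simp only [Finset.mem_biUnion]
        exact ⟨ψ, hψ, by simpa using h⟩
      refine (Finset.card_le_card this).trans (Finset.card_biUnion_le.trans_eq ?_)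
      exact Finset.sum_congr rfl fun ψ _ => by rw [dualWeight, Set.ncard_eq_toFinset_card']
    calc _ ≤ (∑ ψ ∈ B, dualWeight ψ v) * k := Nat.mul_le_mul_right _ hle
      _ = ∑ ψ ∈ B, dualWeight ψ v * k := by rw [Finset.sum_mul]
      _ ≤ ∑ ψ ∈ B, Fintype.card ι := Finset.sum_le_sum fun ψ hψ =>
          mem_lightDuals.1 (hv ▸ hψ)
      _ = B.card * Fintype.card ι := by simp
      _ ≤ _ := Nat.mul_le_mul_right _ ((Finset.card_le_univ B).trans_eq card_dual_eq)
  calc _ = ∑ v ∈ Finset.univ.filter fun v : ι → W => lightDuals (p := p) k v = B,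
        (c * B.card) ^ Fintype.card ι := Finset.sum_congr rfl fun v hv => by
          rw [(Finset.mem_filter.1 hv).2]
    _ = (Finset.univ.filter fun v : ι → W => lightDuals (p := p) k v = B).card *
        (c * B.card) ^ Fintype.card ι := by rw [Finset.sum_const, nsmul_eq_mul]
    _ ≤ (μ ^ 2 * H.card) ^ Fintype.card ι * (c * B.card) ^ Fintype.card ι := by
        gcongr
        refine le_trans ?_ (card_mostly_mem_le (ι := ι) H hHne hk hΛ hμ h1 h2)
        exact_mod_cast Finset.card_le_card hsub
    _ = (μ ^ 2 * (B.card * H.card : ℕ) * c) ^ Fintype.card ι := by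
        rw [← mul_pow]; push_cast; ring
    _ ≤ _ := by gcongr

end Counting

theorem abs_prod_sub_one_le {ι : Type*} (s : Finset ι) (x : ι → ℝ) {η : ℝ}
    (h : ∀ i ∈ s, |x i - 1| ≤ η) : |∏ i ∈ s, x i - 1| ≤ (1 + η) ^ s.card - 1 := by
  classical
  induction s using Finset.induction_on with
  | empty => simp
  | insert a s ha ih =>
    rw [Finset.prod_insert ha, Finset.card_insert_of_notMem ha]
    have ih' := ih fun i hi => h i (Finset.mem_insert_of_mem hi)
    have ha' := h a (Finset.mem_insert_self _ _)
    have hη : 0 ≤ η := (abs_nonneg _).trans ha'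
    have e : x a * ∏ i ∈ s, x i - 1 = x a * (∏ i ∈ s, x i - 1) + (x a - 1) := by ring
    have hxa : |x a| ≤ 1 + η := by
      have := abs_add_le (x a - 1) 1
      rw [sub_add_cancel, abs_one] at this
      linarith
    rw [e]
    refine (abs_add_le _ _).trans ?_
    rw [abs_mul]
    have : |x a| * |∏ i ∈ s, x i - 1| ≤ (1 + η) * ((1 + η) ^ s.card - 1) :=
      mul_le_mul hxa ih' (abs_nonneg _) (by linarith)
    rw [pow_succ]
    nlinarith

/-! ### Spanning families: main term and concentrated families. -/

section Spread

variable {p : ℕ} [Fact p.Prime] {W : Type*} [AddCommGroup W] [Module (ZMod p) W] [Fintype W]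
  [Fintype (Module.Dual (ZMod p) W)] {ι : Type*} [Fintype ι] [DecidableEq ι]

open Classical in
/-- The total probability, over spanning families `v`, that each column of a random matrix is
mapped by `v` to a prescribed vector. -/
noncomputable def spanningHitSum (m : ι → ι → ZMod p → ℝ) (Y : (ι → W) → ι → W) : ℝ :=
  ∑ v ∈ Finset.univ.filter fun v : ι → W => ∀ ψ : Module.Dual (ZMod p) W, ψ ≠ 0 → ∃ i, ψ (v i) ≠ 0,
    ∏ b, hitProb (m b) v (Y v b)

/-- The first error is the deviation from uniform when 0 is the only light functional, the second
accounts for the remaining families missing from that main term, and the third bounds the spanning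
ones among them. The hitting bounds are uniform in the target, so `Y` may depend on `v`. -/
theorem abs_spanningHitSum_sub_one_le {ε ρ : ℝ} (hρ0 : 0 ≤ ρ) (hρ1 : ρ < 1)
    (hρ : ∀ m : ZMod p → ℝ, IsBalancedWeight ε m →
      ∀ c : ZMod p, c ≠ 0 → ‖∑ x, (m x : ℂ) * ZMod.stdAddChar (x * c)‖ ≤ ρ)
    {k : ℕ} (hk : k ≠ 0) {Λ μ : ℝ} (hΛ : 1 ≤ Λ)
    (hμ : 1 < μ) (h1 : Λ ^ Fintype.card W ≤ μ ^ k) (h2 : 1 + Fintype.card W / Λ ≤ μ)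
    {m : ι → ι → ZMod p → ℝ} (hm : ∀ b i, IsBalancedWeight ε (m b i)) (Y : (ι → W) → ι → W)
    {η : ℝ} (hη : η = Fintype.card W * ρ ^ (Fintype.card ι / k)) :
    |spanningHitSum m Y - 1| ≤ ((1 + η) ^ Fintype.card ι - 1) +
      2 ^ Fintype.card W * (μ ^ 2 * (1 / 2)) ^ Fintype.card ι +
      2 ^ Fintype.card W * (μ ^ 2 * ((1 + ρ) / 2 + η)) ^ Fintype.card ι := by
  classical
  set n := Fintype.card ι
  set q := Fintype.card W with hq
  have hq0 : (0 : ℝ) < q := by exact_mod_cast Fintype.card_pos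
  have hη0 : 0 ≤ η := by rw [hη]; positivity
  have hpow : ∀ (v : ι → W) (ψ : Module.Dual (ZMod p) W), ψ ∉ lightDuals k v →
      ρ ^ dualWeight ψ v ≤ ρ ^ (n / k) := by
    intro v ψ hψ
    rw [mem_lightDuals, not_le] at hψ
    exact pow_le_pow_of_le_one hρ0 hρ1.le
      ((Nat.div_lt_iff_lt_mul (Nat.pos_of_ne_zero hk)).2 hψ).le
  set spn : (ι → W) → Prop := fun v => ∀ ψ : Module.Dual (ZMod p) W, ψ ≠ 0 → ∃ i, ψ (v i) ≠ 0
  set code : (ι → W) → Prop := fun v => lightDuals (p := p) k v = {0}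
  set g : (ι → W) → ℝ := fun v => ∏ b, hitProb (m b) v (Y v b)
  have hg0 : ∀ v, 0 ≤ g v := fun v => Finset.prod_nonneg fun b _ => hitProb_nonneg (hm b) _ _
  have hcode : ∀ v, code v → spn v := by
    intro v hv ψ hψ
    by_contra! hcon
    refine hψ (Finset.mem_singleton.1 (hv ▸ mem_lightDuals.2 ?_))
    simp [dualWeight, hcon]
  have hncard : ∀ v, ¬ code v → 2 ≤ (lightDuals (p := p) k v).card := by
    intro v hv
    by_contra! hcon
    apply hv
    refine (Finset.eq_of_subset_of_card_le (Finset.singleton_subset_iff.2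
      (zero_mem_lightDuals k v)) ?_).symm
    simp; omega
  -- spread families
  have hmain : ∀ v, code v → |(q : ℝ) ^ n * g v - 1| ≤ (1 + η) ^ n - 1 := by
    intro v hv
    have e : (q : ℝ) ^ n * g v = ∏ b, ((q : ℝ) * hitProb (m b) v (Y v b)) := by
      rw [Finset.prod_mul_distrib, Finset.prod_const, Finset.card_univ]
    rw [e]
    refine abs_prod_sub_one_le _ _ fun b _ => ?_
    refine (abs_card_mul_hitProb_sub_one_le hρ (hm b) v (Y v b)).trans ?_
    calc ∑ ψ ∈ Finset.univ.erase (0 : Module.Dual (ZMod p) W), ρ ^ dualWeight ψ v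
        ≤ ∑ ψ ∈ Finset.univ.erase (0 : Module.Dual (ZMod p) W), ρ ^ (n / k) := by
          refine Finset.sum_le_sum fun ψ hψ => hpow v ψ fun h => ?_
          rw [hv, Finset.mem_singleton] at h
          simp [h] at hψ
      _ ≤ ∑ ψ : Module.Dual (ZMod p) W, ρ ^ (n / k) :=
          Finset.sum_le_sum_of_subset_of_nonneg (Finset.erase_subset _ _)
            fun _ _ _ => by positivity
      _ = η := by simp [hη, card_dual_eq, hq]
  -- concentrated spanning families
  have hbad : ∀ v, spn v → ¬ code v →
      g v ≤ (((1 + ρ) / 2 + η) / q * (lightDuals (p := p) k v).card) ^ n := by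
    intro v hv hc
    have h2c : (2 : ℝ) ≤ (lightDuals (p := p) k v).card := by exact_mod_cast hncard v hc
    rw [show n = (Finset.univ : Finset ι).card from Finset.card_univ.symm, ← Finset.prod_const]
    refine Finset.prod_le_prod (fun b _ => hitProb_nonneg (hm b) _ _) fun b _ => ?_
    rw [div_mul_eq_mul_div, le_div_iff₀ hq0, mul_comm]
    refine (card_mul_hitProb_le hρ (hm b) v (Y v b)).trans ?_
    -- Because `v` spans, a light nonzero functional sees some coordinate and contributes at most
    -- `ρ`. With `L ≥ 2` light functionals the total is at most `1 + (L - 1)ρ + η ≤ ((1 + ρ)/2 + η)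
    -- L`, a saving over the trivial `L` in every column.
    have hsplit : ∑ ψ : Module.Dual (ZMod p) W, ρ ^ dualWeight ψ v ≤
        ∑ ψ : Module.Dual (ZMod p) W, ((if ψ ∈ lightDuals k v then ρ else 0) +
          (if ψ = 0 then 1 - ρ else 0) + ρ ^ (n / k)) := by
      refine Finset.sum_le_sum fun ψ _ => ?_
      have hp0 : 0 ≤ ρ ^ (n / k) := by positivity
      by_cases h0 : ψ = 0
      · subst h0
        simp only [zero_mem_lightDuals, if_true]
        have : ρ ^ dualWeight (0 : Module.Dual (ZMod p) W) v ≤ 1 := pow_le_one₀ hρ0 hρ1.le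
        linarith
      · by_cases hψ : ψ ∈ lightDuals k v
        · have hw : dualWeight ψ v ≠ 0 := by
            obtain ⟨i, hi⟩ := hv ψ h0
            exact ((Set.ncard_pos (Set.toFinite _)).2 ⟨i, hi⟩).ne'
          have : ρ ^ dualWeight ψ v ≤ ρ := pow_le_of_le_one hρ0 hρ1.le hw
          simp only [hψ, h0, if_true, if_false]
          linarith
        · simp only [hψ, h0, if_false]
          linarith [hpow v ψ hψ]
    refine hsplit.trans ?_
    rw [Finset.sum_add_distrib, Finset.sum_add_distrib, Finset.sum_ite_mem, Finset.univ_inter,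
      Finset.sum_const, Finset.sum_ite_eq', Finset.sum_const, Finset.card_univ, card_dual_eq,
      nsmul_eq_mul, nsmul_eq_mul, ← hq, ← hη]
    simp only [Finset.mem_univ, if_true]
    nlinarith
  -- A Markov-type weight turns the count of these families into the sum bounded above.
  have hhalf : ∀ v, ¬ code v → 1 ≤ (1 / 2 * ((lightDuals (p := p) k v).card : ℝ)) ^ n := by
    intro v hc
    have h2c : (2 : ℝ) ≤ (lightDuals (p := p) k v).card := by exact_mod_cast hncard v hc
    exact one_le_pow₀ (by linarith)
  have hN : ((Finset.univ.filter fun v => ¬ code v).card : ℝ) ≤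
      (q : ℝ) ^ n * (2 ^ q * (μ ^ 2 * (1 / 2)) ^ n) := by
    calc ((Finset.univ.filter fun v => ¬ code v).card : ℝ)
        = ∑ v ∈ Finset.univ.filter fun v => ¬ code v, (1 : ℝ) := by simp
      _ ≤ ∑ v ∈ Finset.univ.filter fun v => ¬ code v,
          (1 / 2 * ((lightDuals (p := p) k v).card : ℝ)) ^ n :=
          Finset.sum_le_sum fun v hv => hhalf v (Finset.mem_filter.1 hv).2
      _ ≤ ∑ v : ι → W, (1 / 2 * ((lightDuals (p := p) k v).card : ℝ)) ^ n :=
          Finset.sum_le_sum_of_subset_of_nonneg (Finset.filter_subset _ _)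
            fun _ _ _ => by positivity
      _ ≤ 2 ^ q * (μ ^ 2 * q * (1 / 2)) ^ n :=
          sum_card_lightDuals_pow_le hk hΛ hμ h1 h2 (by norm_num)
      _ = _ := by rw [show μ ^ 2 * q * (1 / 2) = q * (μ ^ 2 * (1 / 2)) by ring, mul_pow]; ring
  have hB : ∑ v ∈ Finset.univ.filter (fun v => spn v ∧ ¬ code v), g v ≤
      2 ^ q * (μ ^ 2 * ((1 + ρ) / 2 + η)) ^ n := by
    have hc0 : 0 ≤ ((1 + ρ) / 2 + η) / q := by positivity
    calc _ ≤ ∑ v ∈ Finset.univ.filter (fun v => spn v ∧ ¬ code v),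
          (((1 + ρ) / 2 + η) / q * (lightDuals (p := p) k v).card) ^ n :=
          Finset.sum_le_sum fun v hv =>
            hbad v (Finset.mem_filter.1 hv).2.1 (Finset.mem_filter.1 hv).2.2
      _ ≤ ∑ v : ι → W, (((1 + ρ) / 2 + η) / q * (lightDuals (p := p) k v).card) ^ n :=
          Finset.sum_le_sum_of_subset_of_nonneg (Finset.filter_subset _ _)
            fun _ _ _ => by positivity
      _ ≤ 2 ^ q * (μ ^ 2 * q * (((1 + ρ) / 2 + η) / q)) ^ n :=
          sum_card_lightDuals_pow_le hk hΛ hμ h1 h2 hc0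
      _ = _ := by rw [mul_assoc (μ ^ 2), mul_div_cancel₀ _ hq0.ne']
  have hB0 : 0 ≤ ∑ v ∈ Finset.univ.filter (fun v => spn v ∧ ¬ code v), g v :=
    Finset.sum_nonneg fun v _ => hg0 v
  have hsplit : spanningHitSum m Y = ∑ v ∈ Finset.univ.filter code, g v +
      ∑ v ∈ Finset.univ.filter (fun v => spn v ∧ ¬ code v), g v := by
    rw [spanningHitSum, ← Finset.sum_filter_add_sum_filter_not _ code, Finset.filter_filter,
      Finset.filter_filter]
    congr 1
    refine Finset.sum_congr (Finset.filter_congr fun v _ => ?_) fun _ _ => rfl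
    exact ⟨fun h => h.2, fun h => ⟨hcode v h, h⟩⟩
  have hqn : (0 : ℝ) < (q : ℝ) ^ n := by positivity
  have hcards : ((Finset.univ.filter code).card : ℝ) +
      (Finset.univ.filter fun v => ¬ code v).card = (q : ℝ) ^ n := by
    have := Finset.card_filter_add_card_filter_not (s := (Finset.univ : Finset (ι → W))) code
    rw [Finset.card_univ, Fintype.card_fun] at this
    exact_mod_cast this
  have hA : |(q : ℝ) ^ n * ∑ v ∈ Finset.univ.filter code, g v - (Finset.univ.filter code).card| ≤
      (q : ℝ) ^ n * ((1 + η) ^ n - 1) := by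
    have e : (q : ℝ) ^ n * ∑ v ∈ Finset.univ.filter code, g v - (Finset.univ.filter code).card =
        ∑ v ∈ Finset.univ.filter code, ((q : ℝ) ^ n * g v - 1) := by
      rw [Finset.sum_sub_distrib, Finset.mul_sum]; simp
    rw [e]
    refine (Finset.abs_sum_le_sum_abs _ _).trans ?_
    refine (Finset.sum_le_card_nsmul _ _ _ fun v hv => hmain v (Finset.mem_filter.1 hv).2).trans ?_
    rw [nsmul_eq_mul]
    refine mul_le_mul_of_nonneg_right ?_ (sub_nonneg.2 (one_le_pow₀ (by linarith)))
    rw [← hcards]; simp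
  have hN0 : (0 : ℝ) ≤ (Finset.univ.filter fun v => ¬ code v).card := by positivity
  set SA := ∑ v ∈ Finset.univ.filter code, g v
  have hA' : |SA - 1| ≤ ((1 + η) ^ n - 1) + 2 ^ q * (μ ^ 2 * (1 / 2)) ^ n := by
    refine le_of_mul_le_mul_left ?_ hqn
    rw [← abs_of_pos hqn, ← abs_mul, abs_of_pos hqn]
    rw [abs_le] at hA ⊢
    constructor <;> nlinarith [hA.1, hA.2]
  rw [hsplit]
  calc _ ≤ |SA - 1| + |∑ v ∈ Finset.univ.filter (fun v => spn v ∧ ¬ code v), g v| := by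
        rw [show ∀ a b : ℝ, a + b - 1 = (a - 1) + b from fun a b => by ring]
        exact abs_add_le _ _
    _ ≤ _ := by rw [abs_of_nonneg hB0]; linarith

end Spread

/-! ### Choice of parameters and the limit of the hitting sum. -/

section Limit

variable {p : ℕ} [Fact p.Prime] {W : Type*} [AddCommGroup W] [Module (ZMod p) W] [Fintype W]
  [Fintype (Module.Dual (ZMod p) W)]

theorem tendsto_natDiv_atTop {k : ℕ} (hk : k ≠ 0) : Tendsto (fun n : ℕ => n / k) atTop atTop :=
  Nat.tendsto_div_const_atTop hk

theorem tendsto_one_add_mul_pow_div {ρ : ℝ} (hρ0 : 0 ≤ ρ) (hρ1 : ρ < 1) {k : ℕ} (hk : k ≠ 0)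
    {c : ℝ} (hc : 0 ≤ c) :
    Tendsto (fun n : ℕ => (1 + c * ρ ^ (n / k)) ^ n - 1) atTop (𝓝 0) := by
  have h0 : Tendsto (fun m : ℕ => c * (k * ((m + 1) * ρ ^ m))) atTop (𝓝 0) := by
    have h1 := tendsto_self_mul_const_pow_of_lt_one hρ0 hρ1
    have h2 := tendsto_pow_atTop_nhds_zero_of_lt_one hρ0 hρ1
    have h3 := ((h1.add h2).const_mul (k : ℝ)).const_mul c
    simp only [add_zero, mul_zero] at h3
    exact h3.congr fun m => by ring
  have h1 : Tendsto (fun n : ℕ => Real.exp (c * (k * (((n / k : ℕ) + 1) * ρ ^ (n / k)))) - 1)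
      atTop (𝓝 0) := by
    have := (Real.continuous_exp.tendsto 0).comp (h0.comp (tendsto_natDiv_atTop hk))
    simpa using this.sub_const 1
  refine squeeze_zero (fun n => ?_) (fun n => ?_) h1
  · have : 0 ≤ c * ρ ^ (n / k) := by positivity
    exact sub_nonneg.2 (one_le_pow₀ (by linarith))
  · gcongr
    have h2 : 1 + c * ρ ^ (n / k) ≤ Real.exp (c * ρ ^ (n / k)) := by
      rw [add_comm]; exact Real.add_one_le_exp _
    refine (pow_le_pow_left₀ (by positivity) h2 n).trans ?_
    rw [← Real.exp_nat_mul]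
    apply Real.exp_le_exp.2
    have h3 : (n : ℝ) ≤ k * ((n / k : ℕ) + 1) := by
      exact_mod_cast (Nat.lt_mul_div_succ n (Nat.pos_of_ne_zero hk)).le
    have h4 : 0 ≤ c * ρ ^ (n / k) := by positivity
    nlinarith

theorem tendsto_spanningHitSum {ε : ℝ} (hε : 0 < ε)
    (m : ∀ n : ℕ, Fin n → Fin n → ZMod p → ℝ) (hm : ∀ n b i, IsBalancedWeight ε (m n b i))
    (Y : ∀ n : ℕ, (Fin n → W) → Fin n → W) :
    Tendsto (fun n => spanningHitSum (m n) (Y n)) atTop (𝓝 1) := by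
  obtain ⟨ρ, hρ0, hρ1, hρ⟩ := exists_norm_charSum_le (p := p) hε
  -- So close to 1 that `μ ^ 2 (1 + ρ)/2` and `μ ^ 2 / 2` stay below 1. Then `Λ` is chosen to make
  -- `1 + |W| / Λ` equal to `μ`, and `k` comes last.
  set μ : ℝ := 1 + (1 - (1 + ρ) / 2) / 4 with hμdef
  have hμ : 1 < μ := by rw [hμdef]; linarith
  have hμθ : μ ^ 2 * ((1 + ρ) / 2) < 1 := by
    rw [hμdef]; nlinarith [sq_nonneg (1 - ρ), mul_nonneg hρ0 hρ0]
  have hμ2 : μ ^ 2 * (1 / 2) < 1 := by nlinarith [sq_nonneg μ]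
  have hq1 : (1 : ℝ) ≤ Fintype.card W := by exact_mod_cast Fintype.card_pos (α := W)
  set Λ : ℝ := Fintype.card W / (μ - 1)
  have hΛ : 1 ≤ Λ := by
    rw [one_le_div (by linarith)]
    have : μ - 1 ≤ 1 := by rw [hμdef]; linarith
    linarith
  have h2 : 1 + Fintype.card W / Λ ≤ μ := by
    rw [div_div_cancel₀ (by linarith)]; linarith
  obtain ⟨k, hk, h1⟩ : ∃ k : ℕ, k ≠ 0 ∧ Λ ^ Fintype.card W ≤ μ ^ k := by
    obtain ⟨k, hk⟩ := pow_unbounded_of_one_lt (Λ ^ Fintype.card W) hμ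
    exact ⟨k + 1, by simp, hk.le.trans (pow_le_pow_right₀ hμ.le (by simp))⟩
  have hηlim : Tendsto (fun n : ℕ => (Fintype.card W : ℝ) * ρ ^ (n / k)) atTop (𝓝 0) := by
    simpa using ((tendsto_pow_atTop_nhds_zero_of_lt_one hρ0 hρ1).comp
      (tendsto_natDiv_atTop hk)).const_mul (Fintype.card W : ℝ)
  have hA := tendsto_one_add_mul_pow_div hρ0 hρ1 hk (zero_le_one.trans hq1)
  have hB : Tendsto (fun n : ℕ => (2 : ℝ) ^ Fintype.card W * (μ ^ 2 * (1 / 2)) ^ n) atTop (𝓝 0) := by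
    simpa using (tendsto_pow_atTop_nhds_zero_of_lt_one (by positivity) hμ2).const_mul
      ((2 : ℝ) ^ Fintype.card W)
  have hC : Tendsto (fun n : ℕ => (2 : ℝ) ^ Fintype.card W *
      (μ ^ 2 * ((1 + ρ) / 2 + Fintype.card W * ρ ^ (n / k))) ^ n) atTop (𝓝 0) := by
    -- The midpoint between the limiting base and 1 leaves room for the vanishing `η`.
    set τ := (1 + μ ^ 2 * ((1 + ρ) / 2)) / 2
    have hτ0 : 0 ≤ τ := by positivity
    have hτ1 : τ < 1 := by simp only [τ]; linarith
    have hlim : Tendsto (fun n : ℕ => μ ^ 2 * ((1 + ρ) / 2 + Fintype.card W * ρ ^ (n / k))) atTop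
        (𝓝 (μ ^ 2 * ((1 + ρ) / 2 + 0))) := (hηlim.const_add _).const_mul _
    have hev := hlim.eventually_lt_const (u := τ) (by simp only [τ, add_zero]; linarith)
    have hpow : Tendsto (fun n : ℕ => (2 : ℝ) ^ Fintype.card W * τ ^ n) atTop (𝓝 0) := by
      simpa using (tendsto_pow_atTop_nhds_zero_of_lt_one hτ0 hτ1).const_mul
        ((2 : ℝ) ^ Fintype.card W)
    refine squeeze_zero' (Eventually.of_forall fun n => by positivity) ?_ hpow
    filter_upwards [hev] with n hn
    gcongr
  have hsum := (hA.add hB).add hC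
  simp only [add_zero] at hsum
  rw [tendsto_iff_norm_sub_tendsto_zero]
  refine squeeze_zero (fun _ => norm_nonneg _) (fun n => ?_) hsum
  have := abs_spanningHitSum_sub_one_le hρ0 hρ1 hρ hk hΛ hμ h1 h2 (hm n) (Y n) rfl
  simpa only [Fintype.card_fin, Real.norm_eq_abs] using this

end Limit

/-! ### Expected numbers of intertwining surjections. -/

section MatrixMoments

variable {p : ℕ} [Fact p.Prime] {W : Type*} [AddCommGroup W] [Module (ZMod p) W]

/-- The probability of the matrix `M` when entries are independent, the entry `(a, b)` having the
law `m a b`. -/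
noncomputable def matrixWeight {n : ℕ} (m : Fin n → Fin n → ZMod p → ℝ)
    (M : Matrix (Fin n) (Fin n) (ZMod p)) : ℝ :=
  ∏ b, ∏ a, m a b (M a b)

theorem surjective_constr_iff {n : ℕ} (v : Fin n → W) :
    Function.Surjective ((Pi.basisFun (ZMod p) (Fin n)).constr (ZMod p) v) ↔
      ∀ ψ : Module.Dual (ZMod p) W, ψ ≠ 0 → ∃ i, ψ (v i) ≠ 0 := by
  set φ := (Pi.basisFun (ZMod p) (Fin n)).constr (ZMod p) v with hφ
  have hφi : ∀ i, φ (Pi.basisFun (ZMod p) (Fin n) i) = v i := fun i => Module.Basis.constr_basis _ _ _ _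
  constructor
  · intro hs ψ hψ
    by_contra! hcon
    apply hψ
    have : ψ ∘ₗ φ = 0 := (Pi.basisFun (ZMod p) (Fin n)).ext fun i => by
      rw [LinearMap.comp_apply, hφi, hcon]; rfl
    ext w
    obtain ⟨x, rfl⟩ := hs w
    exact LinearMap.congr_fun this x
  · intro h
    rw [← LinearMap.range_eq_top]
    by_contra hne
    obtain ⟨ψ, hψ, hle⟩ := Submodule.exists_le_ker_of_lt_top _ (lt_top_iff_ne_top.2 hne)
    obtain ⟨i, hi⟩ := h ψ hψ
    exact hi (hle ⟨_, hφi i⟩)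

theorem comp_toLin'_constr_iff {n : ℕ} (v : Fin n → W) (M : Matrix (Fin n) (Fin n) (ZMod p))
    (T : Module.End (ZMod p) W) :
    (Pi.basisFun (ZMod p) (Fin n)).constr (ZMod p) v ∘ₗ Matrix.toLin' M =
      T ∘ₗ (Pi.basisFun (ZMod p) (Fin n)).constr (ZMod p) v ↔
      ∀ b, ∑ a, M a b • v a = T (v b) := by
  set φ := (Pi.basisFun (ZMod p) (Fin n)).constr (ZMod p) v with hφ
  have hφi : ∀ i, φ (Pi.basisFun (ZMod p) (Fin n) i) = v i := fun i => Module.Basis.constr_basis _ _ _ _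
  have hM : ∀ b, φ (Matrix.toLin' M (Pi.basisFun (ZMod p) (Fin n) b)) = ∑ a, M a b • v a := by
    intro b
    rw [hφ, Module.Basis.constr_apply_fintype]
    simp
  constructor
  · intro h b
    rw [← hM, ← hφi b]
    exact LinearMap.congr_fun h _
  · intro h
    refine (Pi.basisFun (ZMod p) (Fin n)).ext fun b => ?_
    rw [LinearMap.comp_apply, hM, h, LinearMap.comp_apply, hφi]

theorem card_surjective_intertwining {n : ℕ} (M : Matrix (Fin n) (Fin n) (ZMod p))
    (T : Module.End (ZMod p) W) :
    Nat.card {φ : (Fin n → ZMod p) →ₗ[ZMod p] W //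
        Function.Surjective φ ∧ φ ∘ₗ Matrix.toLin' M = T ∘ₗ φ} =
      Nat.card {v : Fin n → W // (∀ ψ : Module.Dual (ZMod p) W, ψ ≠ 0 →
        ∃ i, ψ (v i) ≠ 0) ∧ ∀ b, ∑ a, M a b • v a = T (v b)} :=
  (Nat.card_congr (((Pi.basisFun (ZMod p) (Fin n)).constr (ZMod p)).toEquiv.subtypeEquiv fun v =>
    and_congr (surjective_constr_iff v).symm (comp_toLin'_constr_iff v M T).symm)).symm

/-- For a fixed spanning family the intertwining condition is one equation per column of `M`, and
the columns are independent, so its probability is a product of hitting probabilities. -/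
theorem sum_matrixWeight_mul_card [Fintype W] [Fintype (Module.Dual (ZMod p) W)] {n : ℕ}
    (m : Fin n → Fin n → ZMod p → ℝ) (T : Module.End (ZMod p) W) :
    ∑ M, matrixWeight m M * Nat.card {φ : (Fin n → ZMod p) →ₗ[ZMod p] W //
        Function.Surjective φ ∧ φ ∘ₗ Matrix.toLin' M = T ∘ₗ φ} =
      spanningHitSum (fun b a => m a b) fun v b => T (v b) := by
  classical
  have h1 : ∀ M : Matrix (Fin n) (Fin n) (ZMod p),
      (Nat.card {φ : (Fin n → ZMod p) →ₗ[ZMod p] W //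
        Function.Surjective φ ∧ φ ∘ₗ Matrix.toLin' M = T ∘ₗ φ} : ℝ) =
      ∑ v ∈ Finset.univ.filter fun v : Fin n → W =>
        ∀ ψ : Module.Dual (ZMod p) W, ψ ≠ 0 → ∃ i, ψ (v i) ≠ 0,
        if ∀ b, ∑ a, M a b • v a = T (v b) then 1 else 0 := by
    intro M
    rw [card_surjective_intertwining]
    rw [Finset.sum_boole, Finset.filter_filter, Nat.card_eq_fintype_card, Fintype.card_subtype]
  simp_rw [h1, Finset.mul_sum]
  rw [Finset.sum_comm, spanningHitSum]
  refine Finset.sum_congr (by ext; simp) fun v _ => ?_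
  simp_rw [hitProb]
  rw [Finset.prod_univ_sum, Fintype.piFinset_univ]
  -- The expanded product runs over tuples of columns, that is, over transposed matrices.
  refine Fintype.sum_equiv (Matrix.transposeAddEquiv (Fin n) (Fin n) (ZMod p)).toEquiv _ _
    fun M => ?_
  rw [Finset.prod_mul_distrib, matrixWeight]
  congr 1
  rw [Finset.prod_boole]
  simp

theorem tendsto_sum_matrixWeight_mul_card [Finite W] {ε : ℝ} (hε : 0 < ε)
    (m : ∀ n : ℕ, Fin n → Fin n → ZMod p → ℝ) (hm : ∀ n a b, IsBalancedWeight ε (m n a b))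
    (T : Module.End (ZMod p) W) :
    Tendsto (fun n => ∑ M, matrixWeight (m n) M *
      (Nat.card {φ : (Fin n → ZMod p) →ₗ[ZMod p] W //
        Function.Surjective φ ∧ φ ∘ₗ Matrix.toLin' M = T ∘ₗ φ} : ℝ)) atTop (𝓝 1) := by
  have := Fintype.ofFinite W
  have : Finite (Module.Dual (ZMod p) W) := DFunLike.finite _
  have := Fintype.ofFinite (Module.Dual (ZMod p) W)
  simp_rw [sum_matrixWeight_mul_card]
  exact tendsto_spanningHitSum hε _ (fun n b i => hm n i b) _

end MatrixMoments

/-! ### Inclusion–exclusion over subspaces and Euler's product. -/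

section GaussFactors

/-- The number `(x - 1) (x - q) ⋯ (x - q ^ (k - 1))` of injective linear maps from a
`k`-dimensional space into a space with `x` elements. -/
noncomputable def qFalling (q : ℝ) (k : ℕ) (x : ℝ) : ℝ := ∏ i ∈ Finset.range k, (x - q ^ i)

/-- The product `(q - 1) (q ^ 2 - 1) ⋯ (q ^ k - 1)`. -/
noncomputable def qDenom (q : ℝ) (k : ℕ) : ℝ := ∏ i ∈ Finset.range k, (q ^ (i + 1) - 1)

variable {q : ℝ}

theorem qDenom_pos (hq : 1 < q) (k : ℕ) : 0 < qDenom q k :=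
  Finset.prod_pos fun _ _ => sub_pos.2 (one_lt_pow₀ hq (Nat.succ_ne_zero _))

theorem qDenom_succ (k : ℕ) : qDenom q (k + 1) = qDenom q k * (q ^ (k + 1) - 1) :=
  Finset.prod_range_succ _ _

theorem qFalling_pow_nonneg (hq : 1 < q) (k r : ℕ) : 0 ≤ qFalling q k (q ^ r) := by
  by_cases h : r < k
  · rw [qFalling, Finset.prod_eq_zero (Finset.mem_range.2 h) (sub_self _)]
  · refine Finset.prod_nonneg fun i hi => sub_nonneg.2 (pow_le_pow_right₀ hq.le ?_)
    have := Finset.mem_range.1 hi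
    omega

/-- At `x = q ^ r` the `k`-th term is `(-1) ^ k q ^ (k(k-1)/2)` times the number of `k`-dimensional
subspaces of an `r`-dimensional space: the Möbius sum of the subspace lattice, truncated at `S`. -/
theorem sum_qFalling_div_qDenom (hq : 1 < q) (x : ℝ) (S : ℕ) :
    ∑ k ∈ Finset.range (S + 1), (-1) ^ k / qDenom q k * qFalling q k x =
      (-1) ^ S * (∏ s ∈ Finset.range S, (x - q ^ (s + 1))) / qDenom q S := by
  induction S with
  | zero => simp [qFalling, qDenom]
  | succ S ih =>
    rw [Finset.sum_range_succ, ih, qDenom_succ, Finset.prod_range_succ]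
    have h1 : qFalling q (S + 1) x = (∏ s ∈ Finset.range S, (x - q ^ (s + 1))) * (x - 1) := by
      rw [qFalling, Finset.prod_range_succ', pow_zero]
    rw [h1]
    have h2 := (qDenom_pos hq S).ne'
    have h3 : q ^ (S + 1) - 1 ≠ 0 := (sub_pos.2 (one_lt_pow₀ hq (Nat.succ_ne_zero _))).ne'
    field_simp
    ring

/-- A Bonferroni inequality: the error is at most the first omitted term. For `1 ≤ r ≤ S` the closed
form has a vanishing factor. The bound is again a factorial moment, so its expectation is under
control. -/
theorem abs_sum_qFalling_sub_le (hq : 1 < q) (r S : ℕ) :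
    |∑ k ∈ Finset.range (S + 1), (-1) ^ k / qDenom q k * qFalling q k (q ^ r) -
      if r = 0 then 1 else 0| ≤ 1 / qDenom q (S + 1) * qFalling q (S + 1) (q ^ r) := by
  have hnn : 0 ≤ 1 / qDenom q (S + 1) * qFalling q (S + 1) (q ^ r) :=
    mul_nonneg (one_div_nonneg.2 (qDenom_pos hq _).le) (qFalling_pow_nonneg hq _ _)
  rw [sum_qFalling_div_qDenom hq]
  rcases Nat.eq_zero_or_pos r with rfl | hr
  · have : (-1 : ℝ) ^ S * ∏ s ∈ Finset.range S, (q ^ 0 - q ^ (s + 1)) = qDenom q S := by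
      rw [← Finset.card_range S, ← Finset.prod_const, Finset.card_range, ← Finset.prod_mul_distrib]
      exact Finset.prod_congr rfl fun s _ => by ring
    rw [this, div_self (qDenom_pos hq S).ne']
    simpa using hnn
  · rw [if_neg hr.ne', sub_zero]
    by_cases h : r ≤ S
    · rw [Finset.prod_eq_zero (i := r - 1) (Finset.mem_range.2 (by omega))]
      · simpa using hnn
      · rw [Nat.sub_add_cancel hr, sub_self]
    · push Not at h
      have hS : 0 < q ^ (S + 1) - 1 := sub_pos.2 (one_lt_pow₀ hq (Nat.succ_ne_zero _))
      have hle : q ^ (S + 1) ≤ q ^ r := pow_le_pow_right₀ hq.le h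
      have hprod : 0 ≤ ∏ s ∈ Finset.range S, (q ^ r - q ^ (s + 1)) :=
        Finset.prod_nonneg fun s hs => sub_nonneg.2 (pow_le_pow_right₀ hq.le (by
          have := Finset.mem_range.1 hs; omega))
      have hF : qFalling q (S + 1) (q ^ r) =
          (∏ s ∈ Finset.range S, (q ^ r - q ^ (s + 1))) * (q ^ r - 1) := by
        rw [qFalling, Finset.prod_range_succ', pow_zero]
      have hD := qDenom_pos hq S
      rw [abs_div, abs_mul, abs_pow, abs_neg, abs_one, one_pow, one_mul, abs_of_nonneg hprod,
        abs_of_pos hD, hF, qDenom_succ, one_div_mul_eq_div, mul_div_mul_comm]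
      refine le_mul_of_one_le_right (by positivity) ?_
      rw [one_le_div hS]
      linarith

theorem summable_one_div_qDenom (hq : 1 < q) : Summable fun k => 1 / qDenom q k := by
  refine summable_of_ratio_test_tendsto_lt_one (l := 0) one_pos
    (Eventually.of_forall fun k => (one_div_pos.2 (qDenom_pos hq k)).ne') ?_
  have h1 : Tendsto (fun k : ℕ => q ^ (k + 1) - 1) atTop atTop :=
    tendsto_atTop_add_const_right _ _ ((tendsto_pow_atTop_atTop_of_one_lt hq).comp
      (tendsto_add_atTop_nat 1))
  refine h1.inv_tendsto_atTop.congr fun k => ?_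
  have h2 := qDenom_pos hq k
  have h3 : 0 < q ^ (k + 1) - 1 := sub_pos.2 (one_lt_pow₀ hq (Nat.succ_ne_zero _))
  rw [Pi.inv_apply, Real.norm_of_nonneg (one_div_nonneg.2 (qDenom_pos hq _).le),
    Real.norm_of_nonneg (one_div_nonneg.2 h2.le), qDenom_succ]
  field_simp

/-- The value `∑ (-1) ^ k / ((q - 1) ⋯ (q ^ k - 1))`, which by Euler's identity equals
`∏ (1 - q ^ (-k))`. -/
noncomputable def eulerValue (q : ℝ) : ℝ := ∑' k, (-1) ^ k / qDenom q k

theorem abs_neg_one_pow_div_qDenom (hq : 1 < q) (k : ℕ) :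
    |(-1) ^ k / qDenom q k| = 1 / qDenom q k := by
  rw [abs_div, abs_pow, abs_neg, abs_one, one_pow, abs_of_pos (qDenom_pos hq k)]

theorem tendsto_sum_eulerValue (hq : 1 < q) :
    Tendsto (fun S => ∑ k ∈ Finset.range (S + 1), (-1) ^ k / qDenom q k) atTop
      (𝓝 (eulerValue q)) := by
  have hs : Summable fun k => (-1) ^ k / qDenom q k := Summable.of_norm <| by
    simpa only [Real.norm_eq_abs, abs_neg_one_pow_div_qDenom hq] using summable_one_div_qDenom hq
  exact (hs.hasSum.tendsto_sum_nat).comp (tendsto_add_atTop_nat 1)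

/-- Euler's identity. -/
theorem tendsto_prod_eulerValue (hq : 1 < q) :
    Tendsto (fun N => ∏ k ∈ Finset.range N, (1 - q⁻¹ ^ (k + 1))) atTop (𝓝 (eulerValue q)) := by
  set t := q⁻¹ with ht
  have hq0 : 0 < q := one_pos.trans hq
  have ht0 : 0 < t := inv_pos.2 hq0
  have ht1 : t < 1 := inv_lt_one_of_one_lt₀ hq
  set c : ℕ → ℝ := fun k => (-1) ^ k / qDenom q k with hc
  have hcs : Summable fun k => |c k| := by
    simpa only [hc, abs_neg_one_pow_div_qDenom hq] using summable_one_div_qDenom hq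
  have hbd : ∀ N k, |c k * (t ^ N) ^ k| ≤ |c k| := fun N k => by
    rw [abs_mul, abs_of_nonneg (by positivity : 0 ≤ (t ^ N) ^ k)]
    exact mul_le_of_le_one_right (abs_nonneg _)
      (pow_le_one₀ (by positivity) (pow_le_one₀ ht0.le ht1.le))
  have hs : ∀ N, Summable fun k => c k * (t ^ N) ^ k := fun N =>
    Summable.of_norm_bounded hcs (hbd N)
  -- `a N` is `G(t ^ N)` for `G(z) = ∑ c k z ^ k`. The ratio of successive coefficients gives `G(z)
  -- = (1 - tz) G(tz)`; iterating this from `z = 1`, with `G(z) → 1` as `z → 0`, yields the product.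
  set a : ℕ → ℝ := fun N => ∑' k, c k * (t ^ N) ^ k with ha
  have hc0 : c 0 = 1 := by simp [hc, qDenom]
  have hcsucc : ∀ k, c (k + 1) * (1 - t ^ (k + 1)) = -c k * t ^ (k + 1) := by
    intro k
    have h2 := (qDenom_pos hq k).ne'
    have h3 : q ^ (k + 1) - 1 ≠ 0 := (sub_pos.2 (one_lt_pow₀ hq (Nat.succ_ne_zero _))).ne'
    have h4 : 1 - t ^ (k + 1) = (q ^ (k + 1) - 1) * t ^ (k + 1) := by
      rw [sub_mul, one_mul, ← mul_pow, ht, mul_inv_cancel₀ hq0.ne', one_pow]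
    rw [h4]
    simp only [hc, qDenom_succ]
    field_simp
    ring
  have hrec : ∀ N, a N = (1 - t ^ (N + 1)) * a (N + 1) := by
    intro N
    have h1 : a N - a (N + 1) = ∑' k, (c k * (t ^ N) ^ k - c k * (t ^ (N + 1)) ^ k) :=
      ((hs N).tsum_sub (hs (N + 1))).symm
    have h2 : ∑' k, (c k * (t ^ N) ^ k - c k * (t ^ (N + 1)) ^ k) =
        ∑' k, -(t ^ (N + 1)) * (c k * (t ^ (N + 1)) ^ k) := by
      rw [((hs N).sub (hs (N + 1))).tsum_eq_zero_add]
      simp only [pow_zero, sub_self, zero_add]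
      refine tsum_congr fun k => ?_
      have e1 : c (k + 1) * (t ^ N) ^ (k + 1) - c (k + 1) * (t ^ (N + 1)) ^ (k + 1) =
          (c (k + 1) * (1 - t ^ (k + 1))) * (t ^ N) ^ (k + 1) := by
        rw [pow_succ t N, mul_pow]; ring
      rw [e1, hcsucc, pow_succ t N, mul_pow]; ring
    rw [h2, tsum_mul_left] at h1
    change a N - a (N + 1) = -(t ^ (N + 1)) * a (N + 1) at h1
    linarith
  have hprod : ∀ N, a 0 = (∏ k ∈ Finset.range N, (1 - t ^ (k + 1))) * a N := by
    intro N
    induction N with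
    | zero => simp
    | succ N ih => rw [Finset.prod_range_succ, mul_assoc, ← hrec, ih]
  have ha1 : Tendsto a atTop (𝓝 1) := by
    rw [tendsto_iff_norm_sub_tendsto_zero]
    have h0 : Tendsto (fun N => t ^ N * ∑' k, |c k|) atTop (𝓝 0) := by
      simpa using (tendsto_pow_atTop_nhds_zero_of_lt_one ht0.le ht1).mul_const _
    refine squeeze_zero (fun _ => norm_nonneg _) (fun N => ?_) h0
    have h1 : a N - 1 = ∑' k, c (k + 1) * (t ^ N) ^ (k + 1) := by
      rw [ha]
      simp only
      rw [(hs N).tsum_eq_zero_add, hc0]; simp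
    have hcs1 : Summable fun k => |c (k + 1)| := (summable_nat_add_iff 1).2 hcs
    have hb1 : ∀ k, ‖c (k + 1) * (t ^ N) ^ (k + 1)‖ ≤ t ^ N * |c (k + 1)| := fun k => by
      rw [Real.norm_eq_abs, abs_mul, abs_of_nonneg (by positivity : 0 ≤ (t ^ N) ^ (k + 1)),
        mul_comm]
      refine mul_le_mul_of_nonneg_right ?_ (abs_nonneg _)
      exact pow_le_of_le_one (by positivity) (pow_le_one₀ ht0.le ht1.le) (Nat.succ_ne_zero _)
    rw [h1]
    refine (tsum_of_norm_bounded (hcs1.mul_left (t ^ N)).hasSum hb1).trans ?_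
    rw [tsum_mul_left]
    refine mul_le_mul_of_nonneg_left ?_ (by positivity)
    rw [hcs.tsum_eq_zero_add]
    linarith [abs_nonneg (c 0)]
  have hlim : Tendsto (fun N => a 0 / a N) atTop (𝓝 (a 0 / 1)) :=
    tendsto_const_nhds.div ha1 one_ne_zero
  have ha0 : a 0 = eulerValue q := by simp [ha, hc, eulerValue]
  rw [div_one, ha0] at hlim
  refine hlim.congr' ?_
  filter_upwards [ha1.eventually_ne one_ne_zero] with N hN
  rw [← ha0, hprod N, mul_div_cancel_right₀ _ hN]

end GaussFactors

/-! ### From mixed factorial moments to the weight of rank zero. -/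

section Determinacy

/-- The right side has product form, so bounding each `|a i - b i|` by a factorial moment term again
leaves a combination of mixed moments. -/
theorem abs_prod_sub_prod_le {ι : Type*} (s : Finset ι) (a b : ι → ℝ) (hb : ∀ i, |b i| ≤ 1) :
    |∏ i ∈ s, a i - ∏ i ∈ s, b i| ≤ ∏ i ∈ s, (1 + |a i - b i|) - 1 := by
  classical
  induction s using Finset.induction_on with
  | empty => simp
  | insert j s hj ih =>
    rw [Finset.prod_insert hj, Finset.prod_insert hj, Finset.prod_insert hj]
    have e : a j * ∏ i ∈ s, a i - b j * ∏ i ∈ s, b i =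
        a j * (∏ i ∈ s, a i - ∏ i ∈ s, b i) + (a j - b j) * ∏ i ∈ s, b i := by ring
    have ha : |a j| ≤ 1 + |a j - b j| := by
      have := abs_add_le (a j - b j) (b j)
      rw [sub_add_cancel] at this
      linarith [hb j]
    have hpb : |∏ i ∈ s, b i| ≤ 1 := by
      rw [Finset.abs_prod]; exact Finset.prod_le_one (fun _ _ => abs_nonneg _) fun i _ => hb i
    rw [e]
    refine (abs_add_le _ _).trans ?_
    rw [abs_mul, abs_mul]
    have h1 := mul_le_mul ha ih (abs_nonneg _) (by positivity)
    have h2 := mul_le_mul_of_nonneg_left hpb (abs_nonneg (a j - b j))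
    nlinarith

variable {ι : Type*} [Fintype ι] [DecidableEq ι] {I : ℕ → Type*} [∀ n, Fintype (I n)]

theorem tendsto_sum_prod_combination (w : ∀ n, I n → ℝ) (r : ∀ n, I n → ι → ℕ) (q : ι → ℝ)
    (hmom : ∀ k : ι → ℕ, Tendsto (fun n => ∑ a, w n a * ∏ i, qFalling (q i) (k i) (q i ^ r n a i))
      atTop (𝓝 1)) (s : Finset ℕ) (c : ι → ℕ → ℝ) :
    Tendsto (fun n => ∑ a, w n a * ∏ i, ∑ k ∈ s, c i k * qFalling (q i) k (q i ^ r n a i)) atTop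
      (𝓝 (∏ i, ∑ k ∈ s, c i k)) := by
  have h1 : ∀ n, ∑ a, w n a * ∏ i, ∑ k ∈ s, c i k * qFalling (q i) k (q i ^ r n a i) =
      ∑ k ∈ Fintype.piFinset fun _ : ι => s, (∏ i, c i (k i)) *
        ∑ a, w n a * ∏ i, qFalling (q i) (k i) (q i ^ r n a i) := by
    intro n
    simp_rw [Finset.prod_univ_sum, Finset.mul_sum]
    rw [Finset.sum_comm]
    refine Finset.sum_congr rfl fun k _ => Finset.sum_congr rfl fun a _ => ?_
    rw [Finset.prod_mul_distrib]; ring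
  simp_rw [h1, Finset.prod_univ_sum]
  refine tendsto_finsetSum _ fun k _ => ?_
  simpa using (hmom k).const_mul (∏ i, c i (k i))

/-- If all mixed factorial moments of the ranks tend to one, then the probability that all ranks
vanish converges to the product of the Euler values. -/
theorem tendsto_sum_ranks_zero (w : ∀ n, I n → ℝ) (hw : ∀ n a, 0 ≤ w n a)
    (r : ∀ n, I n → ι → ℕ) (q : ι → ℝ) (hq : ∀ i, 1 < q i)
    (hmom : ∀ k : ι → ℕ, Tendsto (fun n => ∑ a, w n a * ∏ i, qFalling (q i) (k i) (q i ^ r n a i))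
      atTop (𝓝 1)) :
    Tendsto (fun n => ∑ a, w n a * if ∀ i, r n a i = 0 then 1 else 0) atTop
      (𝓝 (∏ i, eulerValue (q i))) := by
  set c : ι → ℕ → ℝ := fun i k => (-1) ^ k / qDenom (q i) k with hc
  set main : ℕ → ℕ → ℝ := fun S n =>
    ∑ a, w n a * ∏ i, ∑ k ∈ Finset.range (S + 1), c i k * qFalling (q i) k (q i ^ r n a i)
  -- Over the indices `0` and `S + 1` these coefficients spell out `∏ (1 + first omitted term)`; in
  -- `err` the total mass, the moment of order 0, is subtracted.
  set e : ℕ → ι → ℕ → ℝ := fun S i k => if k = 0 then 1 else 1 / qDenom (q i) (S + 1)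
  set err : ℕ → ℕ → ℝ := fun S n =>
    ∑ a, w n a * ∏ i, ∑ k ∈ ({0, S + 1} : Finset ℕ), e S i k * qFalling (q i) k (q i ^ r n a i) -
      ∑ a, w n a * ∏ i, qFalling (q i) 0 (q i ^ r n a i)
  have hmain : ∀ S, Tendsto (main S) atTop (𝓝 (∏ i, ∑ k ∈ Finset.range (S + 1), c i k)) :=
    fun S => tendsto_sum_prod_combination w r q hmom _ _
  have hS0 : ∀ S : ℕ, (0 : ℕ) ∉ ({S + 1} : Finset ℕ) := fun S => by simp
  have herr : ∀ S, Tendsto (err S) atTop (𝓝 (∏ i, (1 + 1 / qDenom (q i) (S + 1)) - 1)) := by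
    intro S
    have := (tendsto_sum_prod_combination w r q hmom {0, S + 1} (e S)).sub (hmom fun _ => 0)
    change Tendsto (fun n => err S n) atTop _
    simpa only [Finset.sum_insert (hS0 S), Finset.sum_singleton, e, if_true, Nat.succ_ne_zero,
      if_false, err] using this
  have hbound : ∀ S n, |main S n - ∑ a, w n a * if ∀ i, r n a i = 0 then 1 else 0| ≤ err S n := by
    intro S n
    simp only [main, err]
    rw [← Finset.sum_sub_distrib, ← Finset.sum_sub_distrib]
    refine (Finset.abs_sum_le_sum_abs _ _).trans (Finset.sum_le_sum fun a _ => ?_)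
    rw [← mul_sub, ← mul_sub, abs_mul, abs_of_nonneg (hw n a)]
    refine mul_le_mul_of_nonneg_left ?_ (hw n a)
    have h1 : (if ∀ i, r n a i = 0 then (1 : ℝ) else 0) =
        ∏ i, if r n a i = 0 then (1 : ℝ) else 0 := by
      rw [Finset.prod_boole]; simp
    rw [h1]
    refine (abs_prod_sub_prod_le _ _ _ fun i => by split_ifs <;> simp).trans ?_
    have h2 : ∏ i, qFalling (q i) 0 (q i ^ r n a i) = 1 := by simp [qFalling]
    rw [h2]
    refine sub_le_sub_right (Finset.prod_le_prod (fun _ _ => by positivity) fun i _ => ?_) 1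
    rw [Finset.sum_insert (hS0 S), Finset.sum_singleton]
    simp only [e, if_true, Nat.succ_ne_zero, if_false, hc]
    have h3 : qFalling (q i) 0 (q i ^ r n a i) = 1 := by simp [qFalling]
    rw [h3, one_mul]
    exact add_le_add_right (abs_sum_qFalling_sub_le (hq i) _ _) 1
  have hmainlim : Tendsto (fun S => ∏ i, ∑ k ∈ Finset.range (S + 1), c i k) atTop
      (𝓝 (∏ i, eulerValue (q i))) :=
    tendsto_finsetProd _ fun i _ => tendsto_sum_eulerValue (hq i)
  have herrlim : Tendsto (fun S => ∏ i, (1 + 1 / qDenom (q i) (S + 1)) - 1) atTop (𝓝 0) := by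
    have : Tendsto (fun S => ∏ i, (1 + 1 / qDenom (q i) (S + 1)) - 1) atTop
        (𝓝 (∏ i : ι, (1 + 0) - 1)) :=
      (tendsto_finsetProd _ fun i _ => tendsto_const_nhds.add
        ((summable_one_div_qDenom (hq i)).tendsto_atTop_zero.comp (tendsto_add_atTop_nat 1))).sub_const 1
    simpa using this
  -- The truncation `S` is fixed first, then `n` is taken large.
  rw [Metric.tendsto_atTop']
  intro δ hδ
  have h3 : 0 < δ / 4 := by linarith
  obtain ⟨S, hS1, hS2⟩ := ((hmainlim.eventually (Metric.ball_mem_nhds _ h3)).and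
    (herrlim.eventually (Metric.ball_mem_nhds _ h3))).exists
  obtain ⟨N, hN⟩ := eventually_atTop.1 (((hmain S).eventually (Metric.ball_mem_nhds _ h3)).and
    ((herr S).eventually (Metric.ball_mem_nhds _ h3)))
  refine ⟨N, fun n hn => ?_⟩
  obtain ⟨h4, h5⟩ := hN n hn.le
  have h6 := hbound S n
  simp only [Real.dist_eq] at *
  rw [abs_lt] at *
  rw [abs_le] at h6
  constructor <;> linarith [hS1.1, hS1.2, hS2.1, hS2.2, h4.1, h4.2, h5.1, h5.2, h6.1, h6.2]

end Determinacy

/-! ### Factoring the limiting mass. -/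

section LimitMass

/-- The tail product is Euler's product divided by its first `j` factors. The two resulting factors
have separate sources: the count of endomorphisms and the condition on the kernel. -/
theorem nuMass_eq {p : ℕ} (hp : 1 < p) {f : (ZMod p)[X]} (hf : 0 < f.natDegree) (j : ℕ) :
    nuMass f j = ((p : ℝ) ^ f.natDegree)⁻¹ ^ j /
      (∏ k ∈ Finset.range j, (1 - ((p : ℝ) ^ f.natDegree)⁻¹ ^ (k + 1))) *
      eulerValue ((p : ℝ) ^ f.natDegree) := by
  set q : ℝ := (p : ℝ) ^ f.natDegree with hqdef
  have hq : 1 < q := one_lt_pow₀ (by exact_mod_cast hp) hf.ne'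
  have ht0 : 0 < q⁻¹ := inv_pos.2 (one_pos.trans hq)
  have ht1 : q⁻¹ < 1 := inv_lt_one_of_one_lt₀ hq
  have hpow : ∀ k, ((p : ℝ)⁻¹) ^ (k * f.natDegree) = q⁻¹ ^ k := fun k => by
    rw [mul_comm, pow_mul, inv_pow]
  have hPj : (∏ k ∈ Finset.range j, (1 - q⁻¹ ^ (k + 1))) ≠ 0 :=
    Finset.prod_ne_zero_iff.2 fun k _ =>
      (sub_pos.2 (pow_lt_one₀ ht0.le ht1 (Nat.succ_ne_zero _))).ne'
  have hmult : Multipliable fun k : ℕ => 1 - q⁻¹ ^ (j + 1 + k) := by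
    have : Summable fun k : ℕ => ‖-q⁻¹ ^ (j + 1 + k)‖ := by
      refine ((summable_geometric_of_lt_one ht0.le ht1).mul_left (q⁻¹ ^ (j + 1))).congr fun k => ?_
      rw [norm_neg, Real.norm_of_nonneg (by positivity), pow_add _ (j + 1)]
    simpa only [sub_eq_add_neg] using multipliable_one_add_of_summable this
  have h1 : Tendsto (fun N => ∏ k ∈ Finset.range N, (1 - q⁻¹ ^ (j + 1 + k))) atTop
      (𝓝 (eulerValue q / ∏ k ∈ Finset.range j, (1 - q⁻¹ ^ (k + 1)))) := by
    have h2 := ((tendsto_prod_eulerValue hq).comp (tendsto_add_atTop_nat j)).div_const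
      (∏ k ∈ Finset.range j, (1 - q⁻¹ ^ (k + 1)))
    refine h2.congr fun N => ?_
    rw [Function.comp_apply, add_comm N j, Finset.prod_range_add, mul_div_cancel_left₀ _ hPj]
    exact Finset.prod_congr rfl fun k _ => by ring_nf
  have h3 := tendsto_nhds_unique hmult.hasProd.tendsto_prod_nat h1
  rw [nuMass]
  simp only [hpow]
  rw [h3]; ring

end LimitMass

/-! ### Surjections from kernels as surjections onto extensions. -/

section Extensions

variable {F : Type*} [Field F]
  {V : Type*} [AddCommGroup V] [Module F V] [Module F[X] V] [IsScalarTower F F[X] V]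
  {W : Type*} [AddCommGroup W] [Module F W] [Module F[X] W] [IsScalarTower F F[X] W]
  {M : Type*} [AddCommGroup M] [Module F M] [Module F[X] M] [IsScalarTower F F[X] M]

/-- An `F`-linear map commuting with multiplication by `X` is `F[X]`-linear. -/
def LinearMap.ofCommX (φ : V →ₗ[F] W) (h : ∀ v, φ ((X : F[X]) • v) = (X : F[X]) • φ v) :
    V →ₗ[F[X]] W where
  toFun := φ
  map_add' := φ.map_add
  map_smul' g v := by
    simp only [RingHom.id_apply]
    induction g using Polynomial.induction_on' generalizing v with
    | add g₁ g₂ h₁ h₂ => rw [add_smul, map_add, h₁, h₂, add_smul]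
    | monomial n a =>
      induction n generalizing v with
      | zero =>
        have e : (monomial 0 a : F[X]) = a • (1 : F[X]) := by
          rw [smul_eq_C_mul, mul_one]; rfl
        rw [e, smul_assoc, one_smul, map_smul, smul_assoc, one_smul]
      | succ n ih =>
        rw [← monomial_mul_X, mul_smul, ih, h, mul_smul]

/-- The endomorphism of `W × M` acting as `X` on `M` and on the quotient `W`, with off-diagonal
part `D`. -/
noncomputable def extensionEnd (D : W →ₗ[F] M) : Module.End F (W × M) :=
  (Algebra.lsmul F F W (X : F[X]) ∘ₗ LinearMap.fst F W M).prod
    (Algebra.lsmul F F M (X : F[X]) ∘ₗ LinearMap.snd F W M + D ∘ₗ LinearMap.fst F W M)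

theorem extensionEnd_apply (D : W →ₗ[F] M) (x : W × M) :
    extensionEnd D x = ((X : F[X]) • x.1, (X : F[X]) • x.2 + D x.1) := rfl

/-- Surjections from the kernel of a surjection `φ : V → W` onto `M`, paired with linear maps
`W → M`, correspond to lifts of `φ` to surjections onto extensions of `W` by `M`. -/
theorem card_surjections_ker_mul_card [Finite V] [Finite W] [Finite M] (φ : V →ₗ[F[X]] W)
    (hφ : Function.Surjective φ) :
    Nat.card {ψ : LinearMap.ker φ →ₗ[F[X]] M // Function.Surjective ψ} * Nat.card (W →ₗ[F] M) =
      Nat.card {x : (W →ₗ[F] M) × (V →ₗ[F] M) //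
        (∀ v, x.2 ((X : F[X]) • v) = (X : F[X]) • x.2 v + x.1 (φ v)) ∧
        Function.Surjective fun v => (φ v, x.2 v)} := by
  -- An `F`-linear section splits `V`; its complement to the kernel is where the extension of `ψ`
  -- may be chosen freely.
  obtain ⟨s, hs⟩ := (φ.restrictScalars F).exists_rightInverse_of_surjective
    (LinearMap.range_eq_top.2 hφ)
  have hs' : ∀ w, φ (s w) = w := fun w => LinearMap.congr_fun hs w
  let π : V →ₗ[F] LinearMap.ker φ :=
    { toFun := fun v => ⟨v - s (φ v), by simp [hs']⟩
      map_add' := fun a b => Subtype.ext (by simp; abel)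
      map_smul' := fun c a => Subtype.ext (by
        have : φ (c • a) = c • φ a := (φ.restrictScalars F).map_smul c a
        simp [this, smul_sub]) }
  have hπ : ∀ v, (π v : V) = v - s (φ v) := fun v => rfl
  have hπk : ∀ k : LinearMap.ker φ, π k = k := fun k =>
    Subtype.ext (by rw [hπ, k.2, map_zero, sub_zero])
  rw [← Nat.card_prod]
  let tilde : (LinearMap.ker φ →ₗ[F[X]] M) → (W →ₗ[F] M) → V →ₗ[F] M := fun ψ η =>
    ψ.restrictScalars F ∘ₗ π + η ∘ₗ φ.restrictScalars F
  have htilde : ∀ ψ η v, tilde ψ η v = ψ (π v) + η (φ v) := fun ψ η v => rfl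
  have htk : ∀ ψ η (k : LinearMap.ker φ), tilde ψ η k = ψ k := fun ψ η k => by
    rw [htilde, hπk, k.2, map_zero, add_zero]
  -- The failure to commute with `X`. It vanishes on `ker φ` when `θ` extends an `F[X]`-linear `ψ`,
  -- hence descends to the off-diagonal part `D` on `W`.
  let δ : (V →ₗ[F] M) → V →ₗ[F] M := fun θ =>
    θ ∘ₗ Algebra.lsmul F F V (X : F[X]) - Algebra.lsmul F F M (X : F[X]) ∘ₗ θ
  have hδ : ∀ θ v, δ θ v = θ ((X : F[X]) • v) - (X : F[X]) • θ v := fun θ v => rfl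
  have hcomm : ∀ ψ η v, tilde ψ η ((X : F[X]) • v) =
      (X : F[X]) • tilde ψ η v + (δ (tilde ψ η) ∘ₗ s) (φ v) := by
    intro ψ η v
    have h1 : v = (π v : V) + s (φ v) := by rw [hπ]; abel
    have h2 : δ (tilde ψ η) v = δ (tilde ψ η) (s (φ v)) := by
      conv_lhs => rw [h1]
      rw [map_add, hδ _ (π v : V)]
      have : (X : F[X]) • (π v : V) = ((X : F[X]) • π v : LinearMap.ker φ) := rfl
      rw [this, htk, htk, map_smul, sub_self, zero_add]
    rw [LinearMap.comp_apply, ← h2, hδ]; abel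
  refine Nat.card_congr ⟨fun x => ⟨(δ (tilde x.1.1 x.2) ∘ₗ s, tilde x.1.1 x.2), hcomm _ _, ?_⟩,
    fun x => ⟨⟨LinearMap.ofCommX (x.1.2 ∘ₗ (LinearMap.ker φ).subtype.restrictScalars F) ?_, ?_⟩,
      x.1.2 ∘ₗ s⟩, ?_, ?_⟩
  · rintro ⟨w, m⟩
    obtain ⟨k, hk⟩ := x.1.2 (m - tilde x.1.1 x.2 (s w))
    refine ⟨s w + k, Prod.ext ?_ ?_⟩
    · simp only [map_add, hs', LinearMap.mem_ker.1 k.2, add_zero]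
    · simp only [map_add, htk]
      rw [hk]; abel
  · intro v
    have := x.2.1 (v : V)
    rw [v.2, map_zero, add_zero] at this
    exact this
  · intro m
    obtain ⟨v, hv⟩ := x.2.2 (0, m)
    exact ⟨⟨v, congrArg Prod.fst hv⟩, congrArg Prod.snd hv⟩
  · rintro ⟨⟨ψ, hψ⟩, η⟩
    refine Prod.ext (Subtype.ext (LinearMap.ext fun k => ?_)) (LinearMap.ext fun w => ?_)
    · exact htk ψ η k
    · have h0 : π (s w) = 0 := Subtype.ext (by rw [hπ, hs', sub_self]; rfl)
      simp only [LinearMap.comp_apply]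
      rw [htilde, h0, map_zero, zero_add, hs']
  · rintro ⟨⟨D, θ⟩, hD, hsur⟩
    have ht : ∀ v, θ (π v : V) + θ (s (φ v)) = θ v := fun v => by rw [← map_add, hπ, sub_add_cancel]
    have ht' : tilde (LinearMap.ofCommX (θ ∘ₗ (LinearMap.ker φ).subtype.restrictScalars F)
        (fun v => by
          have := hD (v : V)
          rw [v.2, map_zero, add_zero] at this
          exact this)) (θ ∘ₗ s) = θ := LinearMap.ext fun v => ht v
    refine Subtype.ext (Prod.ext ?_ ?_)
    · refine LinearMap.ext fun w => ?_
      change (δ (tilde _ _) ∘ₗ s) w = D w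
      rw [ht', LinearMap.comp_apply, hδ]
      have := hD (s w)
      simp only at this
      rw [this, hs']; abel
    · exact ht'

/-- Counting pairs of successive surjections by extensions. -/
theorem sum_card_surjections_ker_mul_card [Finite V] [Finite W] [Finite M]
    [Fintype {φ : V →ₗ[F[X]] W // Function.Surjective φ}] [Fintype (W →ₗ[F] M)] :
    (∑ φ : {φ : V →ₗ[F[X]] W // Function.Surjective φ},
      Nat.card {ψ : LinearMap.ker φ.1 →ₗ[F[X]] M // Function.Surjective ψ}) *
        Fintype.card (W →ₗ[F] M) =
      ∑ D : W →ₗ[F] M, Nat.card {Φ : V →ₗ[F] W × M // Function.Surjective Φ ∧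
        ∀ v, Φ ((X : F[X]) • v) = extensionEnd D (Φ v)} := by
  have : Finite (V →ₗ[F] W × M) := DFunLike.finite _
  have : Finite (V →ₗ[F] M) := DFunLike.finite _
  rw [Finset.sum_mul, ← Nat.card_eq_fintype_card]
  simp_rw [fun φ : {φ : V →ₗ[F[X]] W // Function.Surjective φ} =>
    card_surjections_ker_mul_card (M := M) φ.1 φ.2]
  rw [← Nat.card_sigma, ← Nat.card_sigma]
  refine Nat.card_congr ⟨fun x => ⟨x.2.1.1, (x.1.1.restrictScalars F).prod x.2.1.2, ?_, ?_⟩,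
    fun x => ⟨⟨LinearMap.ofCommX (LinearMap.fst F W M ∘ₗ x.2.1) ?_, ?_⟩,
      (x.1, LinearMap.snd F W M ∘ₗ x.2.1), ?_, ?_⟩, ?_, ?_⟩
  · exact x.2.2.2
  · intro v
    rw [extensionEnd_apply]
    refine Prod.ext ?_ ?_
    · exact x.1.1.map_smul _ _
    · exact x.2.2.1 v
  · intro v
    exact congrArg Prod.fst (x.2.2.2 v)
  · exact Prod.fst_surjective.comp x.2.2.1
  · intro v
    exact congrArg Prod.snd (x.2.2.2 v)
  · exact x.2.2.1
  · rintro ⟨⟨φ, hφ⟩, ⟨⟨D, θ⟩, h⟩⟩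
    exact Sigma.subtype_ext (Subtype.ext (LinearMap.ext fun _ => rfl)) rfl
  · rintro ⟨D, ⟨Φ, h⟩⟩
    exact Sigma.subtype_ext rfl (LinearMap.ext fun _ => rfl)

end Extensions

/-! ### Surjections onto products of residue fields. -/

section Residue

variable {R : Type*} [CommRing R] {K : Type*} [AddCommGroup K] [Module R K]

/-- Surjectivity of `R → L` makes the range an `L`-subspace of `L ^ k`. If proper, it lies in a
hyperplane, whose equation is a linear relation among the `s i`. -/
theorem surjective_pi_iff_linearIndependent {L : Type*} [Field L] [Algebra R L]
    (hL : Function.Surjective (algebraMap R L)) {k : ℕ} (s : Fin k → K →ₗ[R] L) :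
    Function.Surjective (LinearMap.pi s) ↔ LinearIndependent L s := by
  classical
  rw [Fintype.linearIndependent_iff]
  constructor
  · intro h c hc i
    obtain ⟨x, hx⟩ := h (Pi.single i 1)
    have := LinearMap.congr_fun hc x
    simp only [LinearMap.sum_apply, LinearMap.smul_apply, smul_eq_mul, LinearMap.zero_apply] at this
    rw [← this]
    have hx' : ∀ j, s j x = (Pi.single i 1 : Fin k → L) j := fun j => congrFun hx j
    simp [hx', Pi.single_apply]
  · intro h
    let U : Submodule L (Fin k → L) :=
      { carrier := Set.range (LinearMap.pi s)
        add_mem' := by rintro _ _ ⟨x, rfl⟩ ⟨y, rfl⟩; exact ⟨x + y, map_add _ _ _⟩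
        zero_mem' := ⟨0, map_zero _⟩
        smul_mem' := by
          rintro c _ ⟨x, rfl⟩
          obtain ⟨r, rfl⟩ := hL c
          exact ⟨r • x, by rw [map_smul, algebraMap_smul]⟩ }
    by_contra hns
    have hU : U < ⊤ := lt_top_iff_ne_top.2 fun hU => hns fun y => by
      have : y ∈ U := hU ▸ Submodule.mem_top
      exact this
    obtain ⟨ψ, hψ, hle⟩ := Submodule.exists_le_ker_of_lt_top U hU
    apply hψ
    have hzero : ∀ i, ψ (Pi.single i 1) = 0 := by
      refine h _ (LinearMap.ext fun x => ?_)
      have hx : ψ (LinearMap.pi s x) = 0 := hle ⟨x, rfl⟩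
      rw [LinearMap.pi_apply_eq_sum_univ ψ] at hx
      simp only [LinearMap.sum_apply, LinearMap.smul_apply, smul_eq_mul, LinearMap.zero_apply]
      rw [← hx]
      refine Finset.sum_congr rfl fun i _ => ?_
      rw [smul_eq_mul, mul_comm]
      congr 2
      ext j
      simp [Pi.single_apply, eq_comm]
    refine LinearMap.pi_ext' fun i => LinearMap.ext_ring ?_
    simpa using hzero i

theorem card_linearIndependent_eq_qFalling {L H : Type*} [Field L] [Finite L] [AddCommGroup H]
    [Module L H] [Finite H] (k : ℕ) :
    (Nat.card {s : Fin k → H // LinearIndependent L s} : ℝ) =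
      qFalling (Nat.card L) k ((Nat.card L : ℝ) ^ Module.finrank L H) := by
  have := Fintype.ofFinite L
  by_cases hk : k ≤ Module.finrank L H
  · rw [card_linearIndependent hk, Nat.card_eq_fintype_card, qFalling, ← Fin.prod_univ_eq_prod_range
      (fun i => (Fintype.card L : ℝ) ^ Module.finrank L H - (Fintype.card L : ℝ) ^ i)]
    push_cast
    refine Finset.prod_congr rfl fun i _ => ?_
    rw [Nat.cast_sub (Nat.pow_le_pow_right Fintype.card_pos (i.2.le.trans hk))]
    push_cast; rfl
  · have : IsEmpty {s : Fin k → H // LinearIndependent L s} := ⟨fun s => hk (by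
      simpa using s.2.fintype_card_le_finrank)⟩
    rw [Nat.card_of_isEmpty, qFalling,
      Finset.prod_eq_zero (Finset.mem_range.2 (not_le.1 hk)) (sub_self _), Nat.cast_zero]

theorem card_surjections_pi_field [Finite K] {L : Type*} [Field L] [Finite L] [Algebra R L]
    (hL : Function.Surjective (algebraMap R L)) (k : ℕ) :
    (Nat.card {ψ : K →ₗ[R] (Fin k → L) // Function.Surjective ψ} : ℝ) =
      qFalling (Nat.card L) k ((Nat.card L : ℝ) ^ Module.finrank L (K →ₗ[R] L)) := by
  have : Finite (K →ₗ[R] L) := DFunLike.finite _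
  have e : {s : Fin k → K →ₗ[R] L // LinearIndependent L s} ≃
      {ψ : K →ₗ[R] (Fin k → L) // Function.Surjective ψ} :=
    { toFun := fun s => ⟨LinearMap.pi s.1, (surjective_pi_iff_linearIndependent hL _).2 s.2⟩
      invFun := fun ψ => ⟨fun i => LinearMap.proj i ∘ₗ ψ.1, by
        rw [← surjective_pi_iff_linearIndependent hL, LinearMap.pi_proj_comp]
        exact ψ.2⟩
      left_inv := fun s => Subtype.ext (funext fun i => LinearMap.ext fun x => rfl)
      right_inv := fun ψ => Subtype.ext (LinearMap.pi_proj_comp ψ.1) }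
  rw [← Nat.card_congr e, card_linearIndependent_eq_qFalling]

variable {ι : Type*} [Fintype ι]

/-- Chinese remainder theorem: Bézout provides a scalar acting as 1 on `N i` and as 0 on the other
factors. -/
theorem surjective_pi_of_pairwise_coprime {N : ι → Type*} [∀ i, AddCommGroup (N i)]
    [∀ i, Module R (N i)] (f : ι → R) (hf : Pairwise fun i j => IsCoprime (f i) (f j))
    (hN : ∀ i (y : N i), f i • y = 0) (ψ : ∀ i, K →ₗ[R] N i)
    (hψ : ∀ i, Function.Surjective (ψ i)) : Function.Surjective (LinearMap.pi ψ) := by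
  classical
  intro y
  choose x hx using fun i => hψ i (y i)
  have hg : ∀ i, ∃ g : R, (∀ z : N i, g • z = z) ∧ ∀ j, j ≠ i → ∀ z : N j, g • z = 0 := by
    intro i
    obtain ⟨a, b, hab⟩ : IsCoprime (f i) (∏ j ∈ Finset.univ.erase i, f j) :=
      IsCoprime.prod_right fun j hj => hf (Finset.ne_of_mem_erase hj).symm
    refine ⟨b * ∏ j ∈ Finset.univ.erase i, f j, fun z => ?_, fun j hj z => ?_⟩
    · conv_rhs => rw [← one_smul R z, ← hab, add_smul, mul_smul a, hN, smul_zero, zero_add]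
    · obtain ⟨c, hc⟩ := Finset.dvd_prod_of_mem f (Finset.mem_erase.2 ⟨hj, Finset.mem_univ j⟩)
      rw [hc, mul_left_comm, mul_smul, hN]
  choose g hg1 hg2 using hg
  refine ⟨∑ i, g i • x i, funext fun j => ?_⟩
  rw [map_sum, Finset.sum_apply, Finset.sum_eq_single j]
  · rw [map_smul, Pi.smul_apply, LinearMap.pi_apply, hx, hg1]
  · intro i _ hij
    rw [map_smul, Pi.smul_apply, LinearMap.pi_apply, hg2 i j hij.symm]
  · simp

theorem card_surjections_pi_coprime {N : ι → Type*} [∀ i, AddCommGroup (N i)]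
    [∀ i, Module R (N i)] (f : ι → R) (hf : Pairwise fun i j => IsCoprime (f i) (f j))
    (hN : ∀ i (y : N i), f i • y = 0) :
    Nat.card {ψ : K →ₗ[R] (∀ i, N i) // Function.Surjective ψ} =
      ∏ i, Nat.card {ψ : K →ₗ[R] N i // Function.Surjective ψ} := by
  classical
  rw [← Nat.card_pi]
  refine Nat.card_congr
    { toFun := fun ψ i => ⟨LinearMap.proj i ∘ₗ ψ.1, (Function.surjective_eval i).comp ψ.2⟩
      invFun := fun ψ => ⟨LinearMap.pi fun i => (ψ i).1,
        surjective_pi_of_pairwise_coprime f hf hN _ fun i => (ψ i).2⟩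
      left_inv := fun ψ => rfl
      right_inv := fun ψ => rfl }

end Residue

/-! ### Characteristic polynomials of `F[X]`-modules. -/

section CharpolyModule

variable {F : Type*} [Field F]
  {V : Type*} [AddCommGroup V] [Module F V] [Module F[X] V] [IsScalarTower F F[X] V]
  {W : Type*} [AddCommGroup W] [Module F W] [Module F[X] W] [IsScalarTower F F[X] W]

variable (F V) in
/-- Multiplication by `X` on an `F[X]`-module, as an `F`-linear endomorphism. -/
noncomputable def xEnd : Module.End F V := Algebra.lsmul F F V (X : F[X])

theorem xEnd_apply (v : V) : xEnd F V v = (X : F[X]) • v := rfl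

theorem aeval_xEnd (g : F[X]) (v : V) : aeval (xEnd F V) g v = g • v := by
  rw [xEnd, aeval_algHom_apply, aeval_X_left_apply]; rfl

variable [FiniteDimensional F V] [FiniteDimensional F W]

instance finiteDimensional_submodule_polynomial (N : Submodule F[X] V) : FiniteDimensional F N :=
  inferInstanceAs (FiniteDimensional F (N.restrictScalars F))

instance finiteDimensional_quotient_polynomial (N : Submodule F[X] V) :
    FiniteDimensional F (V ⧸ N) :=
  Module.Finite.of_surjective (N.mkQ.restrictScalars F) N.mkQ_surjective

theorem charpoly_xEnd_smul (v : V) : (xEnd F V).charpoly • v = 0 := by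
  rw [← aeval_xEnd, LinearMap.aeval_self_charpoly]; rfl

theorem charpoly_xEnd_congr (e : V ≃ₗ[F[X]] W) : (xEnd F V).charpoly = (xEnd F W).charpoly := by
  rw [← LinearEquiv.charpoly_conj (e.restrictScalars F) (xEnd F V)]
  congr 1
  ext w
  rw [LinearEquiv.conj_apply_apply, xEnd_apply, xEnd_apply]
  change e ((X : F[X]) • e.symm w) = _
  rw [map_smul, LinearEquiv.apply_symm_apply]

/-- The characteristic polynomial of a block triangular endomorphism. -/
theorem charpoly_prod_triangular {U M : Type*} [AddCommGroup U] [Module F U] [FiniteDimensional F U]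
    [AddCommGroup M] [Module F M] [FiniteDimensional F M] (A : Module.End F U) (B : Module.End F M)
    (D : U →ₗ[F] M) :
    ((A ∘ₗ LinearMap.fst F U M).prod (B ∘ₗ LinearMap.snd F U M + D ∘ₗ LinearMap.fst F U M) :
      Module.End F (U × M)).charpoly = A.charpoly * B.charpoly := by
  classical
  let b₁ := Module.finBasis F U
  let b₂ := Module.finBasis F M
  rw [← LinearMap.charpoly_toMatrix A b₁, ← LinearMap.charpoly_toMatrix B b₂,
    ← LinearMap.charpoly_toMatrix _ (b₁.prod b₂), ← Matrix.charpoly_fromBlocks_zero₁₂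
      (M₂₁ := LinearMap.toMatrix b₁ b₂ D)]
  congr 1
  ext i j
  rcases i with i | i <;> rcases j with j | j <;>
    simp [LinearMap.toMatrix_apply]

/-- An `F`-linear section identifies `V` with `W × ker φ`, where `X` becomes block triangular. -/
theorem charpoly_xEnd_eq_mul (φ : V →ₗ[F[X]] W) (hφ : Function.Surjective φ) :
    (xEnd F V).charpoly = (xEnd F W).charpoly * (xEnd F (LinearMap.ker φ)).charpoly := by
  obtain ⟨s, hs⟩ := (φ.restrictScalars F).exists_rightInverse_of_surjective
    (LinearMap.range_eq_top.2 hφ)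
  have hs' : ∀ w, φ (s w) = w := fun w => LinearMap.congr_fun hs w
  let e : (W × LinearMap.ker φ) ≃ₗ[F] V :=
    { toFun := fun x => s x.1 + x.2
      map_add' := fun x y => by simp; abel
      map_smul' := fun c x => by simp [smul_add]
      invFun := fun v => (φ v, ⟨v - s (φ v), by simp [hs']⟩)
      left_inv := fun x => by
        have h : φ (s x.1 + x.2) = x.1 := by rw [map_add, hs', LinearMap.mem_ker.1 x.2.2, add_zero]
        refine Prod.ext h (Subtype.ext ?_)
        simp only [h]; abel
      right_inv := fun v => by simp }
  have he : ∀ x, e x = s x.1 + x.2 := fun x => rfl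
  let D : W →ₗ[F] LinearMap.ker φ :=
    LinearMap.snd F W (LinearMap.ker φ) ∘ₗ e.symm.toLinearMap ∘ₗ xEnd F V ∘ₗ s
  rw [← charpoly_prod_triangular (xEnd F W) (xEnd F (LinearMap.ker φ)) D,
    ← LinearEquiv.charpoly_conj e]
  congr 1
  ext v
  obtain ⟨x, rfl⟩ := e.surjective v
  rw [LinearEquiv.conj_apply_apply, LinearEquiv.symm_apply_apply]
  have h1 : e (xEnd F W x.1, D x.1) = (X : F[X]) • s x.1 := by
    have : (xEnd F W x.1, D x.1) = e.symm ((X : F[X]) • s x.1) := by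
      refine Prod.ext ?_ rfl
      change (X : F[X]) • x.1 = φ ((X : F[X]) • s x.1)
      rw [map_smul, hs']
    rw [this, LinearEquiv.apply_symm_apply]
  have h2 : e (0, xEnd F (LinearMap.ker φ) x.2) = (X : F[X]) • (x.2 : V) := by
    rw [he, map_zero, zero_add]; rfl
  have h3 : ((xEnd F W ∘ₗ LinearMap.fst F W (LinearMap.ker φ)).prod
      (xEnd F (LinearMap.ker φ) ∘ₗ LinearMap.snd F W (LinearMap.ker φ) +
        D ∘ₗ LinearMap.fst F W (LinearMap.ker φ))) x =
      (xEnd F W x.1, D x.1) + (0, xEnd F (LinearMap.ker φ) x.2) := by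
    refine Prod.ext ?_ ?_
    · simp
    · simp [add_comm]
  rw [h3, map_add, h1, h2, xEnd_apply, he, smul_add]

/-- Over `F[X]/(g)` the root of `g` is an eigenvalue of `M`, so spectral mapping puts 0 in the
spectrum of `g(M)`; a unit over `F` would remain a unit there. -/
theorem not_isUnit_aeval_of_dvd_charpoly {n : Type*} [Fintype n] [DecidableEq n]
    (M : Matrix n n F) {g : F[X]} (hg : Irreducible g) (h : g ∣ M.charpoly) :
    ¬ IsUnit (aeval M g) := by
  intro hu
  have := Fact.mk hg
  let L := AdjoinRoot g
  let ML : Matrix n n L := (algebraMap F L).mapMatrix M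
  have hroot : ML.charpoly.IsRoot (AdjoinRoot.root g) := by
    obtain ⟨c, hc⟩ := h
    have h0 : (g.map (algebraMap F L)).eval (AdjoinRoot.root g) = 0 := by
      rw [eval_map_algebraMap, AdjoinRoot.aeval_eq, AdjoinRoot.mk_self]
    have h1 : ML.charpoly = M.charpoly.map (algebraMap F L) := Matrix.charpoly_map M _
    rw [IsRoot, h1, hc, Polynomial.map_mul, eval_mul, h0, zero_mul]
  have hspec := Matrix.mem_spectrum_of_isRoot_charpoly hroot
  have h2 := spectrum.subset_polynomial_aeval ML (g.map (algebraMap F L)) ⟨_, hspec, rfl⟩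
  have h0 : (g.map (algebraMap F L)).eval (AdjoinRoot.root g) = 0 := by
    rw [eval_map_algebraMap, AdjoinRoot.aeval_eq, AdjoinRoot.mk_self]
  simp only [h0] at h2
  rw [spectrum.zero_mem_iff] at h2
  apply h2
  have h3 : aeval ML (g.map (algebraMap F L)) = (algebraMap F L).mapMatrix (aeval M g) := by
    rw [aeval_map_algebraMap]
    exact aeval_algHom_apply ((Algebra.ofId F L).mapMatrix) M g
  rw [h3]
  exact hu.map _

theorem exists_smul_eq_zero_of_dvd_charpoly {g : F[X]} (hg : Irreducible g)
    (h : g ∣ (xEnd F V).charpoly) : ∃ v : V, v ≠ 0 ∧ g • v = 0 := by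
  by_contra! hcon
  let b := Module.finBasis F V
  rw [← LinearMap.charpoly_toMatrix (xEnd F V) b] at h
  refine not_isUnit_aeval_of_dvd_charpoly _ hg h ?_
  have h1 : aeval (LinearMap.toMatrix b b (xEnd F V)) g =
      LinearMap.toMatrix b b (aeval (xEnd F V) g) :=
    aeval_algHom_apply (LinearMap.toMatrixAlgEquiv b).toAlgHom (xEnd F V) g
  have hinj : Function.Injective (aeval (xEnd F V) g) := by
    rw [← LinearMap.ker_eq_bot, LinearMap.ker_eq_bot']
    intro v hv
    by_contra hv0
    exact hcon v hv0 (by rw [← aeval_xEnd, hv])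
  have hu : IsUnit (aeval (xEnd F V) g) := (LinearMap.isUnit_iff_ker_eq_bot _).2
    (LinearMap.ker_eq_bot.2 hinj)
  rw [h1]
  exact hu.map (LinearMap.toMatrixAlgEquiv b).toAlgHom

theorem eq_zero_of_isCoprime_smul {M : Type*} [AddCommGroup M] [Module F[X] M] {a b : F[X]}
    (hab : IsCoprime a b) {v : M} (ha : a • v = 0) (hb : b • v = 0) : v = 0 := by
  obtain ⟨c, d, h⟩ := hab
  rw [← one_smul F[X] v, ← h, add_smul, mul_smul, mul_smul, ha, hb, smul_zero, smul_zero, add_zero]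

theorem injective_smul_of_isCoprime_charpoly {g : F[X]} (h : IsCoprime g (xEnd F V).charpoly) :
    Function.Injective fun v : V => g • v := by
  intro v w hvw
  rw [← sub_eq_zero]
  refine eq_zero_of_isCoprime_smul h ?_ (charpoly_xEnd_smul _)
  rw [smul_sub]
  exact sub_eq_zero.2 hvw

theorem dvd_charpoly_iff {g : F[X]} (hg : Irreducible g) :
    g ∣ (xEnd F V).charpoly ↔ ∃ v : V, v ≠ 0 ∧ g • v = 0 := by
  refine ⟨exists_smul_eq_zero_of_dvd_charpoly hg, fun ⟨v, hv0, hv⟩ => ?_⟩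
  by_contra hcon
  exact hv0 (eq_zero_of_isCoprime_smul ((hg.coprime_iff_not_dvd).2 hcon) hv (charpoly_xEnd_smul v))

theorem surjective_smul_of_not_dvd_charpoly {g : F[X]} (hg : Irreducible g)
    (h : ¬ g ∣ (xEnd F V).charpoly) : Function.Surjective fun v : V => g • v := by
  have hinj := injective_smul_of_isCoprime_charpoly ((hg.coprime_iff_not_dvd).2 h)
  have : Function.Injective (Algebra.lsmul F F V g) := hinj
  exact LinearMap.surjective_of_injective this

/-- An irreducible polynomial does not divide the characteristic polynomial if and only if the
module has no nonzero map to the corresponding simple module. -/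
theorem not_dvd_charpoly_iff_subsingleton {g : F[X]} (hg : Irreducible g) :
    ¬ g ∣ (xEnd F V).charpoly ↔ Subsingleton (V →ₗ[F[X]] F[X] ⧸ Ideal.span {g}) := by
  constructor
  · intro h
    refine ⟨fun a b => LinearMap.ext fun v => ?_⟩
    obtain ⟨w, rfl⟩ := surjective_smul_of_not_dvd_charpoly hg h v
    have h0 : ∀ y : F[X] ⧸ Ideal.span {g}, g • y = 0 := fun y => by
      obtain ⟨y, rfl⟩ := Ideal.Quotient.mk_surjective y
      exact Ideal.Quotient.eq_zero_iff_mem.2 (Ideal.mem_span_singleton.2 (dvd_mul_right _ _))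
    simp only [map_smul, h0]
  · intro hsub hdvd
    obtain ⟨v, hv0, hv⟩ := (dvd_charpoly_iff hg).1 hdvd
    -- Since `g` kills a nonzero vector, `gV ≠ V` by finite dimension. A maximal submodule
    -- containing `gV` has a simple quotient killed by `g`, which must be `F[X]/(g)`.
    let G : V →ₗ[F[X]] V := LinearMap.lsmul F[X] V g
    have hG : LinearMap.range G < ⊤ := by
      rw [lt_top_iff_ne_top]
      intro htop
      have hsurj : Function.Surjective (Algebra.lsmul F F V g) :=
        (LinearMap.range_eq_top.1 htop : Function.Surjective G)
      have hinj := LinearMap.injective_iff_surjective.2 hsurj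
      exact hv0 (hinj (by rw [map_zero]; exact hv))
    have : Module.Finite F[X] V := Module.Finite.of_restrictScalars_finite F F[X] V
    obtain ⟨N, hN, hle⟩ := (eq_top_or_exists_le_coatom (LinearMap.range G)).resolve_left hG.ne
    have : IsSimpleModule F[X] (V ⧸ N) := isSimpleModule_iff_isCoatom.2 hN
    obtain ⟨I, hI, ⟨e⟩⟩ := isSimpleModule_iff_quot_maximal.1 this
    have hgI : g ∈ I := by
      rw [← Ideal.Quotient.eq_zero_iff_mem]
      obtain ⟨y, hy⟩ := e.surjective 1
      obtain ⟨y, rfl⟩ := N.mkQ_surjective y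
      have h1 : g • N.mkQ y = 0 := by
        rw [← map_smul, Submodule.mkQ_apply, Submodule.Quotient.mk_eq_zero]
        exact hle ⟨y, rfl⟩
      have h2 : g • (1 : F[X] ⧸ I) = 0 := by rw [← hy, ← map_smul, h1, map_zero]
      have h3 : g • (1 : F[X] ⧸ I) = Ideal.Quotient.mk I (g * 1) := rfl
      rw [← h2, h3, mul_one]
    have hIg : Ideal.span {g} = I := by
      have hmax : (Ideal.span {g}).IsMaximal := PrincipalIdealRing.isMaximal_of_irreducible hg
      exact hmax.eq_of_le hI.ne_top ((Ideal.span_singleton_le_iff_mem _).2 hgI)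
    subst hIg
    have h0 := Subsingleton.elim (e.toLinearMap ∘ₗ N.mkQ) 0
    obtain ⟨y, hy⟩ := e.surjective 1
    obtain ⟨y, rfl⟩ := N.mkQ_surjective y
    have h1 := LinearMap.congr_fun h0 y
    rw [LinearMap.comp_apply, LinearMap.zero_apply] at h1
    exact one_ne_zero (hy.symm.trans h1)

end CharpolyModule

/-! ### Detecting multiplicities through the quotient `V / gV`. -/

section Factorization

variable {F : Type*} [Field F] {ι : Type*} [Fintype ι] {f : ι → F[X]}

theorem multiplicity_eq_of_eq_prod_mul (hirr : ∀ i, Irreducible (f i))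
    (hcop : Pairwise fun i j => IsCoprime (f i) (f j)) (j : ι → ℕ) {χ c : F[X]}
    (h : χ = (∏ i, f i ^ j i) * c) (hc : ∀ i, ¬ f i ∣ c) (i : ι) : multiplicity (f i) χ = j i := by
  classical
  rw [← Finset.mul_prod_erase _ _ (Finset.mem_univ i), mul_assoc] at h
  refine multiplicity_eq_of_dvd_of_not_dvd ⟨_, h⟩ fun hdvd => ?_
  rw [h, pow_succ] at hdvd
  have h1 := (mul_dvd_mul_iff_left (pow_ne_zero _ (hirr i).ne_zero)).1 hdvd
  rcases (hirr i).prime.dvd_or_dvd h1 with h2 | h2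
  · obtain ⟨l, hl, h3⟩ := (hirr i).prime.exists_mem_finset_dvd h2
    exact (hirr i).not_isUnit ((hcop (Finset.ne_of_mem_erase hl).symm).isUnit_of_dvd' dvd_rfl
      ((hirr i).prime.dvd_of_dvd_pow h3))
  · exact hc i h2

theorem exists_eq_prod_mul_of_multiplicity (hirr : ∀ i, Irreducible (f i))
    (hcop : Pairwise fun i j => IsCoprime (f i) (f j)) {j : ι → ℕ} {χ : F[X]} (hχ : χ ≠ 0)
    (h : ∀ i, multiplicity (f i) χ = j i) :
    ∃ c, χ = (∏ i, f i ^ j i) * c ∧ ∀ i, ¬ f i ∣ c := by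
  obtain ⟨c, hc⟩ : (∏ i, f i ^ j i) ∣ χ :=
    Fintype.prod_dvd_of_coprime (fun a b hab => (hcop hab).pow)
      fun i => h i ▸ pow_multiplicity_dvd _ _
  refine ⟨c, hc, fun i hi => ?_⟩
  have hfin : FiniteMultiplicity (f i) χ := FiniteMultiplicity.of_not_isUnit (hirr i).not_isUnit hχ
  refine hfin.not_pow_dvd_of_multiplicity_lt (m := j i + 1) (by rw [h i]; exact Nat.lt_succ_self _) ?_
  rw [hc, pow_succ]
  exact mul_dvd_mul (Finset.dvd_prod_of_mem (fun i => f i ^ j i) (Finset.mem_univ i)) hi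

variable {V : Type*} [AddCommGroup V] [Module F V] [Module F[X] V] [IsScalarTower F F[X] V]
  [FiniteDimensional F V]

theorem surjective_prod_smul_of_not_dvd_charpoly (hirr : ∀ i, Irreducible (f i)) (j : ι → ℕ)
    (h : ∀ i, ¬ f i ∣ (xEnd F V).charpoly) :
    Function.Surjective fun v : V => (∏ i, f i ^ j i) • v := by
  have hcop : IsCoprime (∏ i, f i ^ j i) (xEnd F V).charpoly :=
    IsCoprime.prod_left fun i _ => (((hirr i).coprime_iff_not_dvd).2 (h i)).pow_left
  have hinj : Function.Injective (Algebra.lsmul F F V (∏ i, f i ^ j i)) :=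
    injective_smul_of_isCoprime_charpoly hcop
  exact LinearMap.surjective_of_injective hinj

/-- The submodule `g V`. -/
noncomputable abbrev smulRange (V : Type*) [AddCommGroup V] [Module F[X] V] (g : F[X]) :
    Submodule F[X] V :=
  LinearMap.range (LinearMap.lsmul F[X] V g)

/-- Cayley–Hamilton shows that `c` kills `gV`, while `g` kills `V / gV`. Hence their characteristic
polynomials are prime to the `f i` and to `c` respectively, and multiplicativity separates the two
factors. -/
theorem charpoly_quotient_and_not_dvd (hirr : ∀ i, Irreducible (f i)) (hmonic : ∀ i, (f i).Monic)
    (j : ι → ℕ) {c : F[X]} (h : (xEnd F V).charpoly = (∏ i, f i ^ j i) * c)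
    (hc : ∀ i, ¬ f i ∣ c) :
    (xEnd F (V ⧸ smulRange V (∏ i, f i ^ j i))).charpoly = ∏ i, f i ^ j i ∧
      ∀ i, ¬ f i ∣ (xEnd F (smulRange V (∏ i, f i ^ j i))).charpoly := by
  set g := ∏ i, f i ^ j i with hg
  have hgc : IsCoprime g c :=
    IsCoprime.prod_left fun i _ => (((hirr i).coprime_iff_not_dvd).2 (hc i)).pow_left
  have hmul : (xEnd F V).charpoly = (xEnd F (V ⧸ smulRange V g)).charpoly *
      (xEnd F (smulRange V g)).charpoly := by
    have h1 := charpoly_xEnd_eq_mul (smulRange V g).mkQ (Submodule.mkQ_surjective _)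
    rw [h1]
    congr 1
    exact charpoly_xEnd_congr (LinearEquiv.ofEq _ _ (Submodule.ker_mkQ _))
  have hnd : ∀ i, ¬ f i ∣ (xEnd F (smulRange V g)).charpoly := by
    intro i hi
    obtain ⟨⟨v, ⟨w, rfl⟩⟩, hv0, hv⟩ := (dvd_charpoly_iff (hirr i)).1 hi
    refine hv0 (eq_zero_of_isCoprime_smul (((hirr i).coprime_iff_not_dvd).2 (hc i)) hv ?_)
    refine Subtype.ext ?_
    change c • g • w = 0
    rw [smul_smul, mul_comm, ← h, charpoly_xEnd_smul]
  refine ⟨?_, hnd⟩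
  have hgmonic : g.Monic := monic_prod_of_monic _ _ fun i _ => (hmonic i).pow _
  have hcop1 : IsCoprime g (xEnd F (smulRange V g)).charpoly :=
    IsCoprime.prod_left fun i _ => (((hirr i).coprime_iff_not_dvd).2 (hnd i)).pow_left
  have hcop2 : IsCoprime (xEnd F (V ⧸ smulRange V g)).charpoly c := by
    refine isCoprime_of_irreducible_dvd (fun h0 => (LinearMap.charpoly_monic _).ne_zero h0.1)
      fun z hz hz1 hz2 => ?_
    obtain ⟨v, hv0, hv⟩ := (dvd_charpoly_iff hz).1 hz1
    obtain ⟨d, rfl⟩ := hz2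
    refine hv0 (eq_zero_of_isCoprime_smul hgc ?_ (by rw [mul_comm, mul_smul, hv, smul_zero]))
    obtain ⟨w, rfl⟩ := Submodule.mkQ_surjective _ v
    rw [← map_smul, Submodule.mkQ_apply, Submodule.Quotient.mk_eq_zero]
    exact ⟨w, rfl⟩
  refine eq_of_monic_of_associated (LinearMap.charpoly_monic _) hgmonic
    (associated_of_dvd_dvd ?_ ?_)
  · refine hcop2.dvd_of_dvd_mul_right ?_
    rw [← h, hmul]
    exact dvd_mul_right _ _
  · refine hcop1.dvd_of_dvd_mul_right ?_
    rw [← hmul, h]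
    exact dvd_mul_right _ _

theorem charpoly_xEnd_aeval {W : Type*} [AddCommGroup W] [Module F W] [FiniteDimensional F W]
    (B : Module.End F W) : (xEnd F (Module.AEval' B)).charpoly = B.charpoly := by
  rw [← LinearEquiv.charpoly_conj (Module.AEval'.of B) B]
  congr 1
  refine LinearMap.ext fun w => ?_
  obtain ⟨w, rfl⟩ := (Module.AEval'.of B).surjective w
  rw [LinearEquiv.conj_apply_apply, LinearEquiv.symm_apply_apply, xEnd_apply,
    Module.AEval'.X_smul_of]

variable {W : Type*} [AddCommGroup W] [Module F W] [FiniteDimensional F W]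

/-- Multiplication by the product is onto on the kernel, giving one inclusion; Cayley–Hamilton on
the target gives the other. -/
theorem ker_eq_smulRange (hirr : ∀ i, Irreducible (f i)) (j : ι → ℕ) {B : Module.End F W}
    (hB : B.charpoly = ∏ i, f i ^ j i) (φ : V →ₗ[F[X]] Module.AEval' B)
    (hK : ∀ i, Subsingleton (LinearMap.ker φ →ₗ[F[X]] F[X] ⧸ Ideal.span {f i})) :
    LinearMap.ker φ = smulRange V (∏ i, f i ^ j i) := by
  refine le_antisymm (fun v hv => ?_) ?_
  · obtain ⟨w, hw⟩ := surjective_prod_smul_of_not_dvd_charpoly (V := LinearMap.ker φ) hirr j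
      (fun i => (not_dvd_charpoly_iff_subsingleton (hirr i)).2 (hK i)) ⟨v, hv⟩
    exact ⟨w, congrArg Subtype.val hw⟩
  · rintro _ ⟨w, rfl⟩
    change φ ((∏ i, f i ^ j i) • w) = 0
    rw [map_smul, ← hB, ← charpoly_xEnd_aeval B, charpoly_xEnd_smul]

/-- The event that the irreducible polynomials `f i` have multiplicities `j i` in the
characteristic polynomial is detected by the surjections onto modules with characteristic
polynomial `∏ f i ^ j i` whose kernel has no part supported at the `f i`. -/
theorem card_sigma_surjections_eq_ite [DecidableEq ι] (hirr : ∀ i, Irreducible (f i))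
    (hmonic : ∀ i, (f i).Monic) (hcop : Pairwise fun i j => IsCoprime (f i) (f j)) (j : ι → ℕ)
    (hdim : Module.finrank F W = (∏ i, f i ^ j i).natDegree)
    [Decidable (∀ i, multiplicity (f i) (xEnd F V).charpoly = j i)] :
    Nat.card (Σ B : {B : Module.End F W // B.charpoly = ∏ i, f i ^ j i},
      {φ : V →ₗ[F[X]] Module.AEval' B.1 // Function.Surjective φ ∧
        ∀ i, Subsingleton (LinearMap.ker φ →ₗ[F[X]] F[X] ⧸ Ideal.span {f i})}) =
      if ∀ i, multiplicity (f i) (xEnd F V).charpoly = j i then Nat.card (W ≃ₗ[F] W) else 0 := by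
  set g := ∏ i, f i ^ j i with hg
  split_ifs with hmult
  · obtain ⟨c, hc, hfc⟩ := exists_eq_prod_mul_of_multiplicity hirr hcop
      (LinearMap.charpoly_monic _).ne_zero hmult
    obtain ⟨hQ, hK⟩ := charpoly_quotient_and_not_dvd hirr hmonic j hc hfc
    rw [← hg] at hQ hK
    have hdim' : Module.finrank F (V ⧸ smulRange V g) = Module.finrank F W := by
      rw [hdim, ← LinearMap.charpoly_natDegree (xEnd F (V ⧸ smulRange V g)), hQ]
    let e₀ : (V ⧸ smulRange V g) ≃ₗ[F] W := LinearEquiv.ofFinrankEq _ _ hdim'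
    have hcard : Nat.card (W ≃ₗ[F] W) = Nat.card ((V ⧸ smulRange V g) ≃ₗ[F] W) :=
      Nat.card_congr
        { toFun := fun e => e₀.trans e
          invFun := fun e => e₀.symm.trans e
          left_inv := fun e => by ext; simp
          right_inv := fun e => by ext; simp }
    rw [hcard]
    -- Transport of structure: a linear isomorphism `V / gV ≃ W` carries `X` to some `B` and
    -- composes with the quotient map to a surjection.
    let mk : ((V ⧸ smulRange V g) ≃ₗ[F] W) → Σ B : {B : Module.End F W // B.charpoly = g},
        {φ : V →ₗ[F[X]] Module.AEval' B.1 // Function.Surjective φ ∧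
          ∀ i, Subsingleton (LinearMap.ker φ →ₗ[F[X]] F[X] ⧸ Ideal.span {f i})} := fun e =>
      ⟨⟨e.conj (xEnd F (V ⧸ smulRange V g)), by rw [LinearEquiv.charpoly_conj, hQ]⟩,
        LinearMap.ofCommX ((Module.AEval'.of (e.conj (xEnd F (V ⧸ smulRange V g)))).toLinearMap ∘ₗ
          e.toLinearMap ∘ₗ (smulRange V g).mkQ.restrictScalars F) (fun v => by
            change Module.AEval'.of _ (e ((smulRange V g).mkQ ((X : F[X]) • v))) =
              (X : F[X]) • Module.AEval'.of _ (e ((smulRange V g).mkQ v))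
            rw [Module.AEval'.X_smul_of, LinearEquiv.conj_apply_apply, LinearEquiv.symm_apply_apply,
              xEnd_apply, map_smul]),
        (((Module.AEval'.of (e.conj (xEnd F (V ⧸ smulRange V g)))).surjective.comp
          e.surjective).comp (Submodule.mkQ_surjective _) :),
        fun i => by
          rw [← not_dvd_charpoly_iff_subsingleton (hirr i)]
          have hk : ∀ φ : V →ₗ[F[X]] Module.AEval' (e.conj (xEnd F (V ⧸ smulRange V g))),
              (∀ v, φ v = Module.AEval'.of _ (e ((smulRange V g).mkQ v))) →
              LinearMap.ker φ = smulRange V g := fun φ hφ => by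
            ext v
            rw [LinearMap.mem_ker, hφ, LinearEquiv.map_eq_zero_iff, LinearEquiv.map_eq_zero_iff,
              Submodule.mkQ_apply, Submodule.Quotient.mk_eq_zero]
          rw [charpoly_xEnd_congr (LinearEquiv.ofEq _ _ (hk _ fun v => rfl))]
          exact hK i⟩
    have hmk : ∀ e v, (mk e).2.1 v = Module.AEval'.of _ (e ((smulRange V g).mkQ v)) :=
      fun e v => rfl
    refine (Nat.card_congr (Equiv.ofBijective mk ⟨fun e e' h => ?_, fun x => ?_⟩)).symm
    · let under : (Σ B : {B : Module.End F W // B.charpoly = g},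
        {φ : V →ₗ[F[X]] Module.AEval' B.1 // Function.Surjective φ ∧
          ∀ i, Subsingleton (LinearMap.ker φ →ₗ[F[X]] F[X] ⧸ Ideal.span {f i})}) → V → W :=
        fun x v => (Module.AEval'.of x.1.1).symm (x.2.1 v)
      ext q
      obtain ⟨v, rfl⟩ := Submodule.mkQ_surjective _ q
      exact congrFun (congrArg under h) v
    · obtain ⟨⟨B, hB⟩, φ, hφ, hφK⟩ := x
      -- Conversely the kernel is forced to be `gV`, so `φ` induces the isomorphism.
      have hker := ker_eq_smulRange hirr j hB φ hφK
      rw [← hg] at hker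
      let e₁ : (V ⧸ smulRange V g) ≃ₗ[F[X]] Module.AEval' B :=
        (Submodule.quotEquivOfEq _ _ hker.symm).trans (φ.quotKerEquivOfSurjective hφ)
      have he₁ : ∀ v, e₁ ((smulRange V g).mkQ v) = φ v := fun v => rfl
      let e : (V ⧸ smulRange V g) ≃ₗ[F] W :=
        (e₁.restrictScalars F).trans (Module.AEval'.of B).symm
      have he : ∀ q, e q = (Module.AEval'.of B).symm (e₁ q) := fun q => rfl
      have hBe : e.conj (xEnd F (V ⧸ smulRange V g)) = B := by
        ext w
        obtain ⟨q, rfl⟩ := e.surjective w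
        rw [LinearEquiv.conj_apply_apply, LinearEquiv.symm_apply_apply, xEnd_apply, he, map_smul,
          Module.AEval'.of_symm_X_smul, he]
      clear_value e
      subst hBe
      refine ⟨e, Sigma.ext rfl (heq_of_eq (Subtype.ext (LinearMap.ext fun v => ?_)))⟩
      rw [hmk, he, LinearEquiv.apply_symm_apply, he₁]
  · have : IsEmpty (Σ B : {B : Module.End F W // B.charpoly = g},
      {φ : V →ₗ[F[X]] Module.AEval' B.1 // Function.Surjective φ ∧
        ∀ i, Subsingleton (LinearMap.ker φ →ₗ[F[X]] F[X] ⧸ Ideal.span {f i})}) := by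
      refine ⟨fun ⟨⟨B, hB⟩, φ, hφ, hK⟩ => hmult ?_⟩
      refine multiplicity_eq_of_eq_prod_mul hirr hcop j (c := (xEnd F (LinearMap.ker φ)).charpoly)
        ?_ fun i => (not_dvd_charpoly_iff_subsingleton (hirr i)).2 (hK i)
      rw [charpoly_xEnd_eq_mul φ hφ, charpoly_xEnd_aeval, hB]
    exact Nat.card_of_isEmpty

end Factorization

/-! ### Limiting weight of surjections with kernel free of the `f i`. -/

section QuotientLimit

variable {p : ℕ} [Fact p.Prime]

theorem finrank_quotient_span {F : Type*} [Field F] {f : F[X]} (hf : f.Monic) :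
    Module.finrank F (F[X] ⧸ Ideal.span {f}) = f.natDegree :=
  (AdjoinRoot.powerBasis' hf).finrank.trans (AdjoinRoot.powerBasis'_dim hf)

theorem finiteDimensional_quotient_span {F : Type*} [Field F] {f : F[X]} (hf : f.Monic) :
    FiniteDimensional F (F[X] ⧸ Ideal.span {f}) :=
  (AdjoinRoot.powerBasis' hf).finite

theorem finite_quotient_span {f : (ZMod p)[X]} (hf : f.Monic) :
    Finite ((ZMod p)[X] ⧸ Ideal.span {f}) := by
  have := finiteDimensional_quotient_span hf
  exact Module.finite_of_finite (ZMod p)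

theorem natCard_quotient_span {f : (ZMod p)[X]} (hf : f.Monic) :
    Nat.card ((ZMod p)[X] ⧸ Ideal.span {f}) = p ^ f.natDegree := by
  have := finiteDimensional_quotient_span hf
  rw [Module.natCard_eq_pow_finrank (K := ZMod p), finrank_quotient_span hf, Nat.card_zmod]

theorem smul_quotient_span_eq_zero {R : Type*} [CommRing R] (g : R) (y : R ⧸ Ideal.span {g}) :
    g • y = 0 := by
  obtain ⟨y, rfl⟩ := Ideal.Quotient.mk_surjective y
  exact Ideal.Quotient.eq_zero_iff_mem.2 (Ideal.mem_span_singleton.2 (dvd_mul_right _ _))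

theorem card_intertwining_aeval {n : ℕ} {U : Type*} [AddCommGroup U] [Module (ZMod p) U]
    (M : Matrix (Fin n) (Fin n) (ZMod p)) (T : Module.End (ZMod p) U) :
    Nat.card {Φ : Module.AEval' (Matrix.toLin' M) →ₗ[ZMod p] U // Function.Surjective Φ ∧
      ∀ v, Φ ((X : (ZMod p)[X]) • v) = T (Φ v)} =
    Nat.card {φ : (Fin n → ZMod p) →ₗ[ZMod p] U //
        Function.Surjective φ ∧ φ ∘ₗ Matrix.toLin' M = T ∘ₗ φ} := by
  let e := Module.AEval'.of (Matrix.toLin' M)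
  refine Nat.card_congr
    { toFun := fun Φ => ⟨Φ.1 ∘ₗ e.toLinearMap, Φ.2.1.comp e.surjective, LinearMap.ext fun v => ?_⟩
      invFun := fun φ => ⟨φ.1 ∘ₗ e.symm.toLinearMap, φ.2.1.comp e.symm.surjective, fun v => ?_⟩
      left_inv := fun Φ => Subtype.ext (LinearMap.ext fun v => by simp)
      right_inv := fun φ => Subtype.ext (LinearMap.ext fun v => by simp) }
  · have := Φ.2.2 (e v)
    rw [Module.AEval'.X_smul_of] at this
    exact this
  · have := LinearMap.congr_fun φ.2.2 (e.symm v)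
    change φ.1 (e.symm ((X : (ZMod p)[X]) • v)) = T (φ.1 (e.symm v))
    rw [Module.AEval'.of_symm_X_smul]
    exact this

variable {ι : Type*} [Fintype ι] {f : ι → (ZMod p)[X]}

/-- The rank of the part of the kernel of `φ` supported at `g`. -/
noncomputable def kernelRank {F : Type*} [Field F] {V W : Type*} [AddCommGroup V] [AddCommGroup W]
    [Module F[X] V] [Module F[X] W] (φ : V →ₗ[F[X]] W) (g : F[X]) : ℕ :=
  Module.finrank (F[X] ⧸ Ideal.span {g}) (LinearMap.ker φ →ₗ[F[X]] F[X] ⧸ Ideal.span {g})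

theorem kernelRank_eq_zero_iff {V W : Type*} [AddCommGroup V] [AddCommGroup W] [Finite V]
    [Module (ZMod p)[X] V] [Module (ZMod p)[X] W] (φ : V →ₗ[(ZMod p)[X]] W) {g : (ZMod p)[X]}
    (hg : Irreducible g) (hgm : g.Monic) : kernelRank φ g = 0 ↔
      Subsingleton (LinearMap.ker φ →ₗ[(ZMod p)[X]] (ZMod p)[X] ⧸ Ideal.span {g}) := by
  have := finite_quotient_span hgm
  have hmax : (Ideal.span {g}).IsMaximal := PrincipalIdealRing.isMaximal_of_irreducible hg
  let _ := Ideal.Quotient.field (Ideal.span {g})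
  have : Finite (LinearMap.ker φ →ₗ[(ZMod p)[X]] (ZMod p)[X] ⧸ Ideal.span {g}) := DFunLike.finite _
  exact Module.finrank_zero_iff

/-- Surjections onto a product with coprime annihilators split over `i`, and a surjection onto a
power of a residue field is a linearly independent tuple in the space whose dimension is
`kernelRank`. -/
theorem prod_qFalling_kernelRank {V W : Type*} [AddCommGroup V] [AddCommGroup W] [Finite V]
    [Module (ZMod p)[X] V] [Module (ZMod p)[X] W] (φ : V →ₗ[(ZMod p)[X]] W)
    (hirr : ∀ i, Irreducible (f i)) (hmonic : ∀ i, (f i).Monic)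
    (hcop : Pairwise fun i j => IsCoprime (f i) (f j)) (k : ι → ℕ) :
    ∏ i, qFalling ((p : ℝ) ^ (f i).natDegree) (k i)
      (((p : ℝ) ^ (f i).natDegree) ^ kernelRank φ (f i)) =
    Nat.card {ψ : LinearMap.ker φ →ₗ[(ZMod p)[X]] ∀ i, Fin (k i) → (ZMod p)[X] ⧸ Ideal.span {f i} //
      Function.Surjective ψ} := by
  rw [card_surjections_pi_coprime f hcop
    (fun i y => funext fun l => smul_quotient_span_eq_zero (f i) (y l))]
  push_cast
  refine Finset.prod_congr rfl fun i _ => ?_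
  have := finite_quotient_span (hmonic i)
  have hmax : (Ideal.span {f i}).IsMaximal := PrincipalIdealRing.isMaximal_of_irreducible (hirr i)
  let _ := Ideal.Quotient.field (Ideal.span {f i})
  have h := card_surjections_pi_field (K := LinearMap.ker φ)
    (L := (ZMod p)[X] ⧸ Ideal.span {f i}) Ideal.Quotient.mk_surjective (k i)
  rw [natCard_quotient_span (hmonic i)] at h
  push_cast at h
  exact h.symm

/-- The inner sum is the average over `D` of surjection counts onto `W × N` with action
`extensionEnd D`, each of mean tending to 1. -/
theorem tendsto_sum_card_surjections_ker {ε : ℝ} (hε : 0 < ε)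
    (m : ∀ n : ℕ, Fin n → Fin n → ZMod p → ℝ) (hm : ∀ n a b, IsBalancedWeight ε (m n a b))
    {W : Type*} [AddCommGroup W] [Module (ZMod p) W] [Module (ZMod p)[X] W]
    [IsScalarTower (ZMod p) (ZMod p)[X] W] [Finite W]
    {N : Type*} [AddCommGroup N] [Module (ZMod p) N] [Module (ZMod p)[X] N]
    [IsScalarTower (ZMod p) (ZMod p)[X] N] [Finite N]
    [∀ n, ∀ M : Matrix (Fin n) (Fin n) (ZMod p),
      Fintype {φ : Module.AEval' (Matrix.toLin' M) →ₗ[(ZMod p)[X]] W // Function.Surjective φ}] :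
    Tendsto (fun n => ∑ M, matrixWeight (m n) M *
      ∑ φ : {φ : Module.AEval' (Matrix.toLin' M) →ₗ[(ZMod p)[X]] W // Function.Surjective φ},
        (Nat.card {ψ : LinearMap.ker φ.1 →ₗ[(ZMod p)[X]] N // Function.Surjective ψ} : ℝ))
      atTop (𝓝 1) := by
  have : Finite (W →ₗ[ZMod p] N) := DFunLike.finite _
  have := Fintype.ofFinite (W →ₗ[ZMod p] N)
  have hc : (Fintype.card (W →ₗ[ZMod p] N) : ℝ) ≠ 0 := by
    exact_mod_cast Fintype.card_ne_zero
  have hfin : ∀ n (M : Matrix (Fin n) (Fin n) (ZMod p)), Finite (Module.AEval' (Matrix.toLin' M)) :=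
    fun n M => inferInstanceAs (Finite (Fin n → ZMod p))
  have h1 : ∀ n (M : Matrix (Fin n) (Fin n) (ZMod p)),
      ∑ φ : {φ : Module.AEval' (Matrix.toLin' M) →ₗ[(ZMod p)[X]] W // Function.Surjective φ},
        (Nat.card {ψ : LinearMap.ker φ.1 →ₗ[(ZMod p)[X]] N // Function.Surjective ψ} : ℝ) =
      (Fintype.card (W →ₗ[ZMod p] N) : ℝ)⁻¹ * ∑ D : W →ₗ[ZMod p] N,
        (Nat.card {φ : (Fin n → ZMod p) →ₗ[ZMod p] W × N //
          Function.Surjective φ ∧ φ ∘ₗ Matrix.toLin' M = extensionEnd D ∘ₗ φ} : ℝ) := by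
    intro n M
    have h := sum_card_surjections_ker_mul_card (F := ZMod p)
      (V := Module.AEval' (Matrix.toLin' M)) (W := W) (M := N)
    simp_rw [card_intertwining_aeval] at h
    rw [eq_inv_mul_iff_mul_eq₀ hc, mul_comm]
    exact_mod_cast h
  have h2 : ∀ n, ∑ M, matrixWeight (m n) M *
      ∑ φ : {φ : Module.AEval' (Matrix.toLin' M) →ₗ[(ZMod p)[X]] W // Function.Surjective φ},
        (Nat.card {ψ : LinearMap.ker φ.1 →ₗ[(ZMod p)[X]] N // Function.Surjective ψ} : ℝ) =
      (Fintype.card (W →ₗ[ZMod p] N) : ℝ)⁻¹ * ∑ D : W →ₗ[ZMod p] N, ∑ M, matrixWeight (m n) M *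
        (Nat.card {φ : (Fin n → ZMod p) →ₗ[ZMod p] W × N //
          Function.Surjective φ ∧ φ ∘ₗ Matrix.toLin' M = extensionEnd D ∘ₗ φ} : ℝ) := by
    intro n
    simp_rw [h1]
    rw [Finset.sum_comm, Finset.mul_sum]
    refine Finset.sum_congr rfl fun M _ => ?_
    rw [← Finset.mul_sum]; ring
  simp_rw [h2]
  have h3 := (tendsto_finsetSum (Finset.univ : Finset (W →ₗ[ZMod p] N)) fun D _ =>
    tendsto_sum_matrixWeight_mul_card hε m hm (extensionEnd D)).const_mul
      (Fintype.card (W →ₗ[ZMod p] N) : ℝ)⁻¹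
  simpa [hc] using h3

/-- The rank argument is applied to pairs `(M, φ)` weighted by the law of `M`, a measure whose total
mass is only asymptotically 1. -/
theorem tendsto_sum_card_surjections_noResidue {ε : ℝ} (hε : 0 < ε)
    (m : ∀ n : ℕ, Fin n → Fin n → ZMod p → ℝ) (hm : ∀ n a b, IsBalancedWeight ε (m n a b))
    {W : Type*} [AddCommGroup W] [Module (ZMod p) W] [Module (ZMod p)[X] W]
    [IsScalarTower (ZMod p) (ZMod p)[X] W] [Finite W]
    (hirr : ∀ i, Irreducible (f i)) (hmonic : ∀ i, (f i).Monic)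
    (hcop : Pairwise fun i j => IsCoprime (f i) (f j)) :
    Tendsto (fun n => ∑ M, matrixWeight (m n) M *
      (Nat.card {φ : Module.AEval' (Matrix.toLin' M) →ₗ[(ZMod p)[X]] W // Function.Surjective φ ∧
        ∀ i, Subsingleton (LinearMap.ker φ →ₗ[(ZMod p)[X]] (ZMod p)[X] ⧸ Ideal.span {f i})} : ℝ))
      atTop (𝓝 (∏ i, eulerValue ((p : ℝ) ^ (f i).natDegree))) := by
  classical
  have hfinV : ∀ n (M : Matrix (Fin n) (Fin n) (ZMod p)), Finite (Module.AEval' (Matrix.toLin' M)) :=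
    fun n M => inferInstanceAs (Finite (Fin n → ZMod p))
  have hfinH : ∀ n (M : Matrix (Fin n) (Fin n) (ZMod p)),
      Finite (Module.AEval' (Matrix.toLin' M) →ₗ[(ZMod p)[X]] W) := fun n M => DFunLike.finite _
  have hft : ∀ n (M : Matrix (Fin n) (Fin n) (ZMod p)),
      Fintype {φ : Module.AEval' (Matrix.toLin' M) →ₗ[(ZMod p)[X]] W // Function.Surjective φ} :=
    fun n M => Fintype.ofFinite _
  have hq : ∀ i, 1 < (p : ℝ) ^ (f i).natDegree := fun i =>
    one_lt_pow₀ (by exact_mod_cast (Fact.out : p.Prime).one_lt) (hirr i).natDegree_pos.ne'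
  have key := tendsto_sum_ranks_zero
    (I := fun n => Σ M : Matrix (Fin n) (Fin n) (ZMod p),
      {φ : Module.AEval' (Matrix.toLin' M) →ₗ[(ZMod p)[X]] W // Function.Surjective φ})
    (fun n a => matrixWeight (m n) a.1)
    (fun n a => Finset.prod_nonneg fun b _ => Finset.prod_nonneg fun c _ => (hm n c b).nonneg _)
    (fun n a i => kernelRank a.2.1 (f i)) _ hq ?_
  · refine key.congr fun n => ?_
    rw [Fintype.sum_sigma]
    refine Finset.sum_congr rfl fun M _ => ?_
    dsimp only
    rw [← Finset.mul_sum, Finset.sum_boole]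
    congr 2
    rw [← Fintype.card_subtype, ← Nat.card_eq_fintype_card]
    refine Nat.card_congr ((Equiv.subtypeSubtypeEquivSubtypeInter _ fun φ =>
      ∀ i, kernelRank φ (f i) = 0).trans (Equiv.subtypeEquivRight fun φ => ?_))
    exact and_congr_right fun _ => forall_congr' fun i =>
      kernelRank_eq_zero_iff φ (hirr i) (hmonic i)
  · intro k
    have hfinL : ∀ i, Finite ((ZMod p)[X] ⧸ Ideal.span {f i}) := fun i => finite_quotient_span (hmonic i)
    refine (tendsto_sum_card_surjections_ker (W := W)
      (N := ∀ i, Fin (k i) → (ZMod p)[X] ⧸ Ideal.span {f i}) hε m hm).congr fun n => ?_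
    rw [Fintype.sum_sigma]
    refine Finset.sum_congr rfl fun M _ => ?_
    rw [Finset.mul_sum]
    refine Finset.sum_congr rfl fun φ _ => ?_
    rw [prod_qFalling_kernelRank φ.1 hirr hmonic hcop k]

end QuotientLimit

/-! ### Endomorphisms with a prescribed invariant subspace. -/

section InjectiveCount

variable {F : Type*} [Field F]
  {S : Type*} [AddCommGroup S] [Module F S] [FiniteDimensional F S]
  {W : Type*} [AddCommGroup W] [Module F W] [FiniteDimensional F W]

/-- For a fixed embedding, the endomorphisms restricting to multiplication by `X`
on `S` and having a given characteristic polynomial are counted by block triangular matrices. -/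
theorem card_extending_endomorphisms {U : Type*} [AddCommGroup U] [Module F U]
    [FiniteDimensional F U] (A : Module.End F S) (θ : S →ₗ[F] W) (hθ : Function.Injective θ)
    (hdim : Module.finrank F U + Module.finrank F S = Module.finrank F W) (g : F[X]) :
    Nat.card {B : Module.End F W // (∀ s, θ (A s) = B (θ s)) ∧ B.charpoly = g * A.charpoly} =
      Nat.card (U →ₗ[F] S) * Nat.card {C : Module.End F U // C.charpoly = g} := by
  obtain ⟨Q, hQ⟩ := (LinearMap.range θ).exists_isCompl
  have hrange : Module.finrank F (LinearMap.range θ) = Module.finrank F S :=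
    LinearMap.finrank_range_of_inj hθ
  have hQdim : Module.finrank F U = Module.finrank F Q := by
    have := Submodule.finrank_add_eq_of_isCompl hQ
    omega
  let e : (U × S) ≃ₗ[F] W :=
    (LinearEquiv.prodCongr (LinearEquiv.ofFinrankEq U Q hQdim) (LinearEquiv.ofInjective θ hθ)).trans
      (Submodule.prodEquivOfIsCompl _ _ hQ.symm)
  have he : ∀ s, e (0, s) = θ s := fun s => by
    simp [e]
  have hes : ∀ s, e.symm (θ s) = (0, s) := fun s => by rw [← he, e.symm_apply_apply]
  rw [← Nat.card_prod]
  let T : (U →ₗ[F] S) → Module.End F U → Module.End F (U × S) := fun D C =>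
    (C ∘ₗ LinearMap.fst F U S).prod (A ∘ₗ LinearMap.snd F U S + D ∘ₗ LinearMap.fst F U S)
  have hT : ∀ D C x, T D C x = (C x.1, A x.2 + D x.1) := fun D C x => rfl
  have hform : ∀ B : Module.End F W, (∀ s, θ (A s) = B (θ s)) →
      T (LinearMap.snd F U S ∘ₗ e.symm.conj B ∘ₗ LinearMap.inl F U S)
        (LinearMap.fst F U S ∘ₗ e.symm.conj B ∘ₗ LinearMap.inl F U S) = e.symm.conj B := by
    intro B hB
    refine LinearMap.ext fun x => ?_
    have h1 : e.symm.conj B (0, x.2) = (0, A x.2) := by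
      rw [LinearEquiv.conj_apply_apply, LinearEquiv.symm_symm, he, ← hB, hes]
    have h2 : e.symm.conj B x = e.symm.conj B (x.1, 0) + (0, A x.2) := by
      rw [← h1, ← map_add]; simp
    rw [h2, hT]
    refine Prod.ext ?_ ?_
    · simp
    · simp [add_comm]
  have hconj : ∀ R : Module.End F (U × S), e.symm.conj (e.conj R) = R := fun R => by
    ext x <;> simp [LinearEquiv.conj_apply]
  have hconj' : ∀ R : Module.End F W, e.conj (e.symm.conj R) = R := fun R => by
    ext x; simp [LinearEquiv.conj_apply]
  have hto : ∀ D C, C.charpoly = g → (∀ s, θ (A s) = e.conj (T D C) (θ s)) ∧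
      (e.conj (T D C)).charpoly = g * A.charpoly := by
    intro D C hC
    refine ⟨fun s => ?_, ?_⟩
    · rw [LinearEquiv.conj_apply_apply, hes, hT, map_zero, map_zero, add_zero, he]
    · rw [LinearEquiv.charpoly_conj, charpoly_prod_triangular, hC]
  have hinv : ∀ B : Module.End F W, (∀ s, θ (A s) = B (θ s)) ∧ B.charpoly = g * A.charpoly →
      (LinearMap.fst F U S ∘ₗ e.symm.conj B ∘ₗ LinearMap.inl F U S : Module.End F U).charpoly =
        g := by
    intro B hB
    have h1 := charpoly_prod_triangular
      (LinearMap.fst F U S ∘ₗ e.symm.conj B ∘ₗ LinearMap.inl F U S) A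
      (LinearMap.snd F U S ∘ₗ e.symm.conj B ∘ₗ LinearMap.inl F U S)
    have h2 := hform B hB.1
    simp only [T] at h2
    rw [h2, LinearEquiv.charpoly_conj, hB.2] at h1
    exact (mul_right_cancel₀ (LinearMap.charpoly_monic A).ne_zero h1).symm
  exact (Nat.card_congr
    { toFun := fun x => ⟨e.conj (T x.1 x.2.1), hto _ _ x.2.2⟩
      invFun := fun B => (LinearMap.snd F U S ∘ₗ e.symm.conj B.1 ∘ₗ LinearMap.inl F U S,
        ⟨LinearMap.fst F U S ∘ₗ e.symm.conj B.1 ∘ₗ LinearMap.inl F U S, hinv _ B.2⟩)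
      left_inv := fun x => by
        refine Prod.ext (LinearMap.ext fun u => ?_) (Subtype.ext (LinearMap.ext fun u => ?_))
        · simp only [hconj]
          simp [hT]
        · simp only [hconj]
          simp [hT]
      right_inv := fun B => Subtype.ext (by
        simp only
        rw [hform B.1 B.2.1, hconj']) }).symm

variable [Finite F]

theorem card_injective_linearMap :
    (Nat.card {θ : S →ₗ[F] W // Function.Injective θ} : ℝ) =
      qFalling (Nat.card F) (Module.finrank F S) ((Nat.card F : ℝ) ^ Module.finrank F W) := by
  have : Finite W := Module.finite_of_finite F
  rw [← card_linearIndependent_eq_qFalling]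
  congr 1
  let b := Module.finBasis F S
  refine (Nat.card_congr ((b.constr F :
    (Fin (Module.finrank F S) → W) ≃ₗ[F] S →ₗ[F] W).toEquiv.subtypeEquiv fun s => ?_)).symm
  change LinearIndependent F s ↔ Function.Injective (b.constr F s)
  have hs : s = b.constr F s ∘ b := funext fun i => (b.constr_basis F s i).symm
  constructor
  · intro h
    rw [← LinearMap.ker_eq_bot]
    refine (LinearMap.ker_eq_bot').2 fun x hx => ?_
    rw [b.constr_apply_fintype F] at hx
    have := Fintype.linearIndependent_iff.1 h _ hx
    exact b.ext_elem fun i => by simpa using this i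
  · intro h
    rw [hs]
    exact b.linearIndependent.map' _ (LinearMap.ker_eq_bot.2 h)

theorem card_linearEquiv_self :
    (Nat.card (W ≃ₗ[F] W) : ℝ) =
      qFalling (Nat.card F) (Module.finrank F W) ((Nat.card F : ℝ) ^ Module.finrank F W) := by
  rw [← card_injective_linearMap]
  congr 1
  exact Nat.card_congr
    { toFun := fun e => ⟨e.toLinearMap, e.injective⟩
      invFun := fun θ => LinearEquiv.ofInjectiveEndo θ.1 θ.2
      left_inv := fun e => by ext; rfl
      right_inv := fun θ => rfl }

/-- This computes `|GL_{e+k}|` by embedding a `k`-dimensional subspace and then completing block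
triangularly. -/
theorem qFalling_add (q : ℝ) (k e : ℕ) :
    qFalling q k (q ^ (e + k)) * q ^ (e * k) * qFalling q e (q ^ e) =
      qFalling q (e + k) (q ^ (e + k)) := by
  rw [add_comm e k, qFalling, qFalling, qFalling, Finset.prod_range_add, mul_assoc]
  congr 1
  have : q ^ (e * k) = ∏ i ∈ Finset.range e, q ^ k := by
    rw [Finset.prod_const, Finset.card_range, ← pow_mul, mul_comm]
  rw [this, ← Finset.prod_mul_distrib]
  exact Finset.prod_congr rfl fun i _ => by ring

theorem qFalling_self_pos {q : ℝ} (hq : 1 < q) (d : ℕ) : 0 < qFalling q d (q ^ d) :=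
  Finset.prod_pos fun _ hi => sub_pos.2 (pow_lt_pow_right₀ hq (Finset.mem_range.1 hi))

/-- Injections `S → W`, times `|Hom(U, S)|`, times `|GL(U)|`, make up `|GL(W)|`. After normalising
by general linear groups only the cofactor `g` is felt. -/
theorem card_embeddings_mul {U : Type*} [AddCommGroup U] [Module F U]
    [FiniteDimensional F U] (A : Module.End F S)
    (hdim : Module.finrank F U + Module.finrank F S = Module.finrank F W) (g : F[X]) :
    (Nat.card {x : (S →ₗ[F] W) × Module.End F W // Function.Injective x.1 ∧
      (∀ s, x.1 (A s) = x.2 (x.1 s)) ∧ x.2.charpoly = g * A.charpoly} : ℝ) *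
        Nat.card (U ≃ₗ[F] U) =
      Nat.card {C : Module.End F U // C.charpoly = g} * Nat.card (W ≃ₗ[F] W) := by
  have : Finite W := Module.finite_of_finite F
  have : Finite (S →ₗ[F] W) := Module.finite_of_finite F
  have : Finite (Module.End F W) := Module.finite_of_finite F
  have := Fintype.ofFinite {θ : S →ₗ[F] W // Function.Injective θ}
  have e : {x : (S →ₗ[F] W) × Module.End F W // Function.Injective x.1 ∧
      (∀ s, x.1 (A s) = x.2 (x.1 s)) ∧ x.2.charpoly = g * A.charpoly} ≃
      Σ θ : {θ : S →ₗ[F] W // Function.Injective θ},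
        {B : Module.End F W // (∀ s, θ.1 (A s) = B (θ.1 s)) ∧ B.charpoly = g * A.charpoly} :=
    { toFun := fun x => ⟨⟨x.1.1, x.2.1⟩, x.1.2, x.2.2⟩
      invFun := fun x => ⟨(x.1.1, x.2.1), x.1.2, x.2.2⟩
      left_inv := fun x => rfl
      right_inv := fun x => rfl }
  rw [Nat.card_congr e, Nat.card_sigma]
  simp_rw [fun θ : {θ : S →ₗ[F] W // Function.Injective θ} =>
    card_extending_endomorphisms A θ.1 θ.2 hdim g]
  rw [Finset.sum_const, Finset.card_univ, ← Nat.card_eq_fintype_card, smul_eq_mul]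
  push_cast
  rw [card_injective_linearMap, card_linearEquiv_self, card_linearEquiv_self, ← hdim,
    ← qFalling_add, Module.natCard_eq_pow_finrank (K := F) (V := U →ₗ[F] S),
    Module.finrank_linearMap]
  push_cast
  ring

end InjectiveCount

/-! ### Counting endomorphisms by characteristic polynomial. -/

section CharpolyCount

variable {F : Type*} [Field F]

theorem charpoly_xEnd_quotient_span {g : F[X]} (hg : g.Monic)
    [FiniteDimensional F (F[X] ⧸ Ideal.span {g})] :
    (xEnd F (F[X] ⧸ Ideal.span {g})).charpoly = g := by
  refine (eq_of_monic_of_dvd_of_natDegree_le hg (LinearMap.charpoly_monic (xEnd F (F[X] ⧸ Ideal.span {g})))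
    ?_ ?_)
  · rw [← Ideal.mem_span_singleton, ← Ideal.Quotient.eq_zero_iff_mem]
    have h := charpoly_xEnd_smul (F := F) (1 : F[X] ⧸ Ideal.span {g})
    rw [← mul_one (xEnd F (F[X] ⧸ Ideal.span {g})).charpoly]
    exact h
  · rw [LinearMap.charpoly_natDegree, finrank_quotient_span hg]

variable {ι : Type*} [Fintype ι] {f : ι → F[X]}

theorem exponents_eq_of_prod_eq (hirr : ∀ i, Irreducible (f i))
    (hcop : Pairwise fun i j => IsCoprime (f i) (f j)) {j k : ι → ℕ}
    (h : ∏ i, f i ^ j i = ∏ i, f i ^ k i) : j = k := by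
  have h1 : ∀ j : ι → ℕ, ∀ i, multiplicity (f i) (∏ i, f i ^ j i) = j i := fun j =>
    multiplicity_eq_of_eq_prod_mul hirr hcop j (mul_one _).symm
      fun i hi => (hirr i).not_isUnit (isUnit_of_dvd_one hi)
  funext i
  rw [← h1 j, ← h1 k, h]

theorem exists_eq_prod_of_monic_of_dvd (hirr : ∀ i, Irreducible (f i))
    (hmonic : ∀ i, (f i).Monic) (hcop : Pairwise fun i j => IsCoprime (f i) (f j)) {j : ι → ℕ}
    {h : F[X]} (hm : h.Monic) (hdvd : h ∣ ∏ i, f i ^ j i) :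
    ∃ k ≤ j, h = ∏ i, f i ^ k i := by
  obtain ⟨c, hc, hfc⟩ := exists_eq_prod_mul_of_multiplicity (j := fun i => multiplicity (f i) h)
    hirr hcop hm.ne_zero fun _ => rfl
  have hprod : ∀ j : ι → ℕ, (∏ i, f i ^ j i).Monic := fun j =>
    monic_prod_of_monic _ _ fun i _ => (hmonic i).pow _
  have hcmonic : c.Monic := (hprod _).of_mul_monic_left (hc ▸ hm)
  have hccop : IsCoprime c (∏ i, f i ^ j i) := IsCoprime.prod_right fun i _ =>
    ((((hirr i).coprime_iff_not_dvd).2 (hfc i)).pow_left).symm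
  have hunit : IsUnit c := hccop.isUnit_of_dvd' dvd_rfl ((Dvd.intro_left _ hc.symm).trans hdvd)
  rw [hcmonic.eq_one_of_isUnit hunit, mul_one] at hc
  refine ⟨_, fun i => ?_, hc⟩
  have h1 := multiplicity_eq_of_eq_prod_mul hirr hcop j (mul_one (∏ i, f i ^ j i)).symm
    (fun i hi => (hirr i).not_isUnit (isUnit_of_dvd_one hi)) i
  rw [← h1]
  by_contra hlt
  exact (FiniteMultiplicity.of_not_isUnit (hirr i).not_isUnit
    (hprod j).ne_zero).not_pow_dvd_of_multiplicity_lt (not_le.1 hlt)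
      ((pow_multiplicity_dvd _ _).trans hdvd)

variable {W : Type*} [AddCommGroup W] [Module F W]

theorem apply_mk_eq_aeval {g : F[X]} {θ : (F[X] ⧸ Ideal.span {g}) →ₗ[F] W} {B : Module.End F W}
    (h : ∀ s, θ (xEnd F (F[X] ⧸ Ideal.span {g}) s) = B (θ s)) (r : F[X]) :
    θ (Ideal.Quotient.mk _ r) = aeval B r (θ 1) := by
  have h1 := (LinearMap.ofCommX ((Module.AEval'.of B).toLinearMap ∘ₗ θ) fun s => by
    change Module.AEval'.of B (θ ((X : F[X]) • s)) = (X : F[X]) • Module.AEval'.of B (θ s)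
    rw [Module.AEval'.X_smul_of, ← h]; rfl).map_smul r 1
  have h2 : (r • (1 : F[X] ⧸ Ideal.span {g})) = Ideal.Quotient.mk _ r := by
    change Ideal.Quotient.mk _ (r * 1) = _
    rw [mul_one]
  rw [h2] at h1
  exact (Module.AEval'.of B).injective h1

theorem exists_embedding_of_annihilator {g : F[X]} {B : Module.End F W} {v : W}
    (h : ∀ r, aeval B r v = 0 ↔ g ∣ r) :
    ∃ θ : (F[X] ⧸ Ideal.span {g}) →ₗ[F] W, Function.Injective θ ∧
      (∀ s, θ (xEnd F (F[X] ⧸ Ideal.span {g}) s) = B (θ s)) ∧ θ 1 = v := by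
  let τ : F[X] →ₗ[F[X]] Module.AEval' B := LinearMap.toSpanSingleton _ _ (Module.AEval'.of B v)
  have hτ : ∀ r, (Module.AEval'.of B).symm (τ r) = aeval B r v := fun r => rfl
  have hle : Ideal.span {g} ≤ LinearMap.ker τ := by
    rw [Ideal.span_singleton_le_iff_mem, LinearMap.mem_ker,
      ← (Module.AEval'.of B).symm.map_eq_zero_iff, hτ]
    exact (h g).2 dvd_rfl
  let θ₀ : (F[X] ⧸ Ideal.span {g}) →ₗ[F[X]] Module.AEval' B := Submodule.liftQ _ τ hle
  let θ : (F[X] ⧸ Ideal.span {g}) →ₗ[F] W :=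
    (Module.AEval'.of B).symm.toLinearMap ∘ₗ θ₀.restrictScalars F
  have hθ : ∀ r, θ (Ideal.Quotient.mk _ r) = aeval B r v := fun r => hτ r
  refine ⟨θ, (injective_iff_map_eq_zero θ).2 fun s hs => ?_, fun s => ?_, ?_⟩
  · obtain ⟨r, rfl⟩ := Ideal.Quotient.mk_surjective s
    rw [hθ, h] at hs
    exact Ideal.Quotient.eq_zero_iff_mem.2 (Ideal.mem_span_singleton.2 hs)
  · obtain ⟨r, rfl⟩ := Ideal.Quotient.mk_surjective s
    have hX : xEnd F (F[X] ⧸ Ideal.span {g}) (Ideal.Quotient.mk _ r) =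
        Ideal.Quotient.mk _ (X * r) := rfl
    rw [hX, hθ, hθ, map_mul, aeval_X]; rfl
  · rw [← map_one (Ideal.Quotient.mk (Ideal.span {g})), hθ, map_one]; rfl

/-- The annihilator is principal and contains the characteristic polynomial, so its monic generator
is one of the divisors `∏ f i ^ k i`. -/
theorem exists_annihilator_of_charpoly_eq [FiniteDimensional F W] (hirr : ∀ i, Irreducible (f i))
    (hmonic : ∀ i, (f i).Monic) (hcop : Pairwise fun i j => IsCoprime (f i) (f j)) {j : ι → ℕ}
    {B : Module.End F W} (hB : B.charpoly = ∏ i, f i ^ j i) (v : W) :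
    ∃ k ≤ j, ∀ r, aeval B r v = 0 ↔ (∏ i, f i ^ k i) ∣ r := by
  classical
  let τ : F[X] →ₗ[F[X]] Module.AEval' B := LinearMap.toSpanSingleton _ _ (Module.AEval'.of B v)
  have hτ : ∀ r, r ∈ LinearMap.ker τ ↔ aeval B r v = 0 := fun r => by
    rw [LinearMap.mem_ker, ← (Module.AEval'.of B).symm.map_eq_zero_iff]; rfl
  obtain ⟨h₀, hh₀⟩ := (IsPrincipalIdealRing.principal (LinearMap.ker τ)).principal
  have hh : ∀ r, aeval B r v = 0 ↔ h₀ ∣ r := fun r => by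
    rw [← hτ, hh₀]; exact Ideal.mem_span_singleton
  have hdvd₀ : h₀ ∣ ∏ i, f i ^ j i := by
    rw [← hh, ← hB, LinearMap.aeval_self_charpoly]; rfl
  have hne : h₀ ≠ 0 := fun h0 => (monic_prod_of_monic Finset.univ (fun i => f i ^ j i)
    fun i _ => (hmonic i).pow _).ne_zero (zero_dvd_iff.1 (h0 ▸ hdvd₀))
  obtain ⟨k, hk, hkeq⟩ := exists_eq_prod_of_monic_of_dvd hirr hmonic hcop (monic_normalize hne)
    ((normalize_dvd_iff).2 hdvd₀)
  exact ⟨k, hk, fun r => by rw [hh, ← hkeq, normalize_dvd_iff]⟩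

theorem natDegree_prod_pow (hmonic : ∀ i, (f i).Monic) (j : ι → ℕ) :
    (∏ i, f i ^ j i).natDegree = ∑ i, j i * (f i).natDegree := by
  rw [natDegree_prod_of_monic _ _ fun i _ => (hmonic i).pow _]
  exact Finset.sum_congr rfl fun i _ => (hmonic i).natDegree_pow _

/-- The proportion, relative to the general linear group, of endomorphisms with characteristic
polynomial `g`. -/
noncomputable def charpolyDensity (g : F[X]) : ℝ :=
  (Nat.card {B : Module.End F (Fin g.natDegree → F) // B.charpoly = g} : ℝ) /
    Nat.card ((Fin g.natDegree → F) ≃ₗ[F] (Fin g.natDegree → F))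

theorem charpolyDensity_one : charpolyDensity (1 : F[X]) = 1 := by
  have h1 : Nat.card {B : Module.End F (Fin (1 : F[X]).natDegree → F) // B.charpoly = 1} = 1 := by
    rw [natDegree_one, Nat.card_eq_one_iff_unique]
    refine ⟨inferInstance, ⟨⟨0, ?_⟩⟩⟩
    refine eq_one_of_monic_natDegree_zero (LinearMap.charpoly_monic _) ?_
    rw [LinearMap.charpoly_natDegree, Module.finrank_fin_fun]
  have h2 : Nat.card ((Fin (1 : F[X]).natDegree → F) ≃ₗ[F] (Fin (1 : F[X]).natDegree → F)) = 1 := by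
    rw [natDegree_one, Nat.card_eq_one_iff_unique]
    exact ⟨⟨fun a b => LinearEquiv.ext fun x => Subsingleton.elim _ _⟩, ⟨LinearEquiv.refl _ _⟩⟩
  rw [charpolyDensity, h1, h2]; norm_num

variable [Finite F]

/-- A pair `(B, v)` is the same as `B` with an equivariant embedding of a cyclic module `F[X]/(g
k)`, where `g k` generates the annihilator of `v` and `v` is the image of 1. -/
theorem card_charpoly_mul_card_of_annihilator [FiniteDimensional F W] {κ : Type*} (T : Finset κ)
    {g : κ → F[X]} (hg : ∀ k, (g k).Monic) (hinj : Function.Injective g) (G : F[X])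
    (hann : ∀ B : Module.End F W, B.charpoly = G → ∀ v, ∃ k ∈ T, ∀ r, aeval B r v = 0 ↔ g k ∣ r) :
    Nat.card {B : Module.End F W // B.charpoly = G} * Nat.card W =
      ∑ k ∈ T, Nat.card {x : ((F[X] ⧸ Ideal.span {g k}) →ₗ[F] W) × Module.End F W //
          Function.Injective x.1 ∧
          (∀ s, x.1 (xEnd F (F[X] ⧸ Ideal.span {g k}) s) = x.2 (x.1 s)) ∧ x.2.charpoly = G} := by
  have hfd : ∀ k, FiniteDimensional F (F[X] ⧸ Ideal.span {g k}) := fun k =>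
    finiteDimensional_quotient_span (hg k)
  have : Finite W := Module.finite_of_finite F
  have : Finite (Module.End F W) := Module.finite_of_finite F
  have : ∀ k, Finite ((F[X] ⧸ Ideal.span {g k}) →ₗ[F] W) := fun k => Module.finite_of_finite F
  rw [← Finset.sum_coe_sort, ← Nat.card_sigma, ← Nat.card_prod]
  symm
  refine Nat.card_congr (Equiv.ofBijective
    (fun x => (⟨x.2.1.2, x.2.2.2.2⟩, x.2.1.1 1)) ⟨?_, ?_⟩)
  · rintro ⟨⟨k, hk⟩, ⟨θ, B⟩, hθ, hcomm, hB⟩ ⟨⟨k', hk'⟩, ⟨θ', B'⟩, hθ', hcomm', hB'⟩ heq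
    simp only [Prod.mk.injEq, Subtype.mk.injEq] at heq hθ hcomm hθ' hcomm'
    obtain ⟨rfl, h1⟩ := heq
    have hmem : ∀ (k : κ) (θ : (F[X] ⧸ Ideal.span {g k}) →ₗ[F] W),
        Function.Injective θ → (∀ s, θ (xEnd F _ s) = B (θ s)) → ∀ r : F[X],
        aeval B r (θ 1) = 0 ↔ g k ∣ r := by
      intro k θ hθ hcomm r
      rw [← apply_mk_eq_aeval hcomm, map_eq_zero_iff θ hθ, Ideal.Quotient.eq_zero_iff_mem,
        Ideal.mem_span_singleton]
    have hkk : k = k' := by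
      refine hinj (eq_of_monic_of_associated (hg k) (hg k') (associated_of_dvd_dvd ?_ ?_))
      · rw [← hmem k θ hθ hcomm, h1, hmem k' θ' hθ' hcomm']
      · rw [← hmem k' θ' hθ' hcomm', ← h1, hmem k θ hθ hcomm]
    subst hkk
    have hθθ : θ = θ' := by
      refine LinearMap.ext fun s => ?_
      obtain ⟨r, rfl⟩ := Ideal.Quotient.mk_surjective s
      rw [apply_mk_eq_aeval hcomm, apply_mk_eq_aeval hcomm', h1]
    subst hθθ
    rfl
  · rintro ⟨⟨B, hB⟩, v⟩
    obtain ⟨k, hk, hann⟩ := hann B hB v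
    obtain ⟨θ, hθ, hcomm, h1⟩ := exists_embedding_of_annihilator hann
    exact ⟨⟨⟨k, hk⟩, ⟨(θ, B), hθ, hcomm, hB⟩⟩, Prod.ext rfl h1⟩

variable [DecidableEq ι]

/-- Pairs `(B, v)` are counted in two ways. If `v` has annihilator with exponents `k`, the quotient
by the submodule it generates has exponents `j - k`. -/
theorem card_pow_mul_charpolyDensity (hirr : ∀ i, Irreducible (f i))
    (hmonic : ∀ i, (f i).Monic) (hcop : Pairwise fun i j => IsCoprime (f i) (f j)) (j : ι → ℕ) :
    (Nat.card F : ℝ) ^ (∏ i, f i ^ j i).natDegree * charpolyDensity (∏ i, f i ^ j i) =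
      ∑ k ∈ Finset.Iic j, charpolyDensity (∏ i, f i ^ k i) := by
  have hγ : ∀ d : ℕ, (Nat.card ((Fin d → F) ≃ₗ[F] (Fin d → F)) : ℝ) ≠ 0 := fun d => by
    rw [card_linearEquiv_self, Module.finrank_fin_fun]
    exact (qFalling_self_pos (by exact_mod_cast Finite.one_lt_card) d).ne'
  obtain ⟨g, hgdef⟩ : ∃ g : (ι → ℕ) → F[X], ∀ k, g k = ∏ i, f i ^ k i := ⟨_, fun _ => rfl⟩
  simp only [← hgdef]
  have hg : ∀ k, (g k).Monic := fun k => by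
    rw [hgdef]; exact monic_prod_of_monic _ _ fun i _ => (hmonic i).pow _
  have hinj : Function.Injective g := fun k k' h => by
    rw [hgdef, hgdef] at h; exact exponents_eq_of_prod_eq hirr hcop h
  have hmul : ∀ k ∈ Finset.Iic j, g j = g (j - k) * g k := fun k hk => by
    rw [hgdef, hgdef, hgdef, ← Finset.prod_mul_distrib]
    refine Finset.prod_congr rfl fun i _ => ?_
    rw [← pow_add, Pi.sub_apply, Nat.sub_add_cancel (Finset.mem_Iic.1 hk i)]
  have h := card_charpoly_mul_card_of_annihilator (W := Fin (g j).natDegree → F) (Finset.Iic j)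
    hg hinj (g j) fun B hB v => by
      obtain ⟨k, hk, h⟩ := exists_annihilator_of_charpoly_eq hirr hmonic hcop
        (hB.trans (hgdef j)) v
      exact ⟨k, Finset.mem_Iic.2 hk, fun r => (h r).trans (by rw [hgdef])⟩
  have h' := congrArg (Nat.cast (R := ℝ)) h
  push_cast at h'
  rw [Module.natCard_eq_pow_finrank (K := F) (V := Fin (g j).natDegree → F),
    Module.finrank_fin_fun] at h'
  push_cast at h'
  have hterm : ∀ k ∈ Finset.Iic j,
      (Nat.card {x : ((F[X] ⧸ Ideal.span {g k}) →ₗ[F] (Fin (g j).natDegree → F)) ×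
            Module.End F (Fin (g j).natDegree → F) //
          Function.Injective x.1 ∧
          (∀ s, x.1 (xEnd F (F[X] ⧸ Ideal.span {g k}) s) = x.2 (x.1 s)) ∧
          x.2.charpoly = g j} : ℝ) =
      charpolyDensity (g (j - k)) *
        Nat.card ((Fin (g j).natDegree → F) ≃ₗ[F] (Fin (g j).natDegree → F)) := by
    intro k hk
    have := finiteDimensional_quotient_span (hg k)
    have hdim : Module.finrank F (Fin (g (j - k)).natDegree → F) +
        Module.finrank F (F[X] ⧸ Ideal.span {g k}) =
        Module.finrank F (Fin (g j).natDegree → F) := by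
      rw [finrank_quotient_span (hg k), Module.finrank_fin_fun, Module.finrank_fin_fun,
        hmul k hk, (hg _).natDegree_mul (hg _)]
    have h2 := card_embeddings_mul (xEnd F (F[X] ⧸ Ideal.span {g k})) hdim (g (j - k))
    rw [charpoly_xEnd_quotient_span (hg k), ← hmul k hk] at h2
    rw [charpolyDensity, div_mul_eq_mul_div, eq_div_iff (hγ _)]
    exact h2
  rw [Finset.sum_congr rfl hterm, ← Finset.sum_mul] at h'
  have hrefl : ∑ k ∈ Finset.Iic j, charpolyDensity (g (j - k)) =
      ∑ k ∈ Finset.Iic j, charpolyDensity (g k) := by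
    refine Finset.sum_nbij' (fun k => j - k) (fun k => j - k) ?_ ?_ ?_ ?_ fun _ _ => rfl
    · intro k _; exact Finset.mem_Iic.2 (fun i => Nat.sub_le _ _)
    · intro k _; exact Finset.mem_Iic.2 (fun i => Nat.sub_le _ _)
    · intro k hk; funext i; exact Nat.sub_sub_self (Finset.mem_Iic.1 hk i)
    · intro k hk; funext i; exact Nat.sub_sub_self (Finset.mem_Iic.1 hk i)
  rw [hrefl] at h'
  rw [charpolyDensity, ← mul_div_assoc, div_eq_iff (hγ _), mul_comm, h']

/-- The local factor `q ^ (-j) / ∏ (1 - q ^ (-l))`, the product running over `1 ≤ l ≤ j`. -/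
noncomputable def localDensity (q : ℝ) (j : ℕ) : ℝ :=
  q⁻¹ ^ j / ∏ l ∈ Finset.range j, (1 - q⁻¹ ^ (l + 1))

/-- The one-variable form of the recursion for `charpolyDensity`. -/
theorem sum_localDensity {q : ℝ} (hq : 1 < q) (J : ℕ) :
    ∑ a ∈ Finset.Iic J, localDensity q a = q ^ J * localDensity q J := by
  have hq0 : 0 < q := one_pos.trans hq
  have hI : Finset.Iic J = Finset.range (J + 1) := by ext; simp
  rw [hI]
  clear hI
  induction J with
  | zero => simp [localDensity]
  | succ J ih =>
    rw [Finset.sum_range_succ, ih]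
    have h1 : 1 - q⁻¹ ^ (J + 1) ≠ 0 := (sub_pos.2 (pow_lt_one₀ (inv_pos.2 hq0).le
      (inv_lt_one_of_one_lt₀ hq) (Nat.succ_ne_zero _))).ne'
    have h2 : localDensity q (J + 1) * (1 - q⁻¹ ^ (J + 1)) = localDensity q J * q⁻¹ := by
      rw [localDensity, localDensity, Finset.prod_range_succ, ← div_div, div_mul_cancel₀ _ h1,
        pow_succ]
      ring
    have h3 : q ^ (J + 1) * q⁻¹ ^ (J + 1) = 1 := by
      rw [← mul_pow, mul_inv_cancel₀ hq0.ne', one_pow]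
    have h4 : q ^ (J + 1) * (localDensity q (J + 1) * (1 - q⁻¹ ^ (J + 1))) =
        q ^ J * localDensity q J := by
      rw [h2, pow_succ]; field_simp
    linear_combination (-1 : ℝ) * h4 - localDensity q (J + 1) * h3

/-- Both sides satisfy the same recursion. Isolating the term `k = j` leaves the nonzero factor `|F|
^ deg - 1`, so the values at smaller exponents determine the one at `j`. -/
theorem charpolyDensity_eq_prod (hirr : ∀ i, Irreducible (f i))
    (hmonic : ∀ i, (f i).Monic) (hcop : Pairwise fun i j => IsCoprime (f i) (f j)) (j : ι → ℕ) :
    charpolyDensity (∏ i, f i ^ j i) =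
      ∏ i, localDensity ((Nat.card F : ℝ) ^ (f i).natDegree) (j i) := by
  have hF : (1 : ℝ) < Nat.card F := by exact_mod_cast Finite.one_lt_card
  have hq : ∀ i, 1 < (Nat.card F : ℝ) ^ (f i).natDegree := fun i =>
    one_lt_pow₀ hF (hirr i).natDegree_pos.ne'
  have hIic : ∀ j : ι → ℕ, Finset.Iic j = Fintype.piFinset fun i => Finset.Iic (j i) := fun j => by
    ext k; simp [Pi.le_def]
  induction j using WellFoundedLT.induction with
  | ind j ih =>
    by_cases hj : j = 0
    · subst hj
      simp [charpolyDensity_one, localDensity]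
    have h1 := card_pow_mul_charpolyDensity hirr hmonic hcop j
    have h2 : ∑ k ∈ Finset.Iic j, ∏ i, localDensity ((Nat.card F : ℝ) ^ (f i).natDegree) (k i) =
        (Nat.card F : ℝ) ^ (∏ i, f i ^ j i).natDegree *
          ∏ i, localDensity ((Nat.card F : ℝ) ^ (f i).natDegree) (j i) := by
      rw [hIic, ← Finset.prod_univ_sum, natDegree_prod_pow hmonic, ← Finset.prod_pow_eq_pow_sum,
        ← Finset.prod_mul_distrib]
      refine Finset.prod_congr rfl fun i _ => ?_
      rw [sum_localDensity (hq i), ← pow_mul, mul_comm (j i)]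
    have hmem : j ∈ Finset.Iic j := Finset.mem_Iic.2 le_rfl
    rw [← Finset.add_sum_erase _ _ hmem] at h1 h2
    have h3 : ∑ k ∈ (Finset.Iic j).erase j, charpolyDensity (∏ i, f i ^ k i) =
        ∑ k ∈ (Finset.Iic j).erase j,
          ∏ i, localDensity ((Nat.card F : ℝ) ^ (f i).natDegree) (k i) :=
      Finset.sum_congr rfl fun k hk => ih k (lt_of_le_of_ne
        (Finset.mem_Iic.1 (Finset.mem_of_mem_erase hk)) (Finset.ne_of_mem_erase hk))
    have hd : (∏ i, f i ^ j i).natDegree ≠ 0 := by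
      rw [natDegree_prod_pow hmonic]
      obtain ⟨i, hi⟩ := Function.ne_iff.1 hj
      intro h0
      have := (Finset.sum_eq_zero_iff.1 h0) i (Finset.mem_univ i)
      rcases Nat.mul_eq_zero.1 this with h | h
      · exact hi h
      · exact (hirr i).natDegree_pos.ne' h
    have h4 : (Nat.card F : ℝ) ^ (∏ i, f i ^ j i).natDegree - 1 ≠ 0 :=
      (sub_pos.2 (one_lt_pow₀ hF hd)).ne'
    refine mul_left_cancel₀ h4 ?_
    linear_combination h1 + h2 + h3

end CharpolyCount

/-! ### Assembling the joint limit for weights. -/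

section MultiplicityLimit

variable {p : ℕ} [Fact p.Prime]

/-- The limiting joint distribution of the multiplicities, for independent balanced weights. -/
theorem tendsto_sum_matrixWeight_multiplicity {ι : Type*} [Fintype ι] {f : ι → (ZMod p)[X]}
    {ε : ℝ} (hε : 0 < ε) (m : ∀ n : ℕ, Fin n → Fin n → ZMod p → ℝ)
    (hm : ∀ n a b, IsBalancedWeight ε (m n a b)) (hirr : ∀ i, Irreducible (f i))
    (hmonic : ∀ i, (f i).Monic) (hcop : Pairwise fun i j => IsCoprime (f i) (f j)) (j : ι → ℕ)
    [∀ n, DecidablePred fun M : Matrix (Fin n) (Fin n) (ZMod p) =>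
      ∀ i, multiplicity (f i) M.charpoly = j i] :
    Tendsto (fun n => ∑ M with ∀ i, multiplicity (f i) M.charpoly = j i, matrixWeight (m n) M)
      atTop (𝓝 (∏ i, nuMass (f i) (j i))) := by
  classical
  have hp : 1 < p := (Fact.out : p.Prime).one_lt
  let W := Fin (∏ i, f i ^ j i).natDegree → ZMod p
  have : Finite (Module.End (ZMod p) W) := Module.finite_of_finite (ZMod p)
  have := Fintype.ofFinite {B : Module.End (ZMod p) W // B.charpoly = ∏ i, f i ^ j i}
  have hγ : (Nat.card (W ≃ₗ[ZMod p] W) : ℝ) ≠ 0 := by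
    rw [card_linearEquiv_self, Module.finrank_fin_fun]
    exact (qFalling_self_pos (by exact_mod_cast Finite.one_lt_card) _).ne'
  -- The limit does not depend on `B`, so summing over the finitely many `B` multiplies it by their
  -- number.
  have hlim := tendsto_finsetSum (Finset.univ :
    Finset {B : Module.End (ZMod p) W // B.charpoly = ∏ i, f i ^ j i}) fun B _ =>
      have : Finite (Module.AEval' B.1) := inferInstanceAs (Finite W)
      tendsto_sum_card_surjections_noResidue hε m hm (W := Module.AEval' B.1) hirr hmonic hcop
  rw [Finset.sum_const, Finset.card_univ, ← Nat.card_eq_fintype_card, nsmul_eq_mul] at hlim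
  have hlim' := hlim.div_const (Nat.card (W ≃ₗ[ZMod p] W) : ℝ)
  have hval : (Nat.card {B : Module.End (ZMod p) W // B.charpoly = ∏ i, f i ^ j i} : ℝ) *
      (∏ i, eulerValue ((p : ℝ) ^ (f i).natDegree)) / Nat.card (W ≃ₗ[ZMod p] W) =
      ∏ i, nuMass (f i) (j i) := by
    have h := charpolyDensity_eq_prod hirr hmonic hcop j
    rw [charpolyDensity] at h
    rw [mul_div_right_comm, h, ← Finset.prod_mul_distrib]
    refine Finset.prod_congr rfl fun i _ => ?_
    rw [nuMass_eq hp (hirr i).natDegree_pos, localDensity, Nat.card_zmod]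
  rw [hval] at hlim'
  refine hlim'.congr fun n => ?_
  rw [Finset.sum_comm, Finset.sum_div, Finset.sum_filter]
  refine Finset.sum_congr rfl fun M _ => ?_
  have : Finite (Module.AEval' (Matrix.toLin' M)) := inferInstanceAs (Finite (Fin n → ZMod p))
  have : FiniteDimensional (ZMod p) (Module.AEval' (Matrix.toLin' M)) :=
    inferInstanceAs (FiniteDimensional (ZMod p) (Fin n → ZMod p))
  have hfin : ∀ B : {B : Module.End (ZMod p) W // B.charpoly = ∏ i, f i ^ j i},
      Finite (Module.AEval' (Matrix.toLin' M) →ₗ[(ZMod p)[X]] Module.AEval' B.1) := fun B =>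
    have : Finite (Module.AEval' B.1) := inferInstanceAs (Finite W)
    DFunLike.finite _
  -- For each matrix the total count over `B` is `|GL(W)|` times the indicator of the event.
  have h := card_sigma_surjections_eq_ite (V := Module.AEval' (Matrix.toLin' M)) (W := W)
    hirr hmonic hcop j (Module.finrank_fin_fun _)
  rw [Nat.card_sigma, charpoly_xEnd_aeval, Matrix.charpoly_toLin'] at h
  rw [← Finset.mul_sum, ← Nat.cast_sum, h]
  split_ifs
  · rw [mul_div_assoc, div_self hγ, mul_one]
  · simp

end MultiplicityLimit

/-! ### Passage from random matrices to weights, and the point masses of the limit. -/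

section Distribution

variable {p : ℕ} [Fact p.Prime]

theorem isBalancedWeight_of_isEpsBalanced {Ω : Type*} [MeasurableSpace Ω] {P : Measure Ω}
    [IsProbabilityMeasure P] {ε : ℝ} {ξ : Ω → ZMod p} (hξ : Measurable ξ)
    (h : IsEpsBalanced P ε ξ) : IsBalancedWeight ε fun x => P.real {ω | ξ ω = x} where
  nonneg _ := measureReal_nonneg
  sum_eq_one := by
    have h1 := sum_measureReal_preimage_singleton (μ := P) (f := ξ) Finset.univ
      fun x _ => hξ (measurableSet_singleton x)
    rw [Finset.coe_univ, Set.preimage_univ, probReal_univ] at h1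
    exact h1
  le := h

theorem measureReal_matrix_eq {p : ℕ} {Ω : Type*} [MeasurableSpace Ω] {P : Measure Ω} {n : ℕ}
    {A : Ω → Matrix (Fin n) (Fin n) (ZMod p)}
    (hindep : iIndepFun (fun (ab : Fin n × Fin n) (ω : Ω) => A ω ab.1 ab.2) P)
    (M : Matrix (Fin n) (Fin n) (ZMod p)) :
    P.real {ω | A ω = M} = matrixWeight (fun a b x => P.real {ω | A ω a b = x}) M := by
  have h := hindep.measure_inter_preimage_eq_mul Finset.univ
    (sets := fun ab => {M ab.1 ab.2}) fun ab _ => measurableSet_singleton _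
  have hset : {ω | A ω = M} = ⋂ ab ∈ (Finset.univ : Finset (Fin n × Fin n)),
      (fun ω => A ω ab.1 ab.2) ⁻¹' {M ab.1 ab.2} := by
    ext ω
    simp [← Matrix.ext_iff]
  rw [measureReal_def, hset, h, ENNReal.toReal_prod, Fintype.prod_prod_type, Finset.prod_comm]
  rfl

theorem measureReal_charpolyPower_eq_sum {Ω : Type*} [MeasurableSpace Ω] {P : Measure Ω}
    [IsProbabilityMeasure P] {n : ℕ} {A : Ω → Matrix (Fin n) (Fin n) (ZMod p)}
    (hmeas : ∀ a b, Measurable fun ω => A ω a b)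
    (hindep : iIndepFun (fun (ab : Fin n × Fin n) (ω : Ω) => A ω ab.1 ab.2) P)
    {ι : Type*} (f : ι → (ZMod p)[X]) (j : ι → ℕ)
    [DecidablePred fun M : Matrix (Fin n) (Fin n) (ZMod p) =>
      ∀ i, multiplicity (f i) M.charpoly = j i] :
    P.real {ω | ∀ i, charpolyPower (f i) (A ω) = j i} =
      ∑ M with ∀ i, multiplicity (f i) M.charpoly = j i,
        matrixWeight (fun a b x => P.real {ω | A ω a b = x}) M := by
  have hM : ∀ M, MeasurableSet (A ⁻¹' {M}) := fun M => by
    have : A ⁻¹' {M} = ⋂ a, ⋂ b, (fun ω => A ω a b) ⁻¹' {M a b} := by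
      ext ω
      simp [← Matrix.ext_iff]
    rw [this]
    exact MeasurableSet.iInter fun a => MeasurableSet.iInter fun b =>
      hmeas a b (measurableSet_singleton _)
  have h1 := sum_measureReal_preimage_singleton (μ := P) (f := A)
    (Finset.univ.filter fun M => ∀ i, multiplicity (f i) M.charpoly = j i) fun M _ => hM M
  have hset : {ω | ∀ i, charpolyPower (f i) (A ω) = j i} =
      A ⁻¹' (Finset.univ.filter fun M => ∀ i, multiplicity (f i) M.charpoly = j i :
        Finset (Matrix (Fin n) (Fin n) (ZMod p))) := by
    ext ω
    simp [charpolyPower]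
  rw [hset, ← h1]
  exact Finset.sum_congr rfl fun M _ => measureReal_matrix_eq hindep M

theorem nuMass_nonneg (hp : 1 < p) (f : (ZMod p)[X]) (j : ℕ) : 0 ≤ nuMass f j := by
  have hp0 : (0 : ℝ) < p := by exact_mod_cast one_pos.trans hp
  have hle : (p : ℝ)⁻¹ ≤ 1 := inv_le_one_of_one_le₀ (by exact_mod_cast hp.le)
  refine mul_nonneg (pow_nonneg (inv_nonneg.2 hp0.le) _) (tprod_nonneg fun k => sub_nonneg.2 ?_)
  exact pow_le_one₀ (inv_nonneg.2 hp0.le) hle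

theorem nuMeasure_singleton (f : (ZMod p)[X]) (j : ℕ) :
    nuMeasure f {j} = ENNReal.ofReal (nuMass f j) := by
  rw [nuMeasure, Measure.sum_apply _ (measurableSet_singleton j), tsum_eq_single j]
  · simp
  · intro k hk
    simp [hk]

/-- Enough for the product measure of a point to be the product of masses; the total mass of
`nuMeasure` is not needed. -/
instance sigmaFinite_nuMeasure (f : (ZMod p)[X]) : SigmaFinite (nuMeasure f) := by
  refine ⟨⟨⟨fun k => {k}, fun _ => trivial, fun k => ?_, ?_⟩⟩⟩
  · rw [nuMeasure_singleton]; exact ENNReal.ofReal_lt_top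
  · exact Set.iUnion_of_singleton ℕ

theorem measureReal_pi_nuMeasure_singleton {ι : Type*} [Fintype ι] (f : ι → (ZMod p)[X])
    (j : ι → ℕ) :
    (Measure.pi fun i => nuMeasure (f i)).real {j} = ∏ i, nuMass (f i) (j i) := by
  rw [measureReal_def, Measure.pi_singleton, ENNReal.toReal_prod]
  refine Finset.prod_congr rfl fun i _ => ?_
  rw [nuMeasure_singleton, ENNReal.toReal_ofReal (nuMass_nonneg (Fact.out : p.Prime).one_lt _ _)]

end Distribution

theorem corollary1p2 (p : ℕ) [Fact p.Prime] (ε : ℝ) (hε0 : 0 < ε) (hε1 : ε ≤ 1 - 1 / (p : ℝ))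
    -- for each `n`, a random matrix `A n` with independent `ε`-balanced entries
    (Ω : ℕ → Type*) [∀ n, MeasurableSpace (Ω n)]
    (P : ∀ n, Measure (Ω n)) [∀ n, IsProbabilityMeasure (P n)]
    (A : ∀ n, Ω n → Matrix (Fin n) (Fin n) (ZMod p))
    (hmeas : ∀ (n : ℕ) (a b : Fin n), Measurable fun ω => A n ω a b)
    (hindep : ∀ n : ℕ, iIndepFun
      (fun (ab : Fin n × Fin n) (ω : Ω n) => A n ω ab.1 ab.2) (P n))
    (hbal : ∀ (n : ℕ) (a b : Fin n), IsEpsBalanced (P n) ε fun ω => A n ω a b)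
    -- distinct monic irreducible polynomials `f 0, …, f (r - 1)`
    (r : ℕ) (f : Fin r → (ZMod p)[X]) (hinj : Function.Injective f)
    (hmonic : ∀ i, (f i).Monic) (hirr : ∀ i, Irreducible (f i)) (j : Fin r → ℕ) :
    Tendsto (fun n => (P n).real {ω | ∀ i, charpolyPower (f i) (A n ω) = j i}) atTop
      (𝓝 ((Measure.pi fun i => nuMeasure (f i)).real {j})) := by
  classical
  have hcop : Pairwise fun i j => IsCoprime (f i) (f j) := fun i k hik =>
    ((hirr i).coprime_iff_not_dvd).2 fun hdvd => hik <| hinj <|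
      eq_of_monic_of_associated (hmonic i) (hmonic k) ((hirr i).associated_of_dvd (hirr k) hdvd)
  rw [measureReal_pi_nuMeasure_singleton]
  exact (tendsto_sum_matrixWeight_multiplicity hε0
    (fun n a b x => (P n).real {ω | A n ω a b = x})
    (fun n a b => isBalancedWeight_of_isEpsBalanced (hmeas n a b) (hbal n a b))
    hirr hmonic hcop j).congr fun n =>
      (measureReal_charpolyPower_eq_sum (hmeas n) (hindep n) f j).symm
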